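/- Let $Z$ be a smooth manifold of dimension $d$ (Hausdorff, second countable), with a smooth positive measure $\mu=|dz|$; in a chart, $\mu=\rho(x)\,|dx|$ with $\rho>0$ smooth. **Quantization.** On $\mathbb R^d$, $\mathrm{Op}_\varepsilon(p)$ is the operator with kernel $$[\mathrm{Op}_\varepsilon(p)](x,y)=(2\pi\varepsilon)^{-d}\int_{\mathbb R^d} e^{i\langle x-y|\xi\rangle/\varepsilon}\,p\Big(\frac{x+y}{2},\xi\Big)\,|d\xi| .$$ On $Z$ it is defined by the same formula in charts: fix smooth charts with domains $U_j$, a smooth partition of unity $(\psi_j)$ subordinate to $(U_j)$, and smooth cutoffs $0\le\chi_j\le 1$ with closed support in $U_j$ and $\chi_j=1$ on $\operatorname{supp}\psi_j$. For $a\in C_c^\infty(T^\star Z;\mathbb C)$ put $\mathrm{Op}_\varepsilon(a)=\sum_j\chi_j\,\mathrm{Op}^{(j)}_\varepsilon(\psi_j a)\,\chi_j$, where $\mathrm{Op}^{(j)}_\varepsilon$ is the above operator in the coordinates of the $j$-th chart, $L^2(|dz|)$ being identified with $L^2(|dx|)$ by $u\mapsto u\,\rho^{1/2}$. (For $Z=\mathbb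 R^d$ with Lebesgue measure, one chart and $\psi=\chi=1$, this is the formula above.) **White noise.** Let $w$ be a white noise on $L^2(Z,\mu;\mathbb C)$: a Gaussian field $e\mapsto\langle e,w\rangle$ indexed by $L^2(Z,\mu)$, with $\mathbb E\langle e,w\rangle=0$ and $\mathbb E\big(\langle e,w\rangle\overline{\langle f,w\rangle}\big)=\langle e,f\rangle$, where $\langle\cdot,\cdot\rangle$ is conjugate linear in its first entry. For a bounded operator $N$ on $L^2(Z,\mu)$, a random element $F$ of $L^2(Z,\mu)$ is said to be $Nw$ if, for every $h$, $\langle h,F\rangle=\langle N^\star h,w\rangle$ almost surely. **Power spectrum.** The Wigner measure $W_u^\varepsilon$ of $u\in L^2(Z,\mu)$ and the power spectrum $P_f^\varepsilon$ of a random field $f=(f_\varepsilon)$ are defined, for $a\in C_c^\infty(T^\star Z;\mathbb C)$, by $$\int a\,dW_u^\varepsilon=\langle u,\mathrm{Op}_\varepsilon(a)u\rangle,\qquad \int a\,dP_f^\varepsilon=\mathbb E\Big(\int a\,dW_{f_\varepsilon}^\varepsilon\Big).$$ **Proposition.** Let $n\in C_c^\infty(T^\star Z;\mathbb C)$. For every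 $\varepsilon>0$ and every $a\in C_c^\infty(T^\star Z;\mathbb C)$, $\mathrm{Op}_\varepsilon(a)$ is a well-defined bounded operator on $L^2(Z,\mu)$, and $f_\varepsilon=\mathrm{Op}_\varepsilon(n)w$ exists as a random element of $L^2(Z,\mu)$. Its power spectrum is well defined (the expectations are of integrable random variables) and satisfies $$P_f^\varepsilon\sim(2\pi\varepsilon)^{-d}\,|n|^2(x,\xi)\,|dx\,d\xi|\qquad(\varepsilon\to0^+)$$ in the weak sense: for every $a\in C_c^\infty(T^\star Z;\mathbb C)$, $$(2\pi\varepsilon)^d\int a\,dP_f^\varepsilon\;\longrightarrow\;\int_{T^\star Z}a\,|n|^2\,|dx\,d\xi|,$$ where $|dx\,d\xi|$ is the Liouville measure of $T^\star Z$. -/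

import Mathlib

open Set Filter Topology MeasureTheory ProbabilityTheory
open scoped Manifold ContDiff ENNReal

noncomputable section

namespace WignerNoise

/-- The model space `ℝ^d` with its Euclidean norm and Lebesgue measure. -/
abbrev Euc (d : ℕ) : Type := EuclideanSpace ℝ (Fin d)

/-- Charts of a `d`-dimensional manifold (open partial homeomorphisms to `ℝ^d`). -/
abbrev Chart (d : ℕ) (Z : Type*) [TopologicalSpace Z] := OpenPartialHomeomorph Z (Euc d)

/-- `e` belongs to the maximal smooth atlas of `Z`. -/
def IsSmoothChart {d : ℕ} {Z : Type*} [TopologicalSpace Z] [ChartedSpace (Euc d) Z]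
    (e : Chart d Z) : Prop :=
  e ∈ IsManifold.maximalAtlas 𝓘(ℝ, Euc d) ∞ Z

/-! ### Phase space -/

/-- The cotangent bundle `T^*Z`, the bundle of continuous linear forms on the tangent spaces. -/
abbrev CotangentBundle (d : ℕ) (Z : Type*) [TopologicalSpace Z] [ChartedSpace (Euc d) Z]
    [IsManifold 𝓘(ℝ, Euc d) ∞ Z] :=
  Bundle.TotalSpace (Euc d →L[ℝ] ℝ)
    (fun z : Z => TangentSpace 𝓘(ℝ, Euc d) z →L[ℝ] Bundle.Trivial Z ℝ z)

section PhaseSpace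

variable {d : ℕ} {Z : Type*} [TopologicalSpace Z] [ChartedSpace (Euc d) Z]
  [IsManifold 𝓘(ℝ, Euc d) ∞ Z]

instance : MeasurableSpace (CotangentBundle d Z) := borel _

instance : BorelSpace (CotangentBundle d Z) := ⟨rfl⟩

/-- The canonical coordinates on `T^*Z` attached to a chart `e` of `Z`: the point with coordinates
`(x, ξ)`, `x ∈ e.target`, is the covector `∑ ξ_k dx_k` at `e⁻¹(x)`. -/
def canonicalCoord (e : Chart d Z) (q : Euc d × Euc d) : CotangentBundle d Z :=
  ⟨e.symm q.1,
    (innerSL ℝ q.2).comp (mfderiv 𝓘(ℝ, Euc d) 𝓘(ℝ, Euc d) e (e.symm q.1))⟩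

/-- Smooth compactly supported complex functions on `T^*Z`. -/
def IsTestSymbol (a : CotangentBundle d Z → ℂ) : Prop :=
  ContMDiff (𝓘(ℝ, Euc d).prod 𝓘(ℝ, Euc d →L[ℝ] ℝ)) 𝓘(ℝ, ℂ) ∞ a ∧ HasCompactSupport a

variable (d Z) in
/-- The Liouville measure `|dx dξ|` on `T^*Z`: the measure which is Lebesgue measure in all
canonical coordinates (the supremum glues the measures given by the individual charts, which agree
on overlaps). -/
def liouville : Measure (CotangentBundle d Z) :=
  ⨆ e : {e : Chart d Z // IsSmoothChart e},
    ((volume : Measure (Euc d × Euc d)).restrict (e.1.target ×ˢ univ)).map (canonicalCoord e.1)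

/-- The function `a` in the canonical coordinates of the chart `e`, extended by zero outside of the
domain of these coordinates. -/
def localSymbol (e : Chart d Z) (a : CotangentBundle d Z → ℂ) (x ξ : Euc d) : ℂ :=
  e.target.indicator (fun y => a (canonicalCoord e (y, ξ))) x

end PhaseSpace

/-! ### Smooth measures on `Z` -/

/-- `μ` is a smooth positive measure on `Z`: in every smooth chart `e` it is `ρ e (x) |dx|` with a
smooth positive density `ρ e`. -/
structure IsSmoothMeasure {d : ℕ} {Z : Type*} [TopologicalSpace Z] [ChartedSpace (Euc d) Z]
    [MeasurableSpace Z] (μ : Measure Z) (ρ : Chart d Z → Euc d → ℝ) : Prop where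
  smooth : ∀ e : Chart d Z, IsSmoothChart e → ContDiffOn ℝ ∞ (ρ e) e.target
  pos : ∀ e : Chart d Z, IsSmoothChart e → ∀ x ∈ e.target, 0 < ρ e x
  map_eq : ∀ e : Chart d Z, IsSmoothChart e →
    (μ.restrict e.source).map e =
      (volume.restrict e.target).withDensity (fun x => ENNReal.ofReal (ρ e x))

/-! ### `ε`-pseudo-differential operators -/

/-- The kernel `(2πε)^{-d} ∫ e^{i⟨x - y, ξ⟩/ε} p((x + y)/2, ξ) dξ` of the `ε`-pseudo-differential
operator on `ℝ^d` with symbol `p`. -/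
def weylKernel {d : ℕ} (ε : ℝ) (p : Euc d → Euc d → ℂ) (x y : Euc d) : ℂ :=
  (((2 * Real.pi * ε) ^ d)⁻¹ : ℝ) *
    ∫ ξ : Euc d, Complex.exp (Complex.I * ((inner ℝ (x - y) ξ / ε : ℝ) : ℂ)) *
      p ((2⁻¹ : ℝ) • (x + y)) ξ

/-- The choices which fix a quantization `a ↦ Op_ε(a)` on `Z`: smooth charts, a smooth partition of
unity `ψ_j` subordinate to their domains, and smooth cutoffs `χ_j` supported in
these domains with `χ_j = 1` on the support of `ψ_j`. -/
structure QuantizationAtlas (d : ℕ) (Z : Type*) [TopologicalSpace Z] [ChartedSpace (Euc d) Z]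
    (ι : Type*) where
  chart : ι → Chart d Z
  isSmoothChart : ∀ j, IsSmoothChart (chart j)
  ψ : SmoothPartitionOfUnity ι 𝓘(ℝ, Euc d) Z univ
  ψ_subordinate : ψ.IsSubordinate (fun j => (chart j).source)
  χ : ι → Z → ℝ
  χ_smooth : ∀ j, ContMDiff 𝓘(ℝ, Euc d) 𝓘(ℝ, ℝ) ∞ (χ j)
  χ_support : ∀ j, tsupport (χ j) ⊆ (chart j).source
  χ_mem : ∀ j z, χ j z ∈ Icc (0 : ℝ) 1
  χ_eq_one : ∀ j, ∀ z ∈ tsupport (ψ j), χ j z = 1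

section Operators

variable {d : ℕ} {Z : Type*} [TopologicalSpace Z] [ChartedSpace (Euc d) Z]
  [IsManifold 𝓘(ℝ, Euc d) ∞ Z] {ι : Type*}

/-- The Schwartz kernel of `Op_ε(a)` with respect to the measure `|dz|` on `Z`.
`Op_ε(a) = ∑_j χ_j Op_ε(ψ_j a) χ_j`, where the `j`-th operator is given by the kernel on `ℝ^d` in
the coordinates of the `j`-th chart; half-densities `u |dz|^{1/2} = u ρ^{1/2} |dx|^{1/2}` identify
`L²(|dz|)` with `L²(|dx|)` there. -/
def opKernel (Q : QuantizationAtlas d Z ι) (ρ : Chart d Z → Euc d → ℝ) (ε : ℝ)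
    (a : CotangentBundle d Z → ℂ) (z z' : Z) : ℂ :=
  ∑ᶠ j : ι,
    ((Q.χ j z * Q.χ j z' *
      (Real.sqrt (ρ (Q.chart j) (Q.chart j z)))⁻¹ *
      (Real.sqrt (ρ (Q.chart j) (Q.chart j z')))⁻¹ : ℝ) : ℂ) *
    weylKernel ε (localSymbol (Q.chart j) (fun p => (Q.ψ j p.proj : ℂ) * a p))
      (Q.chart j z) (Q.chart j z')

/-- `A` is the integral operator on `L²(μ)` with kernel `K`. -/
def HasKernel [MeasurableSpace Z] (μ : Measure Z) (K : Z → Z → ℂ)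
    (A : Lp ℂ 2 μ →L[ℂ] Lp ℂ 2 μ) : Prop :=
  ∀ u : Lp ℂ 2 μ, ∀ᵐ z ∂μ,
    Integrable (fun z' => K z z' * u z') μ ∧ A u z = ∫ z', K z z' * u z' ∂μ

open Classical in
/-- The bounded operator on `L²(μ)` with kernel `K` (zero if there is none). -/
def kernelOperator [MeasurableSpace Z] (μ : Measure Z) (K : Z → Z → ℂ) :
    Lp ℂ 2 μ →L[ℂ] Lp ℂ 2 μ :=
  if h : ∃ A, HasKernel μ K A then h.choose else 0

/-- The operator `Op_ε(a)` on `L²(Z, μ)`. -/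
def opε [MeasurableSpace Z] (Q : QuantizationAtlas d Z ι) (μ : Measure Z)
    (ρ : Chart d Z → Euc d → ℝ) (ε : ℝ) (a : CotangentBundle d Z → ℂ) :
    Lp ℂ 2 μ →L[ℂ] Lp ℂ 2 μ :=
  kernelOperator μ (opKernel Q ρ ε a)

end Operators

/-! ### White noise and random fields -/

section Fields

variable {𝓗 : Type*} [NormedAddCommGroup 𝓗] [InnerProductSpace ℂ 𝓗]
  {Ω : Type*} [MeasurableSpace Ω]

/-- White noise on a Hilbert space: the Gaussian field `e ↦ w e`, where `w e` stands for the
pairing `⟨e, w⟩` (conjugate linear in `e`), which is centred with covariance the scalar product. -/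
structure IsWhiteNoise (P : Measure Ω) (w : 𝓗 → Ω → ℂ) : Prop where
  gaussian : IsGaussianProcess w P
  mean : ∀ e, ∫ t, w e t ∂P = 0
  covariance : ∀ e f, ∫ t, w e t * (starRingEnd ℂ) (w f t) ∂P = inner ℂ e f

/-- The `𝓗`-valued random variable `F` is the image `N w` of the field `w` under the operator `N`:
`⟨h, F⟩ = ⟨N^* h, w⟩` almost surely, for every `h`. -/
def IsImage [CompleteSpace 𝓗] (P : Measure Ω) (w : 𝓗 → Ω → ℂ) (N : 𝓗 →L[ℂ] 𝓗)
    (F : Ω → 𝓗) : Prop :=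
  AEStronglyMeasurable F P ∧
    ∀ h : 𝓗, (fun t => inner ℂ h (F t)) =ᵐ[P] w (ContinuousLinearMap.adjoint N h)

end Fields

section Wigner

variable {d : ℕ} {Z : Type*} [TopologicalSpace Z] [ChartedSpace (Euc d) Z]
  [IsManifold 𝓘(ℝ, Euc d) ∞ Z] [MeasurableSpace Z] {ι : Type*}

/-- The Wigner measure of `u`, as a functional of the observable `a`:
`∫ a dW_u^ε = ⟨Op_ε(a) u | u⟩`, the scalar product being linear in the entry `Op_ε(a) u`. -/
def wigner (Q : QuantizationAtlas d Z ι) (μ : Measure Z) (ρ : Chart d Z → Euc d → ℝ) (ε : ℝ)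
    (u : Lp ℂ 2 μ) (a : CotangentBundle d Z → ℂ) : ℂ :=
  inner ℂ u (opε Q μ ρ ε a u)

/-- The power spectrum of a random field `F` at scale `ε`: the expectation of its Wigner measure. -/
def powerSpectrum (Q : QuantizationAtlas d Z ι) (μ : Measure Z) (ρ : Chart d Z → Euc d → ℝ)
    (ε : ℝ) {Ω : Type*} [MeasurableSpace Ω] (P : Measure Ω) (F : Ω → Lp ℂ 2 μ)
    (a : CotangentBundle d Z → ℂ) : ℂ :=
  ∫ t, wigner Q μ ρ ε (F t) a ∂P

end Wigner

end WignerNoise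

end

/-!
# The power spectrum of a white noise filtered by a semiclassical operator

Write `h = 2πε`. The mean value of the quadratic functional `⟨F, A F⟩` of the field `F = N w` only
involves the covariance of `w`: it is `Tr(A N N^*)`, so that for `A = Op_ε(a)` and `N = Op_ε(n)` the
assertion is the semiclassical trace formula `h^d Tr(A N N^*) → ∫ a |n|² dx dξ`.

*Probability.* White noise is a conjugate linear isometry into the square integrable random
variables, so a Hilbert–Schmidt operator maps it to a genuine random vector
(`IsWhiteNoise.exists_isImage`). Expanding `⟨F, A F⟩` along a Hilbert basis shows that its mean is
the same for every field with the covariance of `F`, random or not (`IsImage.integral_inner_eq`);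
the columns `z ↦ K(·, z)` of the kernel of `N`, as a field on `(Z, μ)`, have this covariance. This
gives the trace as an integral of kernels over `Z³` (`integral_inner_isImage`). By the
Cauchy–Schwarz inequality such a triple integral is bounded by the three Hilbert–Schmidt norms
(`lintegral_traceIntegrand_sq_le`).

*Kernels.* In a chart, the kernel of the operator with symbol `p` is
`h^{-d} (𝓕 p((x + y)/2, ·))((y - x)/h)`. Since the partial Fourier transform decays rapidly, the
square of its Hilbert–Schmidt norm is `O(h^{-d})`, and it tends to zero for the part of the kernel
at a distance at least `δ` from the diagonal (`IsLocalSymbol.tendsto_hsNormSq_sub_truncKernel`). Hence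
the kernels can be cut off near the diagonal, where they live on compact subsets of the charts.

*The limit.* For three symbols localized in three charts, the points `y` and `z` of the triple
integral over `(x, y, z)` are rescaled in the charts around `x`, with variables `s` and `r`. By
dominated convergence the limit is an integral over `x` of
`∫∫ (𝓕 p₁)(s) (𝓕 p₂)(M r - L s) conj ((𝓕 p₃)(r)) ds dr`, where `L` and `M` are the derivatives of
the changes of charts (`tendsto_integral_traceIntegrand_nearKernel`). A covector transforms by the
adjoint of this derivative, so the convolution theorem and Plancherel's formula turn the double
integral into the integral over the fibre of the product of the three symbols
(`integral_fourier_trilinear_comp`). The powers of the density `ρ` cancel against `μ`, which leaves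
Lebesgue measure in canonical coordinates, that is, the Liouville measure (`liouville_restrict`).
Summing over the pieces of the partition of unity gives the result
(`tendsto_integral_traceIntegrand_opKernel`).
-/

noncomputable section

namespace WignerNoise

open scoped FourierTransform

/-! ### Quadratic functionals of fields with values in a Hilbert space -/

section Hilbert

variable {H : Type*} [NormedAddCommGroup H] [InnerProductSpace ℂ H]

variable (H) in
theorem exists_countable_hilbertBasis [CompleteSpace H] [SecondCountableTopology H] :
    ∃ (s : Set H) (_ : HilbertBasis s ℂ H), Countable s := by
  obtain ⟨s, b, hb⟩ := exists_hilbertBasis ℂ H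
  refine ⟨s, b, ?_⟩
  have ho : Orthonormal ℂ ((↑) : s → H) := hb ▸ b.orthonormal
  -- the balls of radius `1/2` around orthonormal vectors are disjoint
  have hdisj : s.PairwiseDisjoint (fun v => Metric.ball v (1 / 2)) := by
    intro u hu v hv huv
    apply Metric.ball_disjoint_ball
    have h1 : ‖u - v‖ ^ 2 = 2 := by
      have h0 : inner ℂ u v = 0 := ho.2 (i := ⟨u, hu⟩) (j := ⟨v, hv⟩) (by simpa using huv)
      have hu1 : ‖u‖ = 1 := ho.1 ⟨u, hu⟩
      have hv1 : ‖v‖ = 1 := ho.1 ⟨v, hv⟩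
      rw [@norm_sub_sq ℂ, h0, hu1, hv1]; norm_num
    rw [dist_eq_norm]
    nlinarith [norm_nonneg (u - v)]
  exact (hdisj.countable_of_isOpen (fun _ _ => Metric.isOpen_ball)
    (fun v _ => ⟨v, by simp⟩)).to_subtype

variable {κ : Type*} (b : HilbertBasis κ ℂ H)

theorem hasSum_norm_inner_sq (x : H) : HasSum (fun k => ‖inner ℂ (b k) x‖ ^ 2) (‖x‖ ^ 2) := by
  have h := b.hasSum_inner_mul_inner x x
  have h2 : HasSum (fun k => ((‖inner ℂ (b k) x‖ ^ 2 : ℝ) : ℂ)) ((‖x‖ ^ 2 : ℝ) : ℂ) := by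
    have e1 : (fun k => ((‖inner ℂ (b k) x‖ ^ 2 : ℝ) : ℂ)) =
        fun k => inner ℂ x (b k) * inner ℂ (b k) x := by
      funext k
      rw [← inner_conj_symm x (b k), Complex.conj_mul']
      push_cast; rfl
    have e2 : ((‖x‖ ^ 2 : ℝ) : ℂ) = inner ℂ x x := by
      rw [inner_self_eq_norm_sq_to_K]; push_cast; rfl
    rw [e1, e2]
    exact h
  exact_mod_cast h2

variable {X : Type*} [MeasurableSpace X] {m : Measure X} {G : X → H}

/-- The index set is only assumed to be countable: the partial sums over its finite subsets converge
along a countably generated filter. -/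
theorem aestronglyMeasurable_of_hasSum [Countable κ] {F : Type*} [NormedAddCommGroup F]
    {f : κ → X → F} {g : X → F} (hf : ∀ k, AEStronglyMeasurable (f k) m)
    (h : ∀ x, HasSum (fun k => f k x) (g x)) : AEStronglyMeasurable g m := by
  refine aestronglyMeasurable_of_tendsto_ae (u := (atTop : Filter (Finset κ)))
    (f := fun s x => ∑ k ∈ s, f k x) ?_ (ae_of_all _ h)
  intro s
  exact Finset.aestronglyMeasurable_fun_sum s (fun k _ => hf k)

include b in
theorem aestronglyMeasurable_norm_sq_of_inner [Countable κ]
    (hG : ∀ h, AEStronglyMeasurable (fun x => inner ℂ h (G x)) m) :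
    AEStronglyMeasurable (fun x => ‖G x‖ ^ 2) m :=
  aestronglyMeasurable_of_hasSum (fun k => (hG (b k)).norm.pow 2)
    (fun x => hasSum_norm_inner_sq b (G x))

/-- Expansion of a quadratic functional of a weakly measurable square integrable vector field
along a Hilbert basis. Only the scalars `⟨h, G⟩` enter the sum, so that two fields with the same
covariance have the same mean quadratic functionals. -/
theorem integrable_and_hasSum_integral_inner [CompleteSpace H] [Countable κ]
    (hG : ∀ h, AEStronglyMeasurable (fun x => inner ℂ h (G x)) m)
    (hG2 : Integrable (fun x => ‖G x‖ ^ 2) m) (A : H →L[ℂ] H) :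
    Integrable (fun x => inner ℂ (G x) (A (G x))) m ∧
    HasSum (fun k => ∫ x, inner ℂ (ContinuousLinearMap.adjoint A (b k)) (G x) *
        (starRingEnd ℂ) (inner ℂ (b k) (G x)) ∂m)
      (∫ x, inner ℂ (G x) (A (G x)) ∂m) := by
  have hsum : ∀ x, HasSum (fun k => inner ℂ (ContinuousLinearMap.adjoint A (b k)) (G x) *
        (starRingEnd ℂ) (inner ℂ (b k) (G x))) (inner ℂ (G x) (A (G x))) := by
    intro x
    simp_rw [ContinuousLinearMap.adjoint_inner_left, inner_conj_symm, mul_comm]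
    exact b.hasSum_inner_mul_inner (G x) (A (G x))
  have hmk : ∀ k, AEStronglyMeasurable (fun x =>
      inner ℂ (ContinuousLinearMap.adjoint A (b k)) (G x) *
        (starRingEnd ℂ) (inner ℂ (b k) (G x))) m := fun k =>
    (hG _).mul (Complex.continuous_conj.comp_aestronglyMeasurable (hG _))
  have hAG : ∀ h, AEStronglyMeasurable (fun x => inner ℂ h (A (G x))) m := by
    intro h
    simpa only [ContinuousLinearMap.adjoint_inner_left] using hG (ContinuousLinearMap.adjoint A h)
  have hAG2 : Integrable (fun x => ‖A (G x)‖ ^ 2) m := by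
    refine (hG2.const_mul (‖A‖ ^ 2)).mono' (aestronglyMeasurable_norm_sq_of_inner b hAG)
      (ae_of_all _ fun x => ?_)
    rw [Real.norm_of_nonneg (by positivity), ← mul_pow]
    gcongr
    exact A.le_opNorm _
  refine ⟨?_, ?_⟩
  · refine (hG2.const_mul ‖A‖).mono' (aestronglyMeasurable_of_hasSum hmk hsum)
      (ae_of_all _ fun x => ?_)
    calc ‖inner ℂ (G x) (A (G x))‖ ≤ ‖G x‖ * ‖A (G x)‖ := norm_inner_le_norm _ _
      _ ≤ ‖G x‖ * (‖A‖ * ‖G x‖) := by gcongr; exact A.le_opNorm _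
      _ = ‖A‖ * ‖G x‖ ^ 2 := by ring
  · -- `|u v| ≤ |u|² + |v|²` dominates the terms by the squared coordinates of `A G` and `G`
    have hb : ∀ x, HasSum (fun k => (‖inner ℂ (b k) (A (G x))‖ ^ 2 + ‖inner ℂ (b k) (G x)‖ ^ 2))
        (‖A (G x)‖ ^ 2 + ‖G x‖ ^ 2) := fun x =>
      (hasSum_norm_inner_sq b _).add (hasSum_norm_inner_sq b _)
    refine hasSum_integral_of_dominated_convergence
      (fun k x => ‖inner ℂ (b k) (A (G x))‖ ^ 2 + ‖inner ℂ (b k) (G x)‖ ^ 2) hmk ?_ ?_ ?_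
      (ae_of_all _ hsum)
    · intro k
      refine ae_of_all _ fun x => ?_
      rw [norm_mul, RCLike.norm_conj, ContinuousLinearMap.adjoint_inner_left]
      nlinarith [sq_nonneg (‖inner ℂ (b k) (A (G x))‖ - ‖inner ℂ (b k) (G x)‖),
        sq_nonneg (‖inner ℂ (b k) (A (G x))‖ + ‖inner ℂ (b k) (G x)‖)]
    · exact ae_of_all _ fun x => (hb x).summable
    · simp_rw [fun x => (hb x).tsum_eq]
      exact hAG2.add hG2

theorem lintegral_enorm_sq_eq_tsum [Countable κ]
    (hG : ∀ h, AEStronglyMeasurable (fun x => inner ℂ h (G x)) m) :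
    ∫⁻ x, ENNReal.ofReal (‖G x‖ ^ 2) ∂m =
      ∑' k, ∫⁻ x, ENNReal.ofReal (‖inner ℂ (b k) (G x)‖ ^ 2) ∂m := by
  rw [← lintegral_tsum]
  · refine lintegral_congr fun x => ?_
    have h := hasSum_norm_inner_sq b (G x)
    rw [← h.tsum_eq, ENNReal.ofReal_tsum_of_nonneg (fun k => by positivity) h.summable]
  · intro k
    exact ((hG (b k)).norm.pow 2).aemeasurable.ennreal_ofReal

end Hilbert

/-! ### White noise and its images under Hilbert–Schmidt operators -/

section WhiteNoise

variable {H : Type*} [NormedAddCommGroup H] [InnerProductSpace ℂ H]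
  {Ω : Type*} [MeasurableSpace Ω] {P : Measure Ω} {w : H → Ω → ℂ}

/-- Gaussian variables are square integrable, so the covariances in the definition of white noise
are integrals of integrable functions. -/
theorem IsWhiteNoise.memLp (hw : IsWhiteNoise P w) (e : H) : MemLp (w e) 2 P := by
  have h := (hw.gaussian.hasGaussianLaw {e}).memLp_two
  have h2 := h.eval ⟨e, by simp⟩
  exact h2

/-- White noise as a conjugate linear isometry into the square integrable random variables. -/
def IsWhiteNoise.isometry (hw : IsWhiteNoise P w) : H →ₛₗᵢ[starRingEnd ℂ] Lp ℂ 2 P :=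
  have hin : ∀ e f, inner ℂ ((hw.memLp e).toLp) ((hw.memLp f).toLp) = inner ℂ f e := by
    intro e f
    rw [L2.inner_def, ← hw.covariance]
    refine integral_congr_ae ?_
    filter_upwards [(hw.memLp e).coeFn_toLp, (hw.memLp f).coeFn_toLp] with t h1 h2
    rw [h1, h2, RCLike.inner_apply]
  { toFun := fun e => (hw.memLp e).toLp
    -- the covariance forces linearity: `‖w (e + f) - w e - w f‖² = 0` in `L²`
    map_add' := fun e f => by
      rw [← sub_eq_zero, ← @inner_self_eq_zero ℂ]
      simp only [inner_sub_left, inner_sub_right, inner_add_left, inner_add_right, hin]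
      ring
    map_smul' := fun c f => by
      rw [← sub_eq_zero, ← @inner_self_eq_zero ℂ]
      simp only [inner_sub_left, inner_sub_right, inner_smul_left, inner_smul_right, hin,
        Complex.conj_conj]
      ring
    norm_map' := fun e => by
      have h := hin e e
      rw [inner_self_eq_norm_sq_to_K, inner_self_eq_norm_sq_to_K] at h
      have h2 : ‖(hw.memLp e).toLp‖ ^ 2 = ‖e‖ ^ 2 := by exact_mod_cast h
      exact (sq_eq_sq₀ (norm_nonneg _) (norm_nonneg _)).1 h2 }

theorem IsWhiteNoise.coeFn_isometry (hw : IsWhiteNoise P w) (e : H) : hw.isometry e =ᵐ[P] w e :=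
  (hw.memLp e).coeFn_toLp

variable [CompleteSpace H] {κ : Type*} (b : HilbertBasis κ ℂ H)

/-- A Hilbert–Schmidt operator maps white noise to a genuine random vector: the series
`∑ ⟨N^* b_k, w⟩ b_k` converges almost surely. -/
theorem IsWhiteNoise.exists_isImage [Countable κ] (hw : IsWhiteNoise P w) (N : H →L[ℂ] H)
    (hN : Summable (fun k => ‖ContinuousLinearMap.adjoint N (b k)‖ ^ 2)) :
    ∃ F : Ω → H, IsImage P w N F := by
  classical
  set Na := ContinuousLinearMap.adjoint N
  have hint : ∀ e, ∫⁻ t, ENNReal.ofReal (‖w e t‖ ^ 2) ∂P = ENNReal.ofReal (‖e‖ ^ 2) := by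
    intro e
    rw [← ofReal_integral_eq_lintegral_ofReal]
    · congr 1
      have h := hw.covariance e e
      rw [inner_self_eq_norm_sq_to_K] at h
      have h2 : ((∫ t, ‖w e t‖ ^ 2 ∂P : ℝ) : ℂ) = ((‖e‖ ^ 2 : ℝ) : ℂ) := by
        rw [← integral_complex_ofReal]
        push_cast
        refine Eq.trans ?_ h
        refine integral_congr_ae (ae_of_all _ fun t => ?_)
        simp only [Complex.mul_conj']
      exact_mod_cast h2
    · exact (hw.memLp e).integrable_norm_pow (by norm_num)
    · exact ae_of_all _ fun t => by positivity
  -- the mean of the sum of the squared coefficients is the squared Hilbert–Schmidt norm of `N`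
  have hsq : ∀ᵐ t ∂P, Summable (fun k => ‖w (Na (b k)) t‖ ^ 2) := by
    have h1 : ∫⁻ t, ∑' k, ENNReal.ofReal (‖w (Na (b k)) t‖ ^ 2) ∂P ≠ ⊤ := by
      rw [lintegral_tsum]
      · simp_rw [hint]
        exact hN.tsum_ofReal_ne_top
      · intro k
        exact ((hw.memLp _).1.norm.pow 2).aemeasurable.ennreal_ofReal
    have h2 := ae_lt_top' (AEMeasurable.tsum fun k =>
      ((hw.memLp (Na (b k))).1.norm.pow 2).aemeasurable.ennreal_ofReal) h1
    filter_upwards [h2] with t ht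
    have := ENNReal.summable_toReal ht.ne
    refine this.congr fun k => ?_
    exact ENNReal.toReal_ofReal (sq_nonneg ‖w (Na (b k)) t‖)
  let F : Ω → H := fun t =>
    if h : Memℓp (fun k => w (Na (b k)) t) 2 then b.repr.symm ⟨_, h⟩ else 0
  have hF : ∀ᵐ t ∂P, HasSum (fun k => w (Na (b k)) t • b k) (F t) := by
    filter_upwards [hsq] with t ht
    have hm : Memℓp (fun k => w (Na (b k)) t) 2 := by
      refine memℓp_gen ?_
      refine ht.congr fun k => ?_
      simp
    simp only [F, dif_pos hm]
    exact b.hasSum_repr_symm ⟨_, hm⟩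
  have hmeas : AEStronglyMeasurable F P := by
    refine aestronglyMeasurable_of_tendsto_ae (u := (atTop : Filter (Finset κ)))
      (f := fun s t => ∑ k ∈ s, w (Na (b k)) t • b k) ?_ hF
    intro s
    exact Finset.aestronglyMeasurable_fun_sum s (fun k _ => (hw.memLp _).1.smul_const _)
  refine ⟨F, hmeas, fun h => ?_⟩
  -- the partial sums of `⟨h, F⟩` converge to `⟨N^* h, w⟩` in `L²`, hence in measure
  let S : Finset κ → Ω → ℂ := fun s t => ∑ k ∈ s, w (Na (b k)) t * inner ℂ h (b k)
  have h1 : TendstoInMeasure P S atTop (w (Na h)) := by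
    have hlim : Tendsto (fun s : Finset κ => hw.isometry (Na (∑ k ∈ s, b.repr h k • b k))) atTop
        (𝓝 (hw.isometry (Na h))) :=
      ((hw.isometry.continuous.comp Na.continuous).tendsto h).comp (b.hasSum_repr h)
    have h3 := tendstoInMeasure_of_tendsto_Lp hlim
    refine h3.congr (fun s => ?_) (hw.coeFn_isometry _)
    have h4 : hw.isometry (Na (∑ k ∈ s, b.repr h k • b k)) =
        ∑ k ∈ s, (inner ℂ h (b k)) • hw.isometry (Na (b k)) := by
      rw [map_sum, map_sum]
      refine Finset.sum_congr rfl fun k _ => ?_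
      rw [map_smul, LinearIsometry.map_smulₛₗ, b.repr_apply_apply, inner_conj_symm]
    rw [h4]
    have h5 : ∀ k ∈ s, (inner ℂ h (b k) • hw.isometry (Na (b k)) : Lp ℂ 2 P) =ᵐ[P]
        fun t => w (Na (b k)) t * inner ℂ h (b k) := by
      intro k _
      filter_upwards [Lp.coeFn_smul (inner ℂ h (b k)) (hw.isometry (Na (b k))),
        hw.coeFn_isometry (Na (b k))] with t h6 h7
      rw [h6, Pi.smul_apply, h7, smul_eq_mul, mul_comm]
    have h6 := Lp.coeFn_finsetSum s (fun k => (inner ℂ h (b k) • hw.isometry (Na (b k)) : Lp ℂ 2 P))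
    have h7 : ∀ᵐ t ∂P, ∀ k ∈ s, (inner ℂ h (b k) • hw.isometry (Na (b k)) : Lp ℂ 2 P) t =
        w (Na (b k)) t * inner ℂ h (b k) := (Finset.eventually_all s).2 h5
    filter_upwards [h6, h7] with t h8 h9
    rw [h8]
    simp only [S, Finset.sum_apply]
    exact Finset.sum_congr rfl h9
  obtain ⟨ns, hns, hae⟩ := h1.exists_seq_tendsto_ae'
  filter_upwards [hae, hF] with t h2 h3
  refine tendsto_nhds_unique ?_ h2
  have h4 : HasSum (fun k => w (Na (b k)) t * inner ℂ h (b k)) (inner ℂ h (F t)) := by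
    simpa only [Function.comp_def, innerSL_apply_apply, inner_smul_right] using
      (innerSL ℂ h).hasSum h3
  exact h4.comp hns

include b in
/-- The mean quadratic functionals of `N w` are computed from any deterministic field `c` which
has the same covariance. -/
theorem IsImage.integral_inner_eq [Countable κ] (hw : IsWhiteNoise P w) {N : H →L[ℂ] H} {F : Ω → H}
    (hF : IsImage P w N F) {Y : Type*} [MeasurableSpace Y] {m : Measure Y} {c : Y → H}
    (hc : ∀ h, AEStronglyMeasurable (fun y => inner ℂ h (c y)) m)
    (hc2 : Integrable (fun y => ‖c y‖ ^ 2) m)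
    (hcov : ∀ h h', ∫ y, inner ℂ h (c y) * (starRingEnd ℂ) (inner ℂ h' (c y)) ∂m =
      inner ℂ (ContinuousLinearMap.adjoint N h) (ContinuousLinearMap.adjoint N h'))
    (A : H →L[ℂ] H) :
    Integrable (fun t => inner ℂ (F t) (A (F t))) P ∧
      ∫ t, inner ℂ (F t) (A (F t)) ∂P = ∫ y, inner ℂ (c y) (A (c y)) ∂m := by
  have hFm : ∀ h, AEStronglyMeasurable (fun t => inner ℂ h (F t)) P := fun h =>
    ((hw.memLp _).1).congr (hF.2 h).symm
  have hcovF : ∀ h h', ∫ t, inner ℂ h (F t) * (starRingEnd ℂ) (inner ℂ h' (F t)) ∂P =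
      ∫ y, inner ℂ h (c y) * (starRingEnd ℂ) (inner ℂ h' (c y)) ∂m := by
    intro h h'
    rw [hcov, ← hw.covariance]
    refine integral_congr_ae ?_
    filter_upwards [hF.2 h, hF.2 h'] with t h1 h2
    rw [h1, h2]
  have hck : ∀ k, Integrable (fun y => ‖inner ℂ (b k) (c y)‖ ^ 2) m := by
    intro k
    refine (hc2.const_mul (‖b k‖ ^ 2)).mono' ((hc _).norm.pow 2) (ae_of_all _ fun y => ?_)
    rw [Real.norm_of_nonneg (by positivity), ← mul_pow]
    gcongr
    exact norm_inner_le_norm _ _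
  have hFk : ∀ k, Integrable (fun t => ‖inner ℂ (b k) (F t)‖ ^ 2) P := by
    intro k
    refine ((hw.memLp (ContinuousLinearMap.adjoint N (b k))).integrable_norm_pow
      (by norm_num)).congr ?_
    filter_upwards [hF.2 (b k)] with t ht
    rw [ht]
  -- the second moment of `F` is the sum of the second moments of its coordinates, and these are
  -- those of `c`
  have hF2 : Integrable (fun t => ‖F t‖ ^ 2) P := by
    refine ⟨aestronglyMeasurable_norm_sq_of_inner b hFm, ?_⟩
    rw [hasFiniteIntegral_iff_ofReal (ae_of_all _ fun t => by positivity)]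
    have hcfin := hc2.2
    rw [hasFiniteIntegral_iff_ofReal (ae_of_all _ fun t => by positivity)] at hcfin
    refine lt_of_eq_of_lt ?_ hcfin
    rw [lintegral_enorm_sq_eq_tsum b hFm, lintegral_enorm_sq_eq_tsum b hc]
    congr 1
    funext k
    rw [← ofReal_integral_eq_lintegral_ofReal (hFk k) (ae_of_all _ fun t => by positivity),
      ← ofReal_integral_eq_lintegral_ofReal (hck k) (ae_of_all _ fun t => by positivity)]
    congr 1
    have h := hcovF (b k) (b k)
    simp_rw [Complex.mul_conj'] at h
    have h1 : ((∫ t, ‖inner ℂ (b k) (F t)‖ ^ 2 ∂P : ℝ) : ℂ) =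
        ((∫ y, ‖inner ℂ (b k) (c y)‖ ^ 2 ∂m : ℝ) : ℂ) := by
      rw [← integral_complex_ofReal, ← integral_complex_ofReal]
      push_cast
      exact h
    exact_mod_cast h1
  obtain ⟨hi, hs⟩ := integrable_and_hasSum_integral_inner b hFm hF2 A
  obtain ⟨-, hs'⟩ := integrable_and_hasSum_integral_inner b hc hc2 A
  refine ⟨hi, hs.unique ?_⟩
  simp_rw [hcovF]
  exact hs'

end WhiteNoise

/-! ### Hilbert–Schmidt kernels and traces of three factors -/

section Schmidt

variable {Z : Type*} [MeasurableSpace Z] {μ : Measure Z}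

theorem lintegral_mul_sq_le {X : Type*} [MeasurableSpace X] {m : Measure X} {f g : X → ℝ≥0∞}
    (hf : AEMeasurable f m) (hg : AEMeasurable g m) :
    (∫⁻ x, f x * g x ∂m) ^ 2 ≤ (∫⁻ x, f x ^ 2 ∂m) * ∫⁻ x, g x ^ 2 ∂m := by
  have h := ENNReal.lintegral_mul_le_Lp_mul_Lq m (Real.HolderConjugate.two_two) hf hg
  calc (∫⁻ x, f x * g x ∂m) ^ 2
      ≤ ((∫⁻ x, f x ^ (2 : ℝ) ∂m) ^ (1 / (2 : ℝ)) *
          (∫⁻ x, g x ^ (2 : ℝ) ∂m) ^ (1 / (2 : ℝ))) ^ 2 := by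
        gcongr
        exact h
    _ = (∫⁻ x, f x ^ 2 ∂m) * ∫⁻ x, g x ^ 2 ∂m := by
        have e : ∀ a : ℝ≥0∞, (a ^ (1 / (2 : ℝ))) ^ 2 = a := fun a => by
          rw [← ENNReal.rpow_natCast, ← ENNReal.rpow_mul]; norm_num
        rw [mul_pow, e, e]
        simp only [ENNReal.rpow_two]

/-- The square of the Hilbert–Schmidt norm of the integral operator with kernel `K`. -/
def hsNormSq (μ : Measure Z) (K : Z → Z → ℂ) : ℝ≥0∞ := ∫⁻ x, ∫⁻ y, ‖K x y‖ₑ ^ 2 ∂μ ∂μ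

/-- A measurable kernel with finite Hilbert–Schmidt norm. -/
structure IsSchmidtKernel (μ : Measure Z) (K : Z → Z → ℂ) : Prop where
  measurable : Measurable (Function.uncurry K)
  hsNormSq_lt_top : hsNormSq μ K < ⊤

theorem lintegral_enorm_sq_Lp (u : Lp ℂ 2 μ) : ∫⁻ x, ‖u x‖ₑ ^ 2 ∂μ = ENNReal.ofReal (‖u‖ ^ 2) := by
  rw [Lp.norm_def, ← ENNReal.toReal_pow, ENNReal.ofReal_toReal (by
    exact ENNReal.pow_ne_top (Lp.eLpNorm_ne_top u)),
    eLpNorm_eq_lintegral_rpow_enorm_toReal (by norm_num) (by norm_num)]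
  rw [← ENNReal.rpow_natCast, ← ENNReal.rpow_mul]
  norm_num

theorem memLp_two_of_lintegral {X : Type*} [MeasurableSpace X] {m : Measure X} {f : X → ℂ}
    (hf : AEStronglyMeasurable f m) (h : ∫⁻ x, ‖f x‖ₑ ^ 2 ∂m < ⊤) : MemLp f 2 m := by
  refine ⟨hf, ?_⟩
  rw [eLpNorm_eq_lintegral_rpow_enorm_toReal (by norm_num) (by norm_num)]
  apply ENNReal.rpow_lt_top_of_nonneg (by positivity)
  simpa using h.ne

theorem norm_toLp_sq {f : Z → ℂ} (hf : MemLp f 2 μ) :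
    ENNReal.ofReal (‖hf.toLp‖ ^ 2) = ∫⁻ x, ‖f x‖ₑ ^ 2 ∂μ := by
  rw [← lintegral_enorm_sq_Lp]
  refine lintegral_congr_ae ?_
  filter_upwards [hf.coeFn_toLp] with x hx
  rw [hx]

variable [SFinite μ] {K : Z → Z → ℂ}

theorem hsNormSq_eq_swap (hK : Measurable (Function.uncurry K)) :
    hsNormSq μ K = ∫⁻ y, ∫⁻ x, ‖K x y‖ₑ ^ 2 ∂μ ∂μ :=
  lintegral_lintegral_swap (hK.enorm.pow_const 2).aemeasurable

namespace IsSchmidtKernel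

theorem swap (hK : IsSchmidtKernel μ K) :
    IsSchmidtKernel μ (fun x y => (starRingEnd ℂ) (K y x)) := by
  refine ⟨Complex.continuous_conj.measurable.comp (hK.measurable.comp measurable_swap), ?_⟩
  have h := hK.hsNormSq_lt_top
  rw [hsNormSq_eq_swap hK.measurable] at h
  simpa only [hsNormSq, RCLike.enorm_conj] using h

theorem ae_memLp (hK : IsSchmidtKernel μ K) : ∀ᵐ x ∂μ, MemLp (K x) 2 μ := by
  have h := ae_lt_top (Measurable.lintegral_prod_right' (ν := μ) (hK.measurable.enorm.pow_const 2))
    hK.hsNormSq_lt_top.ne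
  filter_upwards [h] with x hx
  exact memLp_two_of_lintegral (hK.measurable.of_uncurry_left).aestronglyMeasurable hx

theorem ae_memLp_column (hK : IsSchmidtKernel μ K) : ∀ᵐ z ∂μ, MemLp (fun x => K x z) 2 μ := by
  filter_upwards [hK.swap.ae_memLp] with z hz
  have h : (star fun x => (starRingEnd ℂ) (K x z)) = fun x => K x z :=
    funext fun x => Complex.conj_conj _
  exact h ▸ hz.star

/-- A square integrable kernel defines a bounded operator. -/
theorem exists_hasKernel (hK : IsSchmidtKernel μ K) : ∃ A, HasKernel μ K A := by
  have hint : ∀ u : Lp ℂ 2 μ, ∀ᵐ z ∂μ, Integrable (fun z' => K z z' * u z') μ := by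
    intro u
    filter_upwards [hK.ae_memLp] with z hz
    exact hz.integrable_mul (Lp.memLp u)
  have hmeas : ∀ u : Lp ℂ 2 μ, AEStronglyMeasurable (fun z => ∫ z', K z z' * u z' ∂μ) μ := by
    intro u
    exact AEStronglyMeasurable.integral_prod_right' (f := fun p : Z × Z => K p.1 p.2 * u p.2)
      (hK.measurable.aestronglyMeasurable.mul (Lp.aestronglyMeasurable u).comp_snd)
  have hbound : ∀ u : Lp ℂ 2 μ, ∫⁻ z, ‖∫ z', K z z' * u z' ∂μ‖ₑ ^ 2 ∂μ ≤
      hsNormSq μ K * ENNReal.ofReal (‖u‖ ^ 2) := by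
    intro u
    rw [← lintegral_enorm_sq_Lp, hsNormSq, ← lintegral_mul_const'']
    · refine lintegral_mono fun z => ?_
      calc ‖∫ z', K z z' * u z' ∂μ‖ₑ ^ 2 ≤ (∫⁻ z', ‖K z z'‖ₑ * ‖u z'‖ₑ ∂μ) ^ 2 := by
            gcongr
            simpa only [enorm_mul] using enorm_integral_le_lintegral_enorm (fun z' => K z z' * u z')
        _ ≤ _ := lintegral_mul_sq_le hK.measurable.of_uncurry_left.enorm.aemeasurable
            (Lp.aestronglyMeasurable u).enorm
    · exact (Measurable.lintegral_prod_right' (hK.measurable.enorm.pow_const 2)).aemeasurable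
  have hmem : ∀ u : Lp ℂ 2 μ, MemLp (fun z => ∫ z', K z z' * u z' ∂μ) 2 μ := fun u =>
    memLp_two_of_lintegral (hmeas u)
      ((hbound u).trans_lt (ENNReal.mul_lt_top hK.hsNormSq_lt_top ENNReal.ofReal_lt_top))
  let A₀ : Lp ℂ 2 μ →ₗ[ℂ] Lp ℂ 2 μ :=
    { toFun := fun u => (hmem u).toLp
      map_add' := fun u v => by
        rw [← MemLp.toLp_add]
        refine MemLp.toLp_congr _ _ ?_
        filter_upwards [hint u, hint v] with z h1 h2
        rw [Pi.add_apply, ← integral_add h1 h2]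
        refine integral_congr_ae ?_
        filter_upwards [Lp.coeFn_add u v] with z' h3
        rw [h3, Pi.add_apply, mul_add]
      map_smul' := fun c u => by
        rw [RingHom.id_apply, ← MemLp.toLp_const_smul]
        refine MemLp.toLp_congr _ _ (ae_of_all _ fun z => ?_)
        rw [Pi.smul_apply, smul_eq_mul, ← integral_const_mul]
        refine integral_congr_ae ?_
        filter_upwards [Lp.coeFn_smul c u] with z' h3
        rw [h3, Pi.smul_apply, smul_eq_mul]
        ring }
  refine ⟨A₀.mkContinuous (Real.sqrt (hsNormSq μ K).toReal) fun u => ?_, fun u => ?_⟩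
  · refine abs_le_of_sq_le_sq' (a := ‖A₀ u‖) ?_ (by positivity) |>.2
    rw [mul_pow, Real.sq_sqrt ENNReal.toReal_nonneg]
    rw [← ENNReal.ofReal_le_ofReal_iff (by positivity), ENNReal.ofReal_mul ENNReal.toReal_nonneg,
      ENNReal.ofReal_toReal hK.hsNormSq_lt_top.ne]
    exact (norm_toLp_sq (hmem u)).trans_le (hbound u)
  · filter_upwards [hint u, (hmem u).coeFn_toLp] with z h1 h2
    exact ⟨h1, h2⟩

/-- Integrability of the kernel against two square integrable functions, which licenses the exchange
of integrations in the computation of the adjoint. -/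
theorem integrable_sandwich (hK : IsSchmidtKernel μ K) (h u : Lp ℂ 2 μ) :
    Integrable (fun p : Z × Z => u p.2 * ((starRingEnd ℂ) (h p.1) * K p.1 p.2)) (μ.prod μ) := by
  have hm : AEStronglyMeasurable
      (fun p : Z × Z => u p.2 * ((starRingEnd ℂ) (h p.1) * K p.1 p.2)) (μ.prod μ) :=
    (Lp.aestronglyMeasurable u).comp_snd.mul
      ((Complex.continuous_conj.comp_aestronglyMeasurable (Lp.aestronglyMeasurable h).comp_fst).mul
        hK.measurable.aestronglyMeasurable)
  refine ⟨hm, ?_⟩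
  have h1 : AEMeasurable (fun p : Z × Z => ‖u p.2‖ₑ * ‖h p.1‖ₑ) (μ.prod μ) :=
    (Lp.aestronglyMeasurable u).comp_snd.enorm.mul (Lp.aestronglyMeasurable h).comp_fst.enorm
  have h2 := lintegral_mul_sq_le (m := μ.prod μ) h1 hK.measurable.enorm.aemeasurable
  have h3 : ∫⁻ p : Z × Z, (‖u p.2‖ₑ * ‖h p.1‖ₑ) ^ 2 ∂(μ.prod μ) < ⊤ := by
    have : ∫⁻ p : Z × Z, (‖u p.2‖ₑ * ‖h p.1‖ₑ) ^ 2 ∂(μ.prod μ) =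
        (∫⁻ x, ‖h x‖ₑ ^ 2 ∂μ) * ∫⁻ y, ‖u y‖ₑ ^ 2 ∂μ := by
      rw [← lintegral_prod_mul ((Lp.aestronglyMeasurable h).enorm.pow_const 2)
        ((Lp.aestronglyMeasurable u).enorm.pow_const 2)]
      refine lintegral_congr fun p => ?_
      rw [mul_pow, mul_comm]
    rw [this, lintegral_enorm_sq_Lp, lintegral_enorm_sq_Lp]
    exact ENNReal.mul_lt_top ENNReal.ofReal_lt_top ENNReal.ofReal_lt_top
  have h4 : ∫⁻ p : Z × Z, ‖Function.uncurry K p‖ₑ ^ 2 ∂(μ.prod μ) < ⊤ := by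
    rw [lintegral_prod _ (hK.measurable.enorm.pow_const 2).aemeasurable]
    exact hK.hsNormSq_lt_top
  have h5 : (∫⁻ p : Z × Z, ‖u p.2‖ₑ * ‖h p.1‖ₑ * ‖Function.uncurry K p‖ₑ ∂(μ.prod μ)) < ⊤ := by
    by_contra hcon
    rw [not_lt, top_le_iff] at hcon
    rw [hcon] at h2
    exact absurd (h2.trans_lt (ENNReal.mul_lt_top h3 h4)) (by simp)
  refine lt_of_le_of_lt (le_of_eq ?_) h5
  refine lintegral_congr fun p => ?_
  rw [enorm_mul, enorm_mul, RCLike.enorm_conj, mul_assoc]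
  rfl

/-- The adjoint of an integral operator has the adjoint kernel. -/
theorem hasKernel_adjoint (hK : IsSchmidtKernel μ K) {N : Lp ℂ 2 μ →L[ℂ] Lp ℂ 2 μ}
    (hN : HasKernel μ K N) :
    HasKernel μ (fun x y => (starRingEnd ℂ) (K y x)) (ContinuousLinearMap.adjoint N) := by
  -- the operator `B` with the adjoint kernel exists, and it satisfies the defining relation
  obtain ⟨B, hB⟩ := hK.swap.exists_hasKernel
  suffices h : B = ContinuousLinearMap.adjoint N by rwa [← h]
  rw [ContinuousLinearMap.eq_adjoint_iff]
  intro h u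
  rw [L2.inner_def, L2.inner_def]
  have hI := hK.integrable_sandwich h u
  have e1 : ∫ z, inner ℂ (B h z) (u z) ∂μ =
      ∫ z, ∫ x, u z * ((starRingEnd ℂ) (h x) * K x z) ∂μ ∂μ := by
    refine integral_congr_ae ?_
    filter_upwards [hB h] with z hz
    rw [hz.2, RCLike.inner_apply, ← integral_conj, ← integral_const_mul]
    refine integral_congr_ae (ae_of_all _ fun x => ?_)
    simp only [map_mul, Complex.conj_conj]
    ring
  have e2 : ∫ x, inner ℂ (h x) (N u x) ∂μ =
      ∫ x, ∫ z, u z * ((starRingEnd ℂ) (h x) * K x z) ∂μ ∂μ := by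
    refine integral_congr_ae ?_
    filter_upwards [hN u] with x hx
    rw [hx.2, RCLike.inner_apply, mul_comm, ← integral_const_mul]
    refine integral_congr_ae (ae_of_all _ fun z => ?_)
    simp only
    ring
  rw [e1, e2]
  exact (integral_integral_swap hI).symm

end IsSchmidtKernel

open Classical in
/-- The field `z ↦ K(·, z)` of the columns of a kernel, with the value zero at the negligible set of
points where the column is not square integrable. -/
def column (μ : Measure Z) (K : Z → Z → ℂ) (z : Z) : Lp ℂ 2 μ :=
  if h : MemLp (fun x => K x z) 2 μ then h.toLp else 0

namespace IsSchmidtKernel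

theorem ae_column_eq (hK : IsSchmidtKernel μ K) : ∀ᵐ z ∂μ, column μ K z =ᵐ[μ] fun x => K x z := by
  filter_upwards [hK.ae_memLp_column] with z hz
  rw [column, dif_pos hz]
  exact hz.coeFn_toLp

theorem ae_inner_column (hK : IsSchmidtKernel μ K) {N : Lp ℂ 2 μ →L[ℂ] Lp ℂ 2 μ}
    (hN : HasKernel μ K N) (h : Lp ℂ 2 μ) :
    ∀ᵐ z ∂μ, inner ℂ h (column μ K z) =
      (starRingEnd ℂ) (ContinuousLinearMap.adjoint N h z) := by
  filter_upwards [hK.ae_column_eq, hK.hasKernel_adjoint hN h] with z h1 h2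
  rw [h2.2, L2.inner_def, ← integral_conj]
  refine integral_congr_ae ?_
  filter_upwards [h1] with x hx
  rw [hx, RCLike.inner_apply, map_mul, Complex.conj_conj]

theorem aestronglyMeasurable_inner_column (hK : IsSchmidtKernel μ K) (h : Lp ℂ 2 μ) :
    AEStronglyMeasurable (fun z => inner ℂ h (column μ K z)) μ := by
  obtain ⟨N, hN⟩ := hK.exists_hasKernel
  exact (Complex.continuous_conj.comp_aestronglyMeasurable (Lp.aestronglyMeasurable _)).congr
    (EventuallyEq.symm (hK.ae_inner_column hN h))

/-- The field of columns has the covariance of the image of white noise under the operator. -/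
theorem integral_inner_column (hK : IsSchmidtKernel μ K) {N : Lp ℂ 2 μ →L[ℂ] Lp ℂ 2 μ}
    (hN : HasKernel μ K N) (h h' : Lp ℂ 2 μ) :
    ∫ z, inner ℂ h (column μ K z) * (starRingEnd ℂ) (inner ℂ h' (column μ K z)) ∂μ =
      inner ℂ (ContinuousLinearMap.adjoint N h) (ContinuousLinearMap.adjoint N h') := by
  rw [L2.inner_def]
  refine integral_congr_ae ?_
  filter_upwards [hK.ae_inner_column hN h, hK.ae_inner_column hN h'] with z h1 h2
  rw [h1, h2, Complex.conj_conj, RCLike.inner_apply, mul_comm]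

theorem lintegral_norm_column_sq (hK : IsSchmidtKernel μ K) :
    ∫⁻ z, ENNReal.ofReal (‖column μ K z‖ ^ 2) ∂μ = hsNormSq μ K := by
  rw [hsNormSq_eq_swap hK.measurable]
  refine lintegral_congr_ae ?_
  filter_upwards [hK.ae_memLp_column] with z hz
  rw [column, dif_pos hz, norm_toLp_sq]

variable {κ : Type*} [Countable κ] (b : HilbertBasis κ ℂ (Lp ℂ 2 μ))

include b in
theorem integrable_norm_column_sq (hK : IsSchmidtKernel μ K) :
    Integrable (fun z => ‖column μ K z‖ ^ 2) μ := by
  refine ⟨aestronglyMeasurable_norm_sq_of_inner b hK.aestronglyMeasurable_inner_column, ?_⟩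
  rw [hasFiniteIntegral_iff_ofReal (ae_of_all _ fun t => by positivity),
    hK.lintegral_norm_column_sq]
  exact hK.hsNormSq_lt_top

theorem summable_norm_adjoint_sq (hK : IsSchmidtKernel μ K) {N : Lp ℂ 2 μ →L[ℂ] Lp ℂ 2 μ}
    (hN : HasKernel μ K N) : Summable (fun k => ‖ContinuousLinearMap.adjoint N (b k)‖ ^ 2) := by
  have h1 := hK.lintegral_norm_column_sq
  rw [lintegral_enorm_sq_eq_tsum b hK.aestronglyMeasurable_inner_column] at h1
  have h2 : ∀ k, ∫⁻ z, ENNReal.ofReal (‖inner ℂ (b k) (column μ K z)‖ ^ 2) ∂μ =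
      ENNReal.ofReal (‖ContinuousLinearMap.adjoint N (b k)‖ ^ 2) := by
    intro k
    rw [← lintegral_enorm_sq_Lp]
    refine lintegral_congr_ae ?_
    filter_upwards [hK.ae_inner_column hN (b k)] with z hz
    rw [hz, RCLike.norm_conj, ENNReal.ofReal_pow (norm_nonneg _), ofReal_norm]
  simp_rw [h2] at h1
  have h3 := ENNReal.summable_toReal (h1.trans_lt hK.hsNormSq_lt_top).ne
  refine h3.congr fun k => ?_
  exact ENNReal.toReal_ofReal (sq_nonneg _)

end IsSchmidtKernel

/-- The integrand of `Tr(A N N'^*)` for integral operators with kernels `K₁`, `K₂`, `K₃`. -/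
def traceIntegrand (K₁ K₂ K₃ : Z → Z → ℂ) (p : Z × Z × Z) : ℂ :=
  K₁ p.1 p.2.1 * K₂ p.2.1 p.2.2 * (starRingEnd ℂ) (K₃ p.1 p.2.2)

theorem measurable_traceIntegrand {K₁ K₂ K₃ : Z → Z → ℂ} (h₁ : Measurable (Function.uncurry K₁))
    (h₂ : Measurable (Function.uncurry K₂)) (h₃ : Measurable (Function.uncurry K₃)) :
    Measurable (traceIntegrand K₁ K₂ K₃) := by
  refine Measurable.mul (Measurable.mul ?_ ?_) (Complex.continuous_conj.measurable.comp ?_)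
  · exact h₁.comp (measurable_fst.prodMk measurable_snd.fst)
  · exact h₂.comp (measurable_snd.fst.prodMk measurable_snd.snd)
  · exact h₃.comp (measurable_fst.prodMk measurable_snd.snd)

/-- The Cauchy–Schwarz inequality for the trace of three factors. -/
theorem lintegral_traceIntegrand_sq_le {K₁ K₂ K₃ : Z → Z → ℂ}
    (h₁ : Measurable (Function.uncurry K₁))
    (h₂ : Measurable (Function.uncurry K₂)) (h₃ : Measurable (Function.uncurry K₃)) :
    (∫⁻ p, ‖traceIntegrand K₁ K₂ K₃ p‖ₑ ∂(μ.prod (μ.prod μ))) ^ 2 ≤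
      hsNormSq μ K₁ * (hsNormSq μ K₂ * hsNormSq μ K₃) := by
  have hφ : Measurable (fun q : Z × Z => ∫⁻ z, ‖K₂ q.2 z‖ₑ * ‖K₃ q.1 z‖ₑ ∂μ) :=
    Measurable.lintegral_prod_right' (f := fun r : (Z × Z) × Z => ‖K₂ r.1.2 r.2‖ₑ * ‖K₃ r.1.1 r.2‖ₑ)
      ((h₂.comp (measurable_fst.snd.prodMk measurable_snd)).enorm.mul
        (h₃.comp (measurable_fst.fst.prodMk measurable_snd)).enorm)
  have hm : Measurable fun q : Z × Z =>
      ‖Function.uncurry K₁ q‖ₑ * ∫⁻ z, ‖K₂ q.2 z‖ₑ * ‖K₃ q.1 z‖ₑ ∂μ := h₁.enorm.mul hφ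
  have e : ∫⁻ p, ‖traceIntegrand K₁ K₂ K₃ p‖ₑ ∂(μ.prod (μ.prod μ)) =
      ∫⁻ q : Z × Z, ‖Function.uncurry K₁ q‖ₑ * ∫⁻ z, ‖K₂ q.2 z‖ₑ * ‖K₃ q.1 z‖ₑ ∂μ ∂(μ.prod μ) := by
    rw [lintegral_prod _ (measurable_traceIntegrand h₁ h₂ h₃).enorm.aemeasurable,
      lintegral_prod _ hm.aemeasurable]
    refine lintegral_congr fun x => ?_
    have hx : Measurable fun q : Z × Z => ‖traceIntegrand K₁ K₂ K₃ (x, q)‖ₑ :=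
      ((measurable_traceIntegrand h₁ h₂ h₃).comp measurable_prodMk_left).enorm
    rw [lintegral_prod _ hx.aemeasurable]
    refine lintegral_congr fun y => ?_
    have hxy : Measurable fun z => ‖K₂ y z‖ₑ * ‖K₃ x z‖ₑ :=
      h₂.of_uncurry_left.enorm.mul h₃.of_uncurry_left.enorm
    dsimp only
    rw [← lintegral_const_mul _ hxy]
    refine lintegral_congr fun z => ?_
    simp only [traceIntegrand, Function.uncurry, enorm_mul, RCLike.enorm_conj, mul_assoc]
  rw [e]
  refine (lintegral_mul_sq_le h₁.enorm.aemeasurable hφ.aemeasurable).trans ?_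
  rw [lintegral_prod _ (h₁.enorm.pow_const 2).aemeasurable]
  refine mul_le_mul_right (a := hsNormSq μ K₁) ?_
  have hG : Measurable fun y => ∫⁻ z, ‖K₂ y z‖ₑ ^ 2 ∂μ :=
    Measurable.lintegral_prod_right' (f := fun p => ‖Function.uncurry K₂ p‖ₑ ^ 2)
      (h₂.enorm.pow_const 2)
  have hH : Measurable fun y => ∫⁻ z, ‖K₃ y z‖ₑ ^ 2 ∂μ :=
    Measurable.lintegral_prod_right' (f := fun p => ‖Function.uncurry K₃ p‖ₑ ^ 2)
      (h₃.enorm.pow_const 2)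
  calc ∫⁻ q : Z × Z, (∫⁻ z, ‖K₂ q.2 z‖ₑ * ‖K₃ q.1 z‖ₑ ∂μ) ^ 2 ∂(μ.prod μ)
      ≤ ∫⁻ q : Z × Z, (∫⁻ z, ‖K₃ q.1 z‖ₑ ^ 2 ∂μ) * (∫⁻ z, ‖K₂ q.2 z‖ₑ ^ 2 ∂μ) ∂(μ.prod μ) := by
        refine lintegral_mono fun q => ?_
        rw [mul_comm (∫⁻ z, ‖K₃ q.1 z‖ₑ ^ 2 ∂μ)]
        exact lintegral_mul_sq_le h₂.of_uncurry_left.enorm.aemeasurable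
          h₃.of_uncurry_left.enorm.aemeasurable
    _ = hsNormSq μ K₂ * hsNormSq μ K₃ := by
        rw [lintegral_prod_mul hH.aemeasurable hG.aemeasurable, mul_comm]
        rfl

theorem integrable_traceIntegrand {K₁ K₂ K₃ : Z → Z → ℂ} (h₁ : IsSchmidtKernel μ K₁)
    (h₂ : IsSchmidtKernel μ K₂) (h₃ : IsSchmidtKernel μ K₃) :
    Integrable (traceIntegrand K₁ K₂ K₃) (μ.prod (μ.prod μ)) := by
  refine ⟨(measurable_traceIntegrand h₁.1 h₂.1 h₃.1).aestronglyMeasurable, ?_⟩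
  have h := lintegral_traceIntegrand_sq_le (μ := μ) h₁.1 h₂.1 h₃.1
  by_contra hcon
  rw [HasFiniteIntegral, not_lt, top_le_iff] at hcon
  rw [hcon] at h
  exact absurd (h.trans_lt (ENNReal.mul_lt_top h₁.2 (ENNReal.mul_lt_top h₂.2 h₃.2))) (by simp)

/-- Fubini's theorem with the third variable outermost. -/
theorem integral_eq_integral_rotate {X : Type*} [MeasurableSpace X] {m : Measure X} [SFinite m]
    {G : X × X × X → ℂ} (hG : Integrable G (m.prod (m.prod m))) :
    ∫ p, G p ∂(m.prod (m.prod m)) = ∫ z, ∫ x, ∫ y, G (x, y, z) ∂m ∂m ∂m := by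
  let e : X × X × X ≃ᵐ X × X × X := MeasurableEquiv.prodComm.trans MeasurableEquiv.prodAssoc
  have he : MeasurePreserving e (m.prod (m.prod m)) (m.prod (m.prod m)) :=
    (measurePreserving_prodAssoc m m m).comp Measure.measurePreserving_swap
  have h1 : Integrable (fun q => G (e q)) (m.prod (m.prod m)) :=
    (he.integrable_comp_emb e.measurableEmbedding).2 hG
  rw [← he.integral_comp' G, integral_prod _ h1]
  refine integral_congr_ae ?_
  filter_upwards [h1.prod_right_ae] with z hz
  rw [integral_prod _ hz]
  rfl

/-- The mean value of `⟨F, A F⟩` for `F = N w`, in terms of the kernels of `A` and `N`. -/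
theorem integral_inner_isImage {Ω : Type*} [MeasurableSpace Ω] {P : Measure Ω}
    {w : Lp ℂ 2 μ → Ω → ℂ} (hw : IsWhiteNoise P w) {κ : Type*} [Countable κ]
    (b : HilbertBasis κ ℂ (Lp ℂ 2 μ)) {KA KN : Z → Z → ℂ} {A N : Lp ℂ 2 μ →L[ℂ] Lp ℂ 2 μ}
    (hKA : IsSchmidtKernel μ KA) (hA : HasKernel μ KA A)
    (hKN : IsSchmidtKernel μ KN) (hN : HasKernel μ KN N)
    {F : Ω → Lp ℂ 2 μ} (hF : IsImage P w N F) :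
    Integrable (fun t => inner ℂ (F t) (A (F t))) P ∧
    ∫ t, inner ℂ (F t) (A (F t)) ∂P =
      ∫ p, traceIntegrand KA KN KN p ∂(μ.prod (μ.prod μ)) := by
  obtain ⟨h1, h2⟩ := hF.integral_inner_eq b hw hKN.aestronglyMeasurable_inner_column
    (hKN.integrable_norm_column_sq b) (hKN.integral_inner_column hN) A
  refine ⟨h1, ?_⟩
  rw [h2, integral_eq_integral_rotate (integrable_traceIntegrand hKA hKN hKN)]
  refine integral_congr_ae ?_
  filter_upwards [hKN.ae_column_eq] with z hz
  rw [L2.inner_def]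
  refine integral_congr_ae ?_
  filter_upwards [hz, hA (column μ KN z)] with x hx hx2
  rw [hx2.2, RCLike.inner_apply, hx, mul_comm, ← integral_const_mul]
  refine integral_congr_ae ?_
  filter_upwards [hz] with y hy
  simp only [traceIntegrand]
  rw [hy]
  ring

end Schmidt

/-! ### Changes of charts -/

section Charts

variable {d : ℕ} {Z : Type*} [TopologicalSpace Z] [ChartedSpace (Euc d) Z]
  {e e' : Chart d Z}

theorem isSmoothChart_chartAt [IsManifold 𝓘(ℝ, Euc d) ∞ Z] (z : Z) :
    IsSmoothChart (chartAt (Euc d) z) :=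
  IsManifold.chart_mem_maximalAtlas z

theorem IsSmoothChart.mdifferentiable (he : IsSmoothChart e) :
    e.MDifferentiable 𝓘(ℝ, Euc d) 𝓘(ℝ, Euc d) :=
  ⟨(contMDiffOn_of_mem_maximalAtlas he).mdifferentiableOn (by simp),
    (contMDiffOn_symm_of_mem_maximalAtlas he).mdifferentiableOn (by simp)⟩

theorem isOpen_transition_domain {Z : Type*} [TopologicalSpace Z] (e e' : Chart d Z) :
    IsOpen (e.target ∩ e.symm ⁻¹' e'.source) :=
  e.isOpen_inter_preimage_symm e'.open_source

theorem contDiffOn_transition (he : IsSmoothChart e) (he' : IsSmoothChart e') :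
    ContDiffOn ℝ ∞ (e' ∘ e.symm) (e.target ∩ e.symm ⁻¹' e'.source) := by
  rw [← contMDiffOn_iff_contDiffOn]
  exact (contMDiffOn_of_mem_maximalAtlas he').comp
    ((contMDiffOn_symm_of_mem_maximalAtlas he).mono inter_subset_left) inter_subset_right

theorem hasFDerivAt_transition (he : IsSmoothChart e) (he' : IsSmoothChart e') {x : Euc d}
    (hx : x ∈ e.target) (hx' : e.symm x ∈ e'.source) :
    HasFDerivAt (e' ∘ e.symm) (fderiv ℝ (e' ∘ e.symm) x) x :=
  (((contDiffOn_transition he he').contDiffAt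
    ((isOpen_transition_domain e e').mem_nhds ⟨hx, hx'⟩)).differentiableAt (by simp)).hasFDerivAt

/-- The derivative at `z` of a chart, as an endomorphism of the model space. -/
def chartDeriv (e : Chart d Z) (z : Z) : Euc d →L[ℝ] Euc d :=
  mfderiv 𝓘(ℝ, Euc d) 𝓘(ℝ, Euc d) e z

/-- The derivative at `x` of an inverse chart, as an endomorphism of the model space. -/
def chartDerivSymm (e : Chart d Z) (x : Euc d) : Euc d →L[ℝ] Euc d :=
  mfderiv 𝓘(ℝ, Euc d) 𝓘(ℝ, Euc d) e.symm x

/-- The chain rule for a change of charts. -/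
theorem chartDeriv_eq_comp (he : IsSmoothChart e) (he' : IsSmoothChart e') {x : Euc d}
    (hx : x ∈ e.target) (hx' : e.symm x ∈ e'.source) :
    chartDeriv e' (e.symm x) = (fderiv ℝ (e' ∘ e.symm) x).comp (chartDeriv e (e.symm x)) := by
  have h1 := (he.mdifferentiable.mdifferentiableAt (e.map_target hx)).hasMFDerivAt
  have h2 : HasMFDerivAt 𝓘(ℝ, Euc d) 𝓘(ℝ, Euc d) (e' ∘ e.symm) (e (e.symm x))
      (fderiv ℝ (e' ∘ e.symm) x) := by
    rw [e.right_inv hx]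
    exact (hasFDerivAt_transition he he' hx hx').hasMFDerivAt
  have h3 := h2.comp (e.symm x) h1
  refine HasMFDerivAt.mfderiv (h3.congr_of_eventuallyEq ?_)
  filter_upwards [e.open_source.mem_nhds (e.map_target hx)] with z hz
  simp [e.left_inv hz]

theorem chartDeriv_comp_chartDerivSymm (he : IsSmoothChart e) {x : Euc d} (hx : x ∈ e.target) :
    (chartDeriv e (e.symm x)).comp (chartDerivSymm e x) = ContinuousLinearMap.id ℝ (Euc d) :=
  he.mdifferentiable.comp_symm_deriv hx

theorem fderiv_transition_eq (he : IsSmoothChart e) (he' : IsSmoothChart e') {x : Euc d}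
    (hx : x ∈ e.target) (hx' : e.symm x ∈ e'.source) :
    fderiv ℝ (e' ∘ e.symm) x = (chartDeriv e' (e.symm x)).comp (chartDerivSymm e x) := by
  rw [chartDeriv_eq_comp he he' hx hx', ContinuousLinearMap.comp_assoc,
    chartDeriv_comp_chartDerivSymm he hx, ContinuousLinearMap.comp_id]

theorem fderiv_transition_comp (he : IsSmoothChart e) (he' : IsSmoothChart e') {x : Euc d}
    (hx : x ∈ e.target) (hx' : e.symm x ∈ e'.source) :
    (fderiv ℝ (e ∘ e'.symm) (e' (e.symm x))).comp (fderiv ℝ (e' ∘ e.symm) x) =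
      ContinuousLinearMap.id ℝ (Euc d) := by
  have hy : e' (e.symm x) ∈ e'.target := e'.map_source hx'
  have hy' : e'.symm (e' (e.symm x)) ∈ e.source := by
    rw [e'.left_inv hx']; exact e.map_target hx
  have h1 := chartDeriv_eq_comp he' he hy hy'
  rw [e'.left_inv hx'] at h1
  rw [fderiv_transition_eq he he' hx hx', ← ContinuousLinearMap.comp_assoc, ← h1]
  exact chartDeriv_comp_chartDerivSymm he hx

theorem det_fderiv_transition_ne_zero (he : IsSmoothChart e) (he' : IsSmoothChart e') {x : Euc d}
    (hx : x ∈ e.target) (hx' : e.symm x ∈ e'.source) :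
    (fderiv ℝ (e' ∘ e.symm) x).det ≠ 0 := by
  have h := congrArg ContinuousLinearMap.det (fderiv_transition_comp he he' hx hx')
  intro h0
  have h1 : ((fderiv ℝ (e ∘ e'.symm) (e' (e.symm x))).comp (fderiv ℝ (e' ∘ e.symm) x)).det =
      (fderiv ℝ (e ∘ e'.symm) (e' (e.symm x))).det * (fderiv ℝ (e' ∘ e.symm) x).det :=
    LinearMap.det_comp _ _
  rw [h1, h0, mul_zero] at h
  have h2 : (ContinuousLinearMap.id ℝ (Euc d)).det = 1 := LinearMap.det_id
  rw [h2] at h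
  exact zero_ne_one h

variable [IsManifold 𝓘(ℝ, Euc d) ∞ Z]

/-! ### Canonical coordinates on the cotangent bundle -/

/-- The fibre component of a covector, as a linear form on the model space. -/
def fibreForm (p : CotangentBundle d Z) : Euc d →L[ℝ] ℝ := p.2

/-- The point `(e z, ξ)` of `ℝ^d × ℝ^d` that represents a covector at `z` in the canonical
coordinates of the chart `e`. -/
def cotangentCoord (e : Chart d Z) (p : CotangentBundle d Z) : Euc d × Euc d :=
  (e p.proj, (InnerProductSpace.toDual ℝ (Euc d)).symm
    ((fibreForm p).comp (chartDerivSymm e (e p.proj))))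

theorem fibreForm_canonicalCoord (e : Chart d Z) (q : Euc d × Euc d) :
    fibreForm (canonicalCoord e q) = (innerSL ℝ q.2).comp (chartDeriv e (e.symm q.1)) := rfl

theorem proj_canonicalCoord (e : Chart d Z) (q : Euc d × Euc d) :
    (canonicalCoord e q).proj = e.symm q.1 := rfl

theorem cotangentCoord_canonicalCoord (he : IsSmoothChart e) {x ξ : Euc d} (hx : x ∈ e.target) :
    cotangentCoord e (canonicalCoord e (x, ξ)) = (x, ξ) := by
  rw [cotangentCoord, fibreForm_canonicalCoord, proj_canonicalCoord, e.right_inv hx]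
  refine Prod.ext rfl ?_
  simp only
  rw [LinearIsometryEquiv.symm_apply_eq, ContinuousLinearMap.comp_assoc,
    chartDeriv_comp_chartDerivSymm he hx, ContinuousLinearMap.comp_id]
  rfl

theorem cotangentBundle_ext {p q : CotangentBundle d Z} (h : p.proj = q.proj)
    (h' : fibreForm p = fibreForm q) : p = q := by
  obtain ⟨z, φ⟩ := p
  obtain ⟨z', φ'⟩ := q
  obtain rfl : z = z' := h
  obtain rfl : φ = φ' := h'
  rfl

/-- Change of canonical coordinates: the covector components transform by the adjoint of the
derivative of the transition map. -/
theorem canonicalCoord_transition (he : IsSmoothChart e) (he' : IsSmoothChart e') {x : Euc d}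
    (hx : x ∈ e.target) (hx' : e.symm x ∈ e'.source) (η : Euc d) :
    canonicalCoord e' (e' (e.symm x), η) =
      canonicalCoord e (x, ContinuousLinearMap.adjoint (fderiv ℝ (e' ∘ e.symm) x) η) := by
  have h : e'.symm (e' (e.symm x)) = e.symm x := e'.left_inv hx'
  refine cotangentBundle_ext h ?_
  simp only [fibreForm_canonicalCoord]
  rw [h, chartDeriv_eq_comp he he' hx hx']
  ext v
  simp [ContinuousLinearMap.adjoint_inner_left]

/-- The fibre component of a covector in the bundle trivialization at `z₀`. -/
theorem trivializationAt_snd_eq {z₀ : Z} {p : CotangentBundle d Z}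
    (hp : p.proj ∈ (chartAt (Euc d) z₀).source) :
    (trivializationAt (Euc d →L[ℝ] ℝ)
      (fun z : Z => TangentSpace 𝓘(ℝ, Euc d) z →L[ℝ] Bundle.Trivial Z ℝ z) z₀ p).2 =
      (fibreForm p).comp
        (chartDerivSymm (chartAt (Euc d) z₀) (chartAt (Euc d) z₀ p.proj)) := by
  have h : (trivializationAt (Euc d) (TangentSpace 𝓘(ℝ, Euc d) : Z → Type _) z₀).symmL ℝ p.proj =
      chartDerivSymm (chartAt (Euc d) z₀) (chartAt (Euc d) z₀ p.proj) := by
    rw [TangentBundle.symmL_trivializationAt hp]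
    simp only [chartDerivSymm, mfderivWithin_univ, modelWithCornersSelf_coe, range_id, mfld_simps]
    rfl
  rw [hom_trivializationAt_apply]
  simp only [ContinuousLinearMap.inCoordinates]
  rw [h]
  ext v
  simp
  rfl

/-- The canonical coordinates of `e` read in the bundle trivialization at `z₀`: only transition maps
of charts enter, so smoothness is that of these maps. -/
theorem trivializationAt_canonicalCoord (he : IsSmoothChart e) {z₀ : Z} {x : Euc d}
    (hx : x ∈ e.target) (hx' : e.symm x ∈ (chartAt (Euc d) z₀).source) (ξ : Euc d) :
    (trivializationAt (Euc d →L[ℝ] ℝ)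
      (fun z : Z => TangentSpace 𝓘(ℝ, Euc d) z →L[ℝ] Bundle.Trivial Z ℝ z) z₀
        (canonicalCoord e (x, ξ))).2 =
      (innerSL ℝ ξ).comp (fderiv ℝ (e ∘ (chartAt (Euc d) z₀).symm)
        ((chartAt (Euc d) z₀ ∘ e.symm) x)) := by
  set c := chartAt (Euc d) z₀
  rw [trivializationAt_snd_eq (p := canonicalCoord e (x, ξ)) hx', fibreForm_canonicalCoord,
    proj_canonicalCoord, ContinuousLinearMap.comp_assoc]
  have hy : c (e.symm x) ∈ c.target := c.map_source hx'
  have h := fderiv_transition_eq (isSmoothChart_chartAt z₀) he hy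
    (by rw [c.left_inv hx']; exact e.map_target hx)
  rw [c.left_inv hx'] at h
  rw [Function.comp_apply, h]

theorem contMDiffOn_canonicalCoord (he : IsSmoothChart e) :
    ContMDiffOn 𝓘(ℝ, Euc d × Euc d) (𝓘(ℝ, Euc d).prod 𝓘(ℝ, Euc d →L[ℝ] ℝ)) ∞
      (canonicalCoord e) (e.target ×ˢ univ) := by
  rintro ⟨x, ξ⟩ ⟨hx, -⟩
  apply ContMDiffAt.contMDiffWithinAt
  rw [Bundle.contMDiffAt_totalSpace]
  constructor
  · have h : ContMDiffAt 𝓘(ℝ, Euc d) 𝓘(ℝ, Euc d) ∞ e.symm x :=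
      contMDiffAt_symm_of_mem_maximalAtlas he hx
    exact ContMDiffAt.comp (x := (x, ξ)) (g := e.symm) (f := Prod.fst) h
      contDiff_fst.contMDiff.contMDiffAt
  · rw [contMDiffAt_iff_contDiffAt]
    have hz := mem_chart_source (Euc d) (e.symm x)
    set c := chartAt (Euc d) (e.symm x) with hc
    have hc' : IsSmoothChart c := isSmoothChart_chartAt _
    have h1 : ContDiffAt ℝ ∞ (c ∘ e.symm) x := (contDiffOn_transition he hc').contDiffAt
      ((isOpen_transition_domain e c).mem_nhds ⟨hx, hz⟩)
    have h2 : ContDiffAt ℝ ∞ (e ∘ c.symm) ((c ∘ e.symm) x) :=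
      (contDiffOn_transition hc' he).contDiffAt ((isOpen_transition_domain c e).mem_nhds
        ⟨c.map_source hz, by
          show c.symm (c (e.symm x)) ∈ e.source
          rw [c.left_inv hz]; exact e.map_target hx⟩)
    have h3 : ContDiffAt ℝ ∞ (fun q : Euc d × Euc d =>
        (innerSL ℝ q.2).comp (fderiv ℝ (e ∘ c.symm) ((c ∘ e.symm) q.1))) (x, ξ) := by
      have h4 : ContDiffAt ℝ ∞ (fderiv ℝ (e ∘ c.symm)) ((c ∘ e.symm) x) :=
        h2.fderiv_right (by simp)
      have h5 : ContDiffAt ℝ ∞ (fun q : Euc d × Euc d => fderiv ℝ (e ∘ c.symm) ((c ∘ e.symm) q.1))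
          (x, ξ) :=
        ContDiffAt.comp (g := fun y => fderiv ℝ (e ∘ c.symm) ((c ∘ e.symm) y)) (x, ξ)
          (h4.comp x h1) contDiffAt_fst
      exact ((innerSL ℝ).contDiff.contDiffAt.comp (x, ξ) contDiffAt_snd).clm_comp h5
    refine h3.congr_of_eventuallyEq ?_
    have h6 : (e.target ∩ e.symm ⁻¹' c.source) ×ˢ (univ : Set (Euc d)) ∈ 𝓝 (x, ξ) :=
      ((isOpen_transition_domain e c).prod isOpen_univ).mem_nhds ⟨⟨hx, hz⟩, trivial⟩
    filter_upwards [h6] with q hq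
    exact trivializationAt_canonicalCoord he hq.1.1 hq.1.2 q.2

theorem continuousOn_cotangentCoord (he : IsSmoothChart e) :
    ContinuousOn (cotangentCoord (Z := Z) e) {p | p.proj ∈ e.source} := by
  intro p₀ hp₀
  apply ContinuousAt.continuousWithinAt
  have hproj : Continuous (fun p : CotangentBundle d Z => p.proj) :=
    FiberBundle.continuous_proj (Euc d →L[ℝ] ℝ) _
  have hz := mem_chart_source (Euc d) p₀.proj
  set c := chartAt (Euc d) p₀.proj with hc
  have hc' : IsSmoothChart c := isSmoothChart_chartAt _
  have hep : ContinuousAt (fun p : CotangentBundle d Z => e p.proj) p₀ :=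
    (e.continuousAt hp₀).comp hproj.continuousAt
  refine hep.prodMk ((LinearIsometryEquiv.continuous _).continuousAt.comp ?_)
  have h1 : ContinuousAt (fun p : CotangentBundle d Z => (trivializationAt (Euc d →L[ℝ] ℝ)
      (fun z : Z => TangentSpace 𝓘(ℝ, Euc d) z →L[ℝ] Bundle.Trivial Z ℝ z) p₀.proj p).2) p₀ :=
    continuous_snd.continuousAt.comp
      ((trivializationAt (Euc d →L[ℝ] ℝ) _ p₀.proj).continuousAt
        FiberBundle.mem_trivializationAt_proj_source)
  have hx : e p₀.proj ∈ e.target := e.map_source hp₀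
  have hx' : e.symm (e p₀.proj) ∈ c.source := by rw [e.left_inv hp₀]; exact hz
  have h2 : ContinuousAt (fderiv ℝ (c ∘ e.symm)) (e p₀.proj) :=
    (((contDiffOn_transition he hc').contDiffAt
      ((isOpen_transition_domain e c).mem_nhds ⟨hx, hx'⟩)).fderiv_right (m := 0)
        (by simp)).continuousAt
  have h3 := h1.clm_comp (h2.comp (f := fun p : CotangentBundle d Z => e p.proj) hep)
  refine h3.congr ?_
  filter_upwards [hproj.continuousAt.preimage_mem_nhds (e.open_source.mem_nhds hp₀),
    hproj.continuousAt.preimage_mem_nhds (c.open_source.mem_nhds hz)] with p hpe hpc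
  have hpe : p.proj ∈ e.source := hpe
  have hpc : p.proj ∈ c.source := hpc
  have hy : e p.proj ∈ e.target := e.map_source hpe
  have hy' : e.symm (e p.proj) ∈ c.source := by rw [e.left_inv hpe]; exact hpc
  simp only [Function.comp_apply]
  rw [trivializationAt_snd_eq hpc, ContinuousLinearMap.comp_assoc]
  congr 1
  rw [fderiv_transition_eq he hc' hy hy', ← ContinuousLinearMap.comp_assoc, e.left_inv hpe]
  have h6 : (chartDerivSymm c (c p.proj)).comp (chartDeriv c p.proj) =
      ContinuousLinearMap.id ℝ (Euc d) := hc'.mdifferentiable.symm_comp_deriv hpc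
  rw [h6, ContinuousLinearMap.id_comp]

end Charts

/-! ### Auxiliary facts on measurability and determinants -/

theorem measurableSet_inter_preimage_of_continuousOn {X Y : Type*} [TopologicalSpace X]
    [MeasurableSpace X] [BorelSpace X] [TopologicalSpace Y] [MeasurableSpace Y] [BorelSpace Y]
    {f : X → Y} {s : Set X} (hf : ContinuousOn f s) (hs : MeasurableSet s) {T : Set Y}
    (hT : MeasurableSet T) : MeasurableSet (s ∩ f ⁻¹' T) := by
  have h1 : Measurable (s.domRestrict f) :=
    (continuousOn_iff_continuous_domRestrict.1 hf).measurable
  have h2 := (MeasurableEmbedding.subtype_coe hs).measurableSet_image.2 (h1 hT)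
  convert h2 using 1
  ext x
  simp [and_comm]

theorem det_adjoint {d : ℕ} (L : Euc d →L[ℝ] Euc d) :
    (ContinuousLinearMap.adjoint L).det = L.det := by
  have b := EuclideanSpace.basisFun (Fin d) ℝ
  have h : LinearMap.det (LinearMap.adjoint (L : Euc d →ₗ[ℝ] Euc d)) =
      LinearMap.det (L : Euc d →ₗ[ℝ] Euc d) := by
    rw [← LinearMap.det_toMatrix b.toBasis, LinearMap.toMatrix_adjoint, Matrix.det_conjTranspose,
      LinearMap.det_toMatrix]
    simp
  exact h

/-! ### Symbols in canonical coordinates -/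

section LocalSymbol

variable {d : ℕ} {Z : Type*} [TopologicalSpace Z] [ChartedSpace (Euc d) Z]
  [IsManifold 𝓘(ℝ, Euc d) ∞ Z] {e e' : Chart d Z}

/-- Smooth functions on `ℝ^d × ℝ^d` with compact support in `U × ℝ^d`. -/
structure IsLocalSymbol (U : Set (Euc d)) (p : Euc d → Euc d → ℂ) : Prop where
  smooth : ContDiff ℝ ∞ (Function.uncurry p)
  support : ∃ K : Set (Euc d × Euc d), IsCompact K ∧ K ⊆ U ×ˢ univ ∧ ∀ x ξ, p x ξ ≠ 0 → (x, ξ) ∈ K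

theorem continuous_proj_cotangentBundle :
    Continuous (fun p : CotangentBundle d Z => p.proj) :=
  FiberBundle.continuous_proj (Euc d →L[ℝ] ℝ) _

/-- A test symbol supported over the domain of the chart stays smooth when its coordinate expression
is extended by zero. -/
theorem isLocalSymbol_localSymbol (he : IsSmoothChart e) {b : CotangentBundle d Z → ℂ}
    (hb : IsTestSymbol b) (hbe : tsupport b ⊆ {p | p.proj ∈ e.source}) :
    IsLocalSymbol e.target (localSymbol e b) := by
  set K := cotangentCoord e '' tsupport b with hK
  have hKc : IsCompact K := hb.2.isCompact.image_of_continuousOn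
    ((continuousOn_cotangentCoord he).mono hbe)
  have hKs : K ⊆ e.target ×ˢ univ := by
    rintro _ ⟨p, hp, rfl⟩
    exact ⟨e.map_source (hbe hp), trivial⟩
  have hsupp : ∀ x ξ, localSymbol e b x ξ ≠ 0 → (x, ξ) ∈ K := by
    intro x ξ h
    have hx : x ∈ e.target := by
      by_contra hx
      exact h (indicator_of_notMem hx _)
    rw [localSymbol, indicator_of_mem hx] at h
    exact ⟨canonicalCoord e (x, ξ), subset_tsupport b h, cotangentCoord_canonicalCoord he hx⟩
  refine ⟨contDiff_iff_contDiffAt.2 fun q => ?_, K, hKc, hKs, hsupp⟩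
  by_cases hq : q ∈ K
  · have hq1 : e.target ×ˢ (univ : Set (Euc d)) ∈ 𝓝 q :=
      (e.open_target.prod isOpen_univ).mem_nhds (hKs hq)
    have h1 : ContMDiffAt 𝓘(ℝ, Euc d × Euc d) 𝓘(ℝ, ℂ) ∞ (b ∘ canonicalCoord e) q :=
      (hb.1.contMDiffAt).comp q ((contMDiffOn_canonicalCoord he).contMDiffAt hq1)
    refine (contMDiffAt_iff_contDiffAt.1 h1).congr_of_eventuallyEq ?_
    filter_upwards [hq1] with r hr
    exact indicator_of_mem hr.1 (fun y => b (canonicalCoord e (y, r.2)))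
  · refine (contDiffAt_const (c := (0 : ℂ))).congr_of_eventuallyEq ?_
    filter_upwards [hKc.isClosed.isOpen_compl.mem_nhds hq] with r hr
    by_contra h
    exact hr (hsupp r.1 r.2 h)

/-! ### The Liouville measure in one chart -/

/-- Lebesgue measure in the canonical coordinates of one chart. -/
def chartLiouville (e : Chart d Z) : Measure (CotangentBundle d Z) :=
  ((volume : Measure (Euc d × Euc d)).restrict (e.target ×ˢ univ)).map (canonicalCoord e)

theorem measurableSet_phase_domain {Z : Type*} [TopologicalSpace Z] (e : Chart d Z) :
    MeasurableSet (e.target ×ˢ (univ : Set (Euc d))) :=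
  (e.open_target.prod isOpen_univ).measurableSet

theorem aemeasurable_canonicalCoord (he : IsSmoothChart e) :
    AEMeasurable (canonicalCoord (Z := Z) e)
      ((volume : Measure (Euc d × Euc d)).restrict (e.target ×ˢ univ)) :=
  (contMDiffOn_canonicalCoord he).continuousOn.aemeasurable (measurableSet_phase_domain e)

theorem chartLiouville_apply (he : IsSmoothChart e) {T : Set (CotangentBundle d Z)}
    (hT : MeasurableSet T) :
    chartLiouville e T = ∫⁻ x in e.target, volume {ξ : Euc d | canonicalCoord e (x, ξ) ∈ T} := by
  have hW : MeasurableSet ((e.target ×ˢ univ) ∩ canonicalCoord e ⁻¹' T) :=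
    measurableSet_inter_preimage_of_continuousOn (contMDiffOn_canonicalCoord he).continuousOn
      (measurableSet_phase_domain e) hT
  rw [chartLiouville, Measure.map_apply_of_aemeasurable (aemeasurable_canonicalCoord he) hT,
    Measure.restrict_apply' (measurableSet_phase_domain e), inter_comm,
    Measure.volume_eq_prod, Measure.prod_apply hW,
    ← lintegral_indicator e.open_target.measurableSet]
  refine lintegral_congr fun x => ?_
  by_cases hx : x ∈ e.target
  · rw [indicator_of_mem hx]
    congr 1
    ext ξ
    simp [hx]
  · rw [indicator_of_notMem hx]
    convert measure_empty (μ := (volume : Measure (Euc d)))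
    ext ξ
    simp [hx]

/-- The coordinate changes of the cotangent bundle preserve Lebesgue measure: the Jacobian of the
base change and that of the fibre change cancel. -/
theorem chartLiouville_inter_le (he : IsSmoothChart e) (he' : IsSmoothChart e')
    {T : Set (CotangentBundle d Z)} (hT : MeasurableSet T) :
    chartLiouville e' (T ∩ {p | p.proj ∈ e.source}) ≤ chartLiouville e T := by
  have hS : MeasurableSet {p : CotangentBundle d Z | p.proj ∈ e.source} :=
    (e.open_source.preimage continuous_proj_cotangentBundle).measurableSet
  rw [chartLiouville_apply he' (hT.inter hS), chartLiouville_apply he hT]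
  set D := e.target ∩ e.symm ⁻¹' e'.source
  set D' := e'.target ∩ e'.symm ⁻¹' e.source
  have hD : IsOpen D := isOpen_transition_domain e e'
  have hD' : IsOpen D' := isOpen_transition_domain e' e
  have himg : (e' ∘ e.symm) '' D = D' := by
    ext y
    constructor
    · rintro ⟨x, ⟨hx, hx'⟩, rfl⟩
      refine ⟨e'.map_source hx', ?_⟩
      show e'.symm (e' (e.symm x)) ∈ e.source
      rw [e'.left_inv hx']
      exact e.map_target hx
    · rintro ⟨hy, hy'⟩
      refine ⟨e (e'.symm y), ⟨e.map_source hy', ?_⟩, ?_⟩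
      · show e.symm (e (e'.symm y)) ∈ e'.source
        rw [e.left_inv hy']
        exact e'.map_target hy
      · show e' (e.symm (e (e'.symm y))) = y
        rw [e.left_inv hy', e'.right_inv hy]
  have hinj : InjOn (e' ∘ e.symm) D := by
    intro x hx y hy hxy
    have h1 : e.symm x = e.symm y := e'.injOn hx.2 hy.2 hxy
    exact e.symm.injOn hx.1 hy.1 h1
  calc ∫⁻ y in e'.target,
        volume {η : Euc d | canonicalCoord e' (y, η) ∈ T ∩ {p | p.proj ∈ e.source}}
      = ∫⁻ y in D', volume {η : Euc d | canonicalCoord e' (y, η) ∈ T} := by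
        rw [← lintegral_indicator e'.open_target.measurableSet,
          ← lintegral_indicator hD'.measurableSet]
        refine lintegral_congr fun y => ?_
        by_cases hy : y ∈ e'.target
        · rw [indicator_of_mem hy]
          by_cases hy' : e'.symm y ∈ e.source
          · rw [indicator_of_mem (show y ∈ D' from ⟨hy, hy'⟩)]
            congr 1
            ext η
            exact and_iff_left hy'
          · rw [indicator_of_notMem (fun h => hy' h.2)]
            convert measure_empty (μ := (volume : Measure (Euc d)))
            ext η
            exact iff_of_false (fun h => hy' h.2) (fun h => h)
        · rw [indicator_of_notMem hy, indicator_of_notMem (fun h => hy h.1)]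
    _ = ∫⁻ x in D, ENNReal.ofReal |(fderiv ℝ (e' ∘ e.symm) x).det| *
          volume {η : Euc d | canonicalCoord e' (e' (e.symm x), η) ∈ T} := by
        rw [← himg]
        exact lintegral_image_eq_lintegral_abs_det_fderiv_mul volume hD.measurableSet
          (fun x hx => (hasFDerivAt_transition he he' hx.1 hx.2).hasFDerivWithinAt) hinj _
    _ = ∫⁻ x in D, volume {ξ : Euc d | canonicalCoord e (x, ξ) ∈ T} := by
        refine setLIntegral_congr_fun hD.measurableSet fun x hx => ?_
        set L := fderiv ℝ (e' ∘ e.symm) x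
        have hdet : L.det ≠ 0 := det_fderiv_transition_ne_zero he he' hx.1 hx.2
        have h1 : {η : Euc d | canonicalCoord e' (e' (e.symm x), η) ∈ T} =
            ContinuousLinearMap.adjoint L ⁻¹' {ξ : Euc d | canonicalCoord e (x, ξ) ∈ T} := by
          ext η
          simp only [mem_ofPred_eq, mem_preimage]
          rw [canonicalCoord_transition he he' hx.1 hx.2]
        have h2 : LinearMap.det ((ContinuousLinearMap.adjoint L : Euc d →L[ℝ] Euc d) :
            Euc d →ₗ[ℝ] Euc d) = L.det := det_adjoint L
        rw [h1, Measure.addHaar_preimage_continuousLinearMap _ (by rw [h2]; exact hdet), h2,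
          ← mul_assoc, ← ENNReal.ofReal_mul (abs_nonneg _), ← abs_mul, mul_inv_cancel₀ hdet]
        simp
    _ ≤ ∫⁻ x in e.target, volume {ξ : Euc d | canonicalCoord e (x, ξ) ∈ T} :=
        lintegral_mono_set inter_subset_left

/-- The chart measures agree on overlaps, so over the domain of one chart the supremum which defines
the Liouville measure is the measure of this chart. -/
theorem liouville_restrict (he : IsSmoothChart e) :
    (liouville d Z).restrict {p | p.proj ∈ e.source} = chartLiouville e := by
  set S : Set (CotangentBundle d Z) := {p | p.proj ∈ e.source} with hSdef
  have hS : MeasurableSet S :=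
    (e.open_source.preimage continuous_proj_cotangentBundle).measurableSet
  have hle : ∀ e' : {e' : Chart d Z // IsSmoothChart e'}, chartLiouville e'.1 ≤ liouville d Z :=
    fun e' => le_iSup (fun e : {e : Chart d Z // IsSmoothChart e} => chartLiouville e.1) e'
  have hcompl : chartLiouville e Sᶜ = 0 := by
    rw [chartLiouville_apply he hS.compl, ← lintegral_zero]
    rw [← lintegral_indicator e.open_target.measurableSet]
    refine lintegral_congr fun x => ?_
    by_cases hx : x ∈ e.target
    · rw [indicator_of_mem hx]
      convert measure_empty (μ := (volume : Measure (Euc d)))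
      ext ξ
      exact iff_of_false (fun h => h (e.map_target hx)) (fun h => h)
    · rw [indicator_of_notMem hx]
  apply le_antisymm
  · have h1 : liouville d Z ≤ chartLiouville e + (liouville d Z).restrict Sᶜ := by
      refine iSup_le fun e' => ?_
      rw [Measure.le_iff]
      intro T hT
      change chartLiouville e'.1 T ≤ _
      rw [← measure_inter_add_sdiff T hS, Measure.add_apply, Measure.restrict_apply hT]
      exact add_le_add (chartLiouville_inter_le he e'.2 hT) (hle e' _)
    rw [Measure.le_iff]
    intro T hT
    rw [Measure.restrict_apply hT]
    refine (h1 _).trans ?_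
    rw [Measure.add_apply, Measure.restrict_apply (hT.inter hS)]
    have h2 : T ∩ S ∩ Sᶜ = ∅ := by
      rw [inter_assoc, inter_compl_self, inter_empty]
    rw [h2, measure_empty, add_zero]
    exact measure_mono inter_subset_left
  · rw [Measure.le_iff]
    intro T hT
    rw [Measure.restrict_apply hT, ← measure_inter_add_sdiff T hS]
    have h3 : chartLiouville e (T \ S) = 0 := measure_mono_null (fun p hp => hp.2) hcompl
    rw [h3, add_zero]
    exact hle ⟨e, he⟩ _

theorem IsLocalSymbol.hasCompactSupport {U : Set (Euc d)} {p : Euc d → Euc d → ℂ}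
    (hp : IsLocalSymbol U p) : HasCompactSupport (Function.uncurry p) := by
  obtain ⟨K, hK, -, hs⟩ := hp.support
  refine HasCompactSupport.intro hK fun q hq => ?_
  by_contra h
  exact hq (hs q.1 q.2 h)

theorem IsLocalSymbol.integrable {U : Set (Euc d)} {p : Euc d → Euc d → ℂ}
    (hp : IsLocalSymbol U p) : Integrable (Function.uncurry p) :=
  hp.smooth.continuous.integrable_of_hasCompactSupport hp.hasCompactSupport

theorem integrable_and_integral_liouville_eq (he : IsSmoothChart e) {f : CotangentBundle d Z → ℂ}
    (hf : IsTestSymbol f) (hfe : tsupport f ⊆ {p | p.proj ∈ e.source}) :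
    Integrable f (liouville d Z) ∧
      ∫ p, f p ∂(liouville d Z) = ∫ x, ∫ ξ, localSymbol e f x ξ := by
  have hfs : Function.support f ⊆ {p : CotangentBundle d Z | p.proj ∈ e.source} :=
    (subset_tsupport f).trans hfe
  have hp := (isLocalSymbol_localSymbol he hf hfe).integrable
  have hind : Function.uncurry (localSymbol e f) =
      (e.target ×ˢ univ).indicator (fun q => f (canonicalCoord e q)) := by
    ext ⟨x, ξ⟩
    by_cases hx : x ∈ e.target <;> simp [localSymbol, Function.uncurry, indicator, hx]
  have hm : AEStronglyMeasurable f (chartLiouville e) := hf.1.continuous.aestronglyMeasurable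
  constructor
  · rw [← integrableOn_iff_integrable_of_support_subset hfs, IntegrableOn, liouville_restrict he]
    refine (integrable_map_measure hm (aemeasurable_canonicalCoord he)).2 ?_
    rw [hind, integrable_indicator_iff (measurableSet_phase_domain e)] at hp
    exact hp
  · rw [← setIntegral_eq_integral_of_forall_compl_eq_zero (s := {p | p.proj ∈ e.source})
      (fun p hp => by_contra fun h => hp (hfs h)), liouville_restrict he, chartLiouville,
      integral_map (aemeasurable_canonicalCoord he) hm,
      ← integral_indicator (measurableSet_phase_domain e), ← hind, Measure.volume_eq_prod,
      integral_prod _ hp]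
    rfl

/-! ### Products of test symbols -/

theorem contMDiff_mul_symbol {a b : CotangentBundle d Z → ℂ}
    (ha : ContMDiff (𝓘(ℝ, Euc d).prod 𝓘(ℝ, Euc d →L[ℝ] ℝ)) 𝓘(ℝ, ℂ) ∞ a)
    (hb : ContMDiff (𝓘(ℝ, Euc d).prod 𝓘(ℝ, Euc d →L[ℝ] ℝ)) 𝓘(ℝ, ℂ) ∞ b) :
    ContMDiff (𝓘(ℝ, Euc d).prod 𝓘(ℝ, Euc d →L[ℝ] ℝ)) 𝓘(ℝ, ℂ) ∞ (fun p => a p * b p) :=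
  (contDiff_fst.mul contDiff_snd : ContDiff ℝ ∞ (fun q : ℂ × ℂ => q.1 * q.2)).contMDiff.comp
    (ha.prodMk_space hb)

theorem IsTestSymbol.mul {a b : CotangentBundle d Z → ℂ} (ha : IsTestSymbol a)
    (hb : IsTestSymbol b) : IsTestSymbol (fun p => a p * b p) :=
  ⟨contMDiff_mul_symbol ha.1 hb.1, ha.2.mul_right⟩

theorem IsTestSymbol.conj {a : CotangentBundle d Z → ℂ} (ha : IsTestSymbol a) :
    IsTestSymbol (fun p => (starRingEnd ℂ) (a p)) :=
  ⟨Complex.conjCLE.contDiff.contMDiff.comp ha.1, ha.2.comp_left (map_zero _)⟩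

theorem IsTestSymbol.base_mul {a : CotangentBundle d Z → ℂ} (ha : IsTestSymbol a) {ψ : Z → ℝ}
    (hψ : ContMDiff 𝓘(ℝ, Euc d) 𝓘(ℝ, ℝ) ∞ ψ) : IsTestSymbol (fun p => (ψ p.proj : ℂ) * a p) := by
  refine ⟨contMDiff_mul_symbol ?_ ha.1, ha.2.mul_left⟩
  exact Complex.ofRealCLM.contDiff.contMDiff.comp (hψ.comp (Bundle.contMDiff_proj _))

theorem tsupport_base_mul_subset (a : CotangentBundle d Z → ℂ) (ψ : Z → ℝ) :
    tsupport (fun p : CotangentBundle d Z => (ψ p.proj : ℂ) * a p) ⊆ {p | p.proj ∈ tsupport ψ} := by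
  refine closure_minimal ?_ ((isClosed_tsupport ψ).preimage continuous_proj_cotangentBundle)
  intro p hp
  refine subset_tsupport ψ fun h => hp ?_
  simp [h]

end LocalSymbol

/-! ### The partial Fourier transform of a symbol -/

section Fourier

variable {d : ℕ}

/-- The integrable weight `(1 + |s|)^{-(d+1)}` on `ℝ^d`. -/
def decay (s : Euc d) : ℝ := ((1 + ‖s‖) ^ (d + 1))⁻¹

theorem decay_pos (s : Euc d) : 0 < decay s := by unfold decay; positivity

theorem decay_le_one (s : Euc d) : decay s ≤ 1 :=
  inv_le_one_of_one_le₀ (one_le_pow₀ (by linarith [norm_nonneg s]))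

theorem continuous_decay : Continuous (decay : Euc d → ℝ) := by
  unfold decay
  exact Continuous.inv₀ (by fun_prop) (fun s => by positivity)

theorem integrable_decay : Integrable (decay : Euc d → ℝ) := by
  have h := integrable_one_add_norm (E := Euc d) (μ := volume) (r := (d + 1 : ℝ))
    (by simp)
  refine h.congr (ae_of_all _ fun s => ?_)
  have : (d + 1 : ℝ) = ((d + 1 : ℕ) : ℝ) := by push_cast; rfl
  simp only [decay]
  rw [Real.rpow_neg (by positivity), this, Real.rpow_natCast]

/-- The Weyl kernel is a partial Fourier transform of the symbol, at the scale `2πε`. -/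
theorem weylKernel_eq {ε : ℝ} (p : Euc d → Euc d → ℂ) (x y : Euc d) :
    weylKernel ε p x y = ((((2 * Real.pi * ε) ^ d)⁻¹ : ℝ) : ℂ) *
      𝓕 (p ((2⁻¹ : ℝ) • (x + y))) ((2 * Real.pi * ε)⁻¹ • (y - x)) := by
  rw [weylKernel, Real.fourier_eq']
  congr 1
  refine integral_congr_ae (ae_of_all _ fun ξ => ?_)
  simp only [smul_eq_mul]
  congr 2
  rw [mul_comm]
  congr 2
  rw [inner_smul_right, real_inner_comm, ← neg_sub x y, inner_neg_right]
  have := Real.pi_ne_zero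
  rw [mul_inv, mul_inv]
  field_simp

variable {U : Set (Euc d)} {p : Euc d → Euc d → ℂ}

theorem IsLocalSymbol.contDiff_slice (hp : IsLocalSymbol U p) (x : Euc d) : ContDiff ℝ ∞ (p x) :=
  hp.smooth.comp (contDiff_const.prodMk contDiff_id)

theorem IsLocalSymbol.exists_bound_ball (hp : IsLocalSymbol U p) :
    ∃ R : ℝ, ∀ x ξ, p x ξ ≠ 0 → ξ ∈ Metric.closedBall (0 : Euc d) R := by
  obtain ⟨K, hK, -, hs⟩ := hp.support
  obtain ⟨R, hR⟩ := (hK.image continuous_snd).isBounded.subset_closedBall 0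
  exact ⟨R, fun x ξ h => hR ⟨(x, ξ), hs x ξ h, rfl⟩⟩

theorem IsLocalSymbol.hasCompactSupport_slice (hp : IsLocalSymbol U p) (x : Euc d) :
    HasCompactSupport (p x) := by
  obtain ⟨R, hR⟩ := hp.exists_bound_ball
  exact HasCompactSupport.intro (isCompact_closedBall 0 R) fun ξ hξ =>
    by_contra fun h => hξ (hR x ξ h)

theorem IsLocalSymbol.continuous_fourier (hp : IsLocalSymbol U p) :
    Continuous (fun q : Euc d × Euc d => 𝓕 (p q.1) q.2) := by
  obtain ⟨R, hR⟩ := hp.exists_bound_ball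
  have h1 : Continuous (fun q : Euc d × Euc d => ∫ v in Metric.closedBall (0 : Euc d) R,
      Complex.exp ((↑(-2 * Real.pi * inner ℝ v q.2) * Complex.I)) • p q.1 v) := by
    refine continuous_parametric_integral_of_continuous ?_ (isCompact_closedBall 0 R)
    have h2 : Continuous (fun r : (Euc d × Euc d) × Euc d => p r.1.1 r.2) :=
      hp.smooth.continuous.comp (by fun_prop : Continuous
        (fun r : (Euc d × Euc d) × Euc d => (r.1.1, r.2)))
    have h3 : Continuous (fun r : (Euc d × Euc d) × Euc d =>
        Complex.exp ((↑(-2 * Real.pi * inner ℝ r.2 r.1.2) * Complex.I)) • p r.1.1 r.2) := by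
      refine Continuous.smul (Complex.continuous_exp.comp (Continuous.mul ?_ continuous_const)) h2
      exact Complex.continuous_ofReal.comp
        (continuous_const.mul (continuous_snd.inner continuous_fst.snd))
    exact h3
  refine h1.congr fun q => ?_
  rw [Real.fourier_eq']
  refine setIntegral_eq_integral_of_forall_compl_eq_zero fun v hv => ?_
  rw [by_contra fun h => hv (hR q.1 v h), smul_zero]

/-- The partial Fourier transform decays rapidly, uniformly in the base point. -/
theorem IsLocalSymbol.exists_fourier_le (hp : IsLocalSymbol U p) (n : ℕ) :
    ∃ C : ℝ, ∀ x s, ‖s‖ ^ n * ‖𝓕 (p x) s‖ ≤ C := by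
  obtain ⟨R, hR⟩ := hp.exists_bound_ball
  set P := Function.uncurry p with hP
  have hbd : ∀ j : ℕ, ∃ M : ℝ, 0 ≤ M ∧ ∀ q, ‖iteratedFDeriv ℝ j P q‖ ≤ M := by
    intro j
    have hc : Continuous (iteratedFDeriv ℝ j P) := hp.smooth.continuous_iteratedFDeriv (by
      exact_mod_cast le_top)
    obtain ⟨M, hM⟩ := (hc.norm).bddAbove_range_of_hasCompactSupport
      ((hp.hasCompactSupport.iteratedFDeriv j).norm)
    exact ⟨max M 0, le_max_right _ _, fun q => (hM ⟨q, rfl⟩).trans (le_max_left _ _)⟩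
  choose M hM0 hM using hbd
  -- the derivatives of a slice are restrictions of derivatives of `P`, which are bounded
  have hslice : ∀ x (j : ℕ) v, ‖iteratedFDeriv ℝ j (p x) v‖ ≤ M j := by
    intro x j v
    have e1 : p x = (fun q => P ((x, 0) + q)) ∘ (ContinuousLinearMap.inr ℝ (Euc d) (Euc d)) := by
      ext ξ
      simp [hP]
    have hsm : ContDiff ℝ ∞ (fun q => P ((x, 0) + q)) :=
      hp.smooth.comp (contDiff_const.add contDiff_id)
    rw [e1, ContinuousLinearMap.iteratedFDeriv_comp_right _ hsm _ (by exact_mod_cast le_top),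
      iteratedFDeriv_comp_add_left]
    refine (ContinuousMultilinearMap.norm_compContinuousLinearMap_le _ _).trans ?_
    have h2 : ∏ _i : Fin j, ‖ContinuousLinearMap.inr ℝ (Euc d) (Euc d)‖ ≤ 1 :=
      Finset.prod_le_one (fun _ _ => norm_nonneg _)
        (fun _ _ => ContinuousLinearMap.norm_inr_le_one ℝ (Euc d) (Euc d))
    calc _ ≤ M j * 1 := by
          gcongr
          · exact hM0 j
          · exact hM j _
      _ = M j := mul_one _
  have hsupp : ∀ x (j : ℕ) v, v ∉ Metric.closedBall (0 : Euc d) R →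
      iteratedFDeriv ℝ j (p x) v = 0 := by
    intro x j v hv
    by_contra h
    have h1 : tsupport (p x) ⊆ Metric.closedBall (0 : Euc d) R :=
      closure_minimal (fun ξ hξ => hR x ξ hξ) Metric.isClosed_closedBall
    exact hv (h1 (support_iteratedFDeriv_subset j h))
  have hle : ∀ x (j : ℕ) v, ‖v‖ ^ 0 * ‖iteratedFDeriv ℝ j (p x) v‖ ≤
      (Metric.closedBall (0 : Euc d) R).indicator (fun _ => M j) v := by
    intro x j v
    rw [pow_zero, one_mul]
    by_cases hv : v ∈ Metric.closedBall (0 : Euc d) R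
    · rw [indicator_of_mem hv]; exact hslice x j v
    · rw [indicator_of_notMem hv, hsupp x j v hv, norm_zero]
  have hindint : ∀ j : ℕ, Integrable ((Metric.closedBall (0 : Euc d) R).indicator (fun _ => M j)) :=
    fun j => (integrable_indicator_iff measurableSet_closedBall).2
      (integrableOn_const (measure_closedBall_lt_top.ne))
  have hint : ∀ x (j : ℕ), Integrable (fun v => ‖v‖ ^ 0 * ‖iteratedFDeriv ℝ j (p x) v‖) := by
    intro x j
    refine (hindint j).mono' ?_ (ae_of_all _ fun v => ?_)
    · have hc : Continuous (iteratedFDeriv ℝ j (p x)) :=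
        (hp.contDiff_slice x).continuous_iteratedFDeriv (by exact_mod_cast le_top)
      simpa using hc.norm.aestronglyMeasurable
    · rw [Real.norm_of_nonneg (by positivity)]
      exact hle x j v
  refine ⟨(2 * Real.pi) ^ 0 * (2 * (0 : ℕ) + 2) ^ n *
      ∑ q ∈ Finset.range (0 + 1) ×ˢ Finset.range (n + 1),
        ∫ v, (Metric.closedBall (0 : Euc d) R).indicator (fun _ => M q.2) v, fun x s => ?_⟩
  have h := Real.pow_mul_norm_iteratedFDeriv_fourier_le (K := 0) (N := n) (f := p x)
    ((hp.contDiff_slice x).of_le (by exact_mod_cast le_top))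
    (fun k j hk _ => by
      obtain rfl : k = 0 := by simpa using hk
      exact hint x j) (k := 0) (n := n) le_rfl le_rfl s
  rw [norm_iteratedFDeriv_zero] at h
  refine h.trans ?_
  refine mul_le_mul_of_nonneg_left (Finset.sum_le_sum fun q hq => ?_) (by positivity)
  have hq0 : q.1 = 0 := by
    have := (Finset.mem_product.1 hq).1
    simpa using this
  rw [hq0]
  exact integral_mono (hint x q.2) (hindint q.2) (hle x q.2)

/-! ### The trilinear Fourier identity -/

theorem integral_comp_clm {L : Euc d →L[ℝ] Euc d} (hL : L.det ≠ 0) (F : Euc d → ℂ) :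
    ∫ η, F (L η) = ((|L.det|⁻¹ : ℝ) : ℂ) * ∫ ξ, F ξ := by
  have hinj : Function.Injective L := by
    exact (LinearMap.equivOfDetNeZero (L : Euc d →ₗ[ℝ] Euc d) hL).injective
  have hsurj : Function.Surjective L :=
    (LinearMap.equivOfDetNeZero (L : Euc d →ₗ[ℝ] Euc d) hL).surjective
  have h := integral_image_eq_integral_abs_det_fderiv_smul (volume : Measure (Euc d))
    (s := univ) (f := L) (f' := fun _ => L) MeasurableSet.univ
    (fun x _ => L.hasFDerivAt.hasFDerivWithinAt) hinj.injOn F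
  rw [image_univ, hsurj.range_eq, setIntegral_univ, setIntegral_univ] at h
  rw [h, integral_smul, Complex.real_smul, ← mul_assoc, ← Complex.ofReal_mul,
    inv_mul_cancel₀ (abs_ne_zero.2 hL), Complex.ofReal_one, one_mul]

/-- The effect on the Fourier transform of a linear change of the covector variable. -/
theorem fourier_eq_of_comp_adjoint {L : Euc d →L[ℝ] Euc d} (hL : L.det ≠ 0) {f g : Euc d → ℂ}
    (hfg : ∀ η, f (ContinuousLinearMap.adjoint L η) = g η) (s : Euc d) :
    𝓕 f s = ((|L.det| : ℝ) : ℂ) * 𝓕 g (L s) := by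
  have hL' : (ContinuousLinearMap.adjoint L : Euc d →L[ℝ] Euc d).det ≠ 0 := by
    rwa [det_adjoint]
  have h := integral_comp_clm hL'
    (fun ξ => Complex.exp ((↑(-2 * Real.pi * inner ℝ ξ s) * Complex.I)) • f ξ)
  rw [det_adjoint, ← Real.fourier_eq'] at h
  simp_rw [hfg, ContinuousLinearMap.adjoint_inner_left] at h
  rw [← Real.fourier_eq'] at h
  rw [h, ← mul_assoc, ← Complex.ofReal_mul, mul_inv_cancel₀ (abs_ne_zero.2 hL), Complex.ofReal_one,
    one_mul]

/-- The convolution theorem and Plancherel's formula in one identity. -/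
theorem integral_fourier_trilinear {a f g : Euc d → ℂ} (ha : ContDiff ℝ ∞ a)
    (ha' : HasCompactSupport a) (hf : ContDiff ℝ ∞ f) (hf' : HasCompactSupport f)
    (hg : ContDiff ℝ ∞ g) (hg' : HasCompactSupport g) :
    ∫ s, ∫ r, 𝓕 a s * 𝓕 f (r - s) * (starRingEnd ℂ) (𝓕 g r) =
      ∫ ξ, a ξ * f ξ * (starRingEnd ℂ) (g ξ) := by
  have hconj : ContDiff ℝ ∞ (fun ξ => (starRingEnd ℂ) (g ξ)) := Complex.conjCLE.contDiff.comp hg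
  let A := ha'.toSchwartzMap ha
  let G := hg'.toSchwartzMap hg
  let B : SchwartzMap (Euc d) ℂ :=
    (hf'.mul_right (f' := fun ξ => (starRingEnd ℂ) (g ξ))).toSchwartzMap
    (hf.mul hconj)
  -- translation of `𝓕 f` is modulation of `f`, so the inner integral is Plancherel's formula
  have hinner : ∀ s, ∫ r, 𝓕 f (r - s) * (starRingEnd ℂ) (𝓕 g r) = 𝓕⁻ B s := by
    intro s
    have hmod : ContDiff ℝ ∞ (fun ξ : Euc d =>
        Complex.exp ((↑(2 * Real.pi * inner ℝ ξ s) * Complex.I)) * f ξ) := by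
      refine ContDiff.mul ?_ hf
      refine Complex.contDiff_exp.comp (ContDiff.mul ?_ contDiff_const)
      exact Complex.ofRealCLM.contDiff.comp
        (contDiff_const.mul (contDiff_id.inner ℝ contDiff_const))
    let M : SchwartzMap (Euc d) ℂ := (hf'.mul_left (f := fun ξ : Euc d =>
        Complex.exp ((↑(2 * Real.pi * inner ℝ ξ s) * Complex.I)))).toSchwartzMap hmod
    have h1 := SchwartzMap.integral_inner_fourier_fourier G M
    have h2 : ∀ r, 𝓕 f (r - s) = 𝓕 M r := by
      intro r
      rw [SchwartzMap.fourier_coe, Real.fourier_eq', Real.fourier_eq']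
      refine integral_congr_ae (ae_of_all _ fun ξ => ?_)
      simp only [M, HasCompactSupport.toSchwartzMap_toFun, smul_eq_mul, Pi.mul_apply]
      rw [← mul_assoc, ← Complex.exp_add, inner_sub_right]
      congr 2
      push_cast
      ring
    rw [SchwartzMap.fourierInv_coe, Real.fourierInv_eq']
    simp_rw [h2]
    refine Eq.trans ?_ (h1.trans ?_)
    · refine integral_congr_ae (ae_of_all _ fun r => ?_)
      simp only [RCLike.inner_apply, SchwartzMap.fourier_coe]
      rfl
    · refine integral_congr_ae (ae_of_all _ fun ξ => ?_)
      simp only [RCLike.inner_apply, M, G, B, HasCompactSupport.toSchwartzMap_toFun, smul_eq_mul,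
        Pi.mul_apply]
      rw [← mul_assoc]
  -- the outer integral moves the Fourier transform from `a` to `𝓕⁻ (f * conj g)`
  have h3 := SchwartzMap.integral_fourier_smul_eq A (𝓕⁻ B)
  rw [FourierTransform.fourier_fourierInv_eq] at h3
  refine Eq.trans ?_ (h3.trans ?_)
  · refine integral_congr_ae (ae_of_all _ fun s => ?_)
    simp only [mul_assoc]
    rw [integral_const_mul, hinner s, smul_eq_mul, SchwartzMap.fourier_coe]
    rfl
  · refine integral_congr_ae (ae_of_all _ fun ξ => ?_)
    simp only [A, B, HasCompactSupport.toSchwartzMap_toFun, smul_eq_mul, Pi.mul_apply]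
    ring

/-- The trilinear Fourier identity with each of the outer two functions read in linear coordinates
of its own. -/
theorem integral_fourier_trilinear_comp {a f g a' g' : Euc d → ℂ} (ha : ContDiff ℝ ∞ a)
    (ha' : HasCompactSupport a) (hf : ContDiff ℝ ∞ f) (hf' : HasCompactSupport f)
    (hg : ContDiff ℝ ∞ g) (hg' : HasCompactSupport g) {L M : Euc d →L[ℝ] Euc d}
    (hL : L.det ≠ 0) (hM : M.det ≠ 0)
    (haL : ∀ η, a' (ContinuousLinearMap.adjoint L η) = a η)
    (hgM : ∀ η, g' (ContinuousLinearMap.adjoint M η) = g η) :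
    ∫ s, ∫ r, 𝓕 a' s * 𝓕 f (M r - L s) * (starRingEnd ℂ) (𝓕 g' r) =
      ∫ ξ, a ξ * f ξ * (starRingEnd ℂ) (g ξ) := by
  rw [← integral_fourier_trilinear ha ha' hf hf' hg hg']
  simp_rw [fourier_eq_of_comp_adjoint hL haL, fourier_eq_of_comp_adjoint hM hgM]
  have h1 : ∀ s, ∫ r, ((|L.det| : ℝ) : ℂ) * 𝓕 a (L s) * 𝓕 f (M r - L s) *
      (starRingEnd ℂ) (((|M.det| : ℝ) : ℂ) * 𝓕 g (M r)) =
      ((|L.det| : ℝ) : ℂ) * ∫ r, 𝓕 a (L s) * 𝓕 f (r - L s) * (starRingEnd ℂ) (𝓕 g r) := by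
    intro s
    have h := integral_comp_clm hM
      (fun r => 𝓕 a (L s) * 𝓕 f (r - L s) * (starRingEnd ℂ) (𝓕 g r))
    have h2 : ∫ r, 𝓕 a (L s) * 𝓕 f (r - L s) * (starRingEnd ℂ) (𝓕 g r) = ((|M.det| : ℝ) : ℂ) *
        ∫ r, 𝓕 a (L s) * 𝓕 f (M r - L s) * (starRingEnd ℂ) (𝓕 g (M r)) := by
      rw [h, ← mul_assoc, ← Complex.ofReal_mul, mul_inv_cancel₀ (abs_ne_zero.2 hM),
        Complex.ofReal_one, one_mul]
    rw [h2, ← integral_const_mul, ← integral_const_mul]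
    refine integral_congr_ae (ae_of_all _ fun r => ?_)
    simp only [map_mul, Complex.conj_ofReal]
    ring
  simp_rw [h1]
  rw [integral_const_mul, integral_comp_clm hL
    (fun s => ∫ r, 𝓕 a s * 𝓕 f (r - s) * (starRingEnd ℂ) (𝓕 g r)), ← mul_assoc,
    ← Complex.ofReal_mul, mul_inv_cancel₀ (abs_ne_zero.2 hL), Complex.ofReal_one, one_mul]

end Fourier

/-! ### Transport of kernels to the manifold -/

section Transport

variable {d : ℕ} {Z : Type*} [TopologicalSpace Z] {ρ : Chart d Z → Euc d → ℝ} {e : Chart d Z}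

/-- The factor `χ ρ^{-1/2}` by which a kernel on `ℝ^d` is multiplied, in each variable, when it is
transported to the manifold. -/
def pieceWeight (ρ : Chart d Z → Euc d → ℝ) (e : Chart d Z) (χ : Z → ℝ) (z : Z) : ℝ :=
  χ z * (Real.sqrt (ρ e (e z)))⁻¹

/-- The transport to the manifold of a kernel on `ℝ^d`, with a cutoff `χ`. -/
def pieceKernel (ρ : Chart d Z → Euc d → ℝ) (e : Chart d Z) (χ : Z → ℝ) (k : Euc d → Euc d → ℂ)
    (z z' : Z) : ℂ :=
  ((pieceWeight ρ e χ z * pieceWeight ρ e χ z' : ℝ) : ℂ) * k (e z) (e z')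

/-- A cutoff with values in `[0, 1]` and closed support in the domain of the chart `e`. -/
structure IsCutoff (e : Chart d Z) (χ : Z → ℝ) : Prop where
  continuous : Continuous χ
  support : tsupport χ ⊆ e.source
  mem_Icc : ∀ z, χ z ∈ Icc (0 : ℝ) 1

variable {χ : Z → ℝ}

theorem IsCutoff.eq_zero (hχ : IsCutoff e χ) {z : Z} (hz : z ∉ e.source) : χ z = 0 := by
  by_contra h
  exact hz (hχ.support (subset_tsupport χ h))

theorem IsCutoff.pieceWeight_eq_zero (hχ : IsCutoff e χ) {z : Z} (hz : z ∉ e.source) :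
    pieceWeight ρ e χ z = 0 := by
  rw [pieceWeight, hχ.eq_zero hz, zero_mul]

theorem continuousOn_pieceWeight [ChartedSpace (Euc d) Z] [MeasurableSpace Z] {μ : Measure Z}
    (hμ : IsSmoothMeasure μ ρ) (he : IsSmoothChart e) (hχ : IsCutoff e χ) :
    ContinuousOn (pieceWeight ρ e χ) e.source := by
  refine hχ.continuous.continuousOn.mul (ContinuousOn.inv₀ ?_ fun z hz => ?_)
  · exact Real.continuous_sqrt.comp_continuousOn
      ((hμ.smooth e he).continuousOn.comp e.continuousOn e.mapsTo)
  · exact (Real.sqrt_pos.2 (hμ.pos e he _ (e.map_source hz))).ne'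

end Transport

/-! ### Smooth measures in charts -/

section SmoothMeasure

variable {d : ℕ} {Z : Type*} [TopologicalSpace Z] [ChartedSpace (Euc d) Z]
  [MeasurableSpace Z] {μ : Measure Z} {ρ : Chart d Z → Euc d → ℝ} {e : Chart d Z}

theorem IsSmoothMeasure.aemeasurable_density (hμ : IsSmoothMeasure μ ρ) (he : IsSmoothChart e) :
    AEMeasurable (fun x => ENNReal.ofReal (ρ e x)) (volume.restrict e.target) :=
  ((hμ.smooth e he).continuousOn.aemeasurable e.open_target.measurableSet).ennreal_ofReal

variable [BorelSpace Z]

theorem aemeasurable_chart_symm {Z : Type*} [TopologicalSpace Z] [MeasurableSpace Z] [BorelSpace Z]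
    (e : Chart d Z) :
    AEMeasurable e.symm ((volume : Measure (Euc d)).restrict e.target) :=
  e.continuousOn_symm.aemeasurable e.open_target.measurableSet

theorem IsSmoothMeasure.restrict_eq_map (hμ : IsSmoothMeasure μ ρ) (he : IsSmoothChart e) :
    μ.restrict e.source =
      ((volume.restrict e.target).withDensity (fun x => ENNReal.ofReal (ρ e x))).map e.symm := by
  rw [← hμ.map_eq e he, AEMeasurable.map_map_of_aemeasurable]
  · have h : (e.symm ∘ e) =ᵐ[μ.restrict e.source] id := by
      filter_upwards [ae_restrict_mem e.open_source.measurableSet] with z hz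
      exact e.left_inv hz
    rw [Measure.map_congr h, Measure.map_id]
  · rw [hμ.map_eq e he]
    exact (aemeasurable_chart_symm e).mono_ac (withDensity_absolutelyContinuous _ _)
  · exact e.continuousOn.aemeasurable e.open_source.measurableSet

/-- One inequality is enough for the estimates, and it needs no measurability of `F`. -/
theorem IsSmoothMeasure.lintegral_source_le (hμ : IsSmoothMeasure μ ρ) (he : IsSmoothChart e)
    (F : Z → ℝ≥0∞) :
    ∫⁻ z in e.source, F z ∂μ ≤ ∫⁻ x in e.target, ENNReal.ofReal (ρ e x) * F (e.symm x) := by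
  rw [hμ.restrict_eq_map he]
  refine (lintegral_map_le _ _).trans (le_of_eq ?_)
  rw [lintegral_withDensity_eq_lintegral_mul_non_measurable₀ _ (hμ.aemeasurable_density he)
    (ae_of_all _ fun x => ENNReal.ofReal_lt_top)]
  rfl

theorem IsSmoothMeasure.integral_source_eq (hμ : IsSmoothMeasure μ ρ) (he : IsSmoothChart e)
    {G : Z → ℂ} (hG : AEStronglyMeasurable G (μ.restrict e.source)) :
    ∫ z in e.source, G z ∂μ = ∫ x in e.target, (ρ e x : ℂ) * G (e.symm x) := by
  rw [hμ.restrict_eq_map he] at hG ⊢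
  rw [integral_map
    ((aemeasurable_chart_symm e).mono_ac (withDensity_absolutelyContinuous _ _))
    hG,
    integral_withDensity_eq_integral_toReal_smul₀ (hμ.aemeasurable_density he)
    (ae_of_all _ fun x => ENNReal.ofReal_lt_top)]
  refine setIntegral_congr_fun e.open_target.measurableSet fun x hx => ?_
  rw [ENNReal.toReal_ofReal (hμ.pos e he x hx).le, Complex.real_smul]

theorem IsSmoothMeasure.isLocallyFiniteMeasure [IsManifold 𝓘(ℝ, Euc d) ∞ Z]
    (hμ : IsSmoothMeasure μ ρ) : IsLocallyFiniteMeasure μ := by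
  refine ⟨fun z => ?_⟩
  set e := chartAt (Euc d) z
  have he : IsSmoothChart e := isSmoothChart_chartAt z
  have hz : e z ∈ e.target := e.map_source (mem_chart_source _ z)
  obtain ⟨r, hr, hB⟩ := Metric.nhds_basis_closedBall.mem_iff.1 (e.open_target.mem_nhds hz)
  set B := Metric.closedBall (e z) r
  have hBc : IsCompact B := isCompact_closedBall _ _
  have hsub : e.source ∩ e ⁻¹' B ⊆ e.source := inter_subset_left
  have hnhds : e.source ∩ e ⁻¹' B ∈ 𝓝 z :=
    inter_mem (e.open_source.mem_nhds (mem_chart_source _ z))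
      ((e.continuousAt (mem_chart_source _ z)).preimage_mem_nhds
        (Metric.closedBall_mem_nhds _ hr))
  refine ⟨_, hnhds, ?_⟩
  obtain ⟨M, hM⟩ := (hBc.image_of_continuousOn ((hμ.smooth e he).continuousOn.mono hB)).bddAbove
  have hmeas : MeasurableSet (e.source ∩ e ⁻¹' B) :=
    measurableSet_inter_preimage_of_continuousOn e.continuousOn e.open_source.measurableSet
      hBc.isClosed.measurableSet
  calc μ (e.source ∩ e ⁻¹' B)
      = ∫⁻ z in e.source, (e.source ∩ e ⁻¹' B).indicator 1 z ∂μ := by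
        rw [lintegral_indicator_one hmeas, Measure.restrict_apply hmeas, inter_eq_left.2 hsub]
    _ ≤ ∫⁻ x in e.target, ENNReal.ofReal (ρ e x) * (e.source ∩ e ⁻¹' B).indicator 1 (e.symm x) :=
        hμ.lintegral_source_le he _
    _ ≤ ∫⁻ x in e.target, B.indicator (fun _ => ENNReal.ofReal M) x := by
        refine setLIntegral_mono' e.open_target.measurableSet fun x hx => ?_
        by_cases hxB : x ∈ B
        · rw [indicator_of_mem hxB]
          calc _ ≤ ENNReal.ofReal M * 1 := by
                gcongr
                · exact hM ⟨x, hxB, rfl⟩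
                · exact indicator_le_self' (by simp) _
            _ = _ := mul_one _
        · rw [indicator_of_notMem hxB, indicator_of_notMem, mul_zero]
          intro h
          have h2 : e (e.symm x) ∈ B := h.2
          rw [e.right_inv hx] at h2
          exact hxB h2
    _ ≤ ∫⁻ x, B.indicator (fun _ => ENNReal.ofReal M) x := setLIntegral_le_lintegral _ _
    _ < ⊤ := by
        rw [lintegral_indicator hBc.isClosed.measurableSet, setLIntegral_const]
        exact ENNReal.mul_lt_top ENNReal.ofReal_lt_top hBc.measure_lt_top

variable {χ : Z → ℝ}

theorem measurable_pieceWeight (hμ : IsSmoothMeasure μ ρ) (he : IsSmoothChart e)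
    (hχ : IsCutoff e χ) : Measurable (pieceWeight ρ e χ) := by
  classical
  have h := (continuousOn_pieceWeight hμ he hχ).measurable_piecewise
    (continuousOn_const (c := (0 : ℝ)) (s := e.sourceᶜ)) e.open_source.measurableSet
  convert h using 1
  ext z
  by_cases hz : z ∈ e.source
  · simp [hz]
  · simp [hz, hχ.pieceWeight_eq_zero hz]

theorem measurable_pieceKernel (hμ : IsSmoothMeasure μ ρ) (he : IsSmoothChart e)
    (hχ : IsCutoff e χ) {k : Euc d → Euc d → ℂ} (hk : Measurable (Function.uncurry k)) :
    Measurable (Function.uncurry (pieceKernel ρ e χ k)) := by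
  classical
  have hE : Measurable (e.source.piecewise e (fun _ => (0 : Euc d))) :=
    e.continuousOn.measurable_piecewise continuousOn_const e.open_source.measurableSet
  have hg := measurable_pieceWeight hμ he hχ
  have h : Measurable (fun q : Z × Z => ((pieceWeight ρ e χ q.1 * pieceWeight ρ e χ q.2 : ℝ) : ℂ) *
      Function.uncurry k (e.source.piecewise e (fun _ => (0 : Euc d)) q.1,
        e.source.piecewise e (fun _ => (0 : Euc d)) q.2)) :=
    (Complex.measurable_ofReal.comp ((hg.comp measurable_fst).mul (hg.comp measurable_snd))).mul
      (hk.comp ((hE.comp measurable_fst).prodMk (hE.comp measurable_snd)))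
  convert h using 1
  ext ⟨z, z'⟩
  by_cases hz : z ∈ e.source
  · by_cases hz' : z' ∈ e.source
    · simp [pieceKernel, hz, hz', Function.uncurry]
    · simp [pieceKernel, hχ.pieceWeight_eq_zero hz', Function.uncurry]
  · simp [pieceKernel, hχ.pieceWeight_eq_zero hz, Function.uncurry]

theorem lintegral_pieceWeight_sq_le (hμ : IsSmoothMeasure μ ρ) (he : IsSmoothChart e)
    (hχ : IsCutoff e χ) (F : Euc d → ℝ≥0∞) :
    ∫⁻ z, ‖pieceWeight ρ e χ z‖ₑ ^ 2 * F (e z) ∂μ ≤ ∫⁻ x, F x := by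
  have h1 : ∫⁻ z, ‖pieceWeight ρ e χ z‖ₑ ^ 2 * F (e z) ∂μ =
      ∫⁻ z in e.source, ‖pieceWeight ρ e χ z‖ₑ ^ 2 * F (e z) ∂μ := by
    refine (setLIntegral_eq_of_support_subset ?_).symm
    intro z hz
    by_contra h
    exact hz (by simp [hχ.pieceWeight_eq_zero h])
  rw [h1]
  refine (hμ.lintegral_source_le he _).trans ?_
  refine le_trans ?_ (setLIntegral_le_lintegral e.target F)
  refine setLIntegral_mono' e.open_target.measurableSet fun x hx => ?_
  rw [e.right_inv hx, ← mul_assoc]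
  have hρ := hμ.pos e he x hx
  have h2 : ENNReal.ofReal (ρ e x) * ‖pieceWeight ρ e χ (e.symm x)‖ₑ ^ 2 ≤ 1 := by
    rw [Real.enorm_eq_ofReal_abs, ← ENNReal.ofReal_pow (abs_nonneg _), ← ENNReal.ofReal_mul hρ.le,
      sq_abs, pieceWeight, e.right_inv hx, ENNReal.ofReal_le_one, mul_pow, inv_pow,
      Real.sq_sqrt hρ.le, mul_comm, mul_assoc, inv_mul_cancel₀ hρ.ne', mul_one]
    exact pow_le_one₀ (hχ.mem_Icc _).1 (hχ.mem_Icc _).2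
  calc _ ≤ 1 * F x := by gcongr
    _ = F x := one_mul _

/-- Half-densities: the transport does not increase the Hilbert–Schmidt norm. -/
theorem hsNormSq_pieceKernel_le (hμ : IsSmoothMeasure μ ρ) (he : IsSmoothChart e)
    (hχ : IsCutoff e χ) (k : Euc d → Euc d → ℂ) :
    hsNormSq μ (pieceKernel ρ e χ k) ≤ hsNormSq volume k := by
  refine le_trans ?_ (lintegral_pieceWeight_sq_le hμ he hχ (fun x => ∫⁻ y, ‖k x y‖ₑ ^ 2))
  refine lintegral_mono fun z => ?_
  have h0 : ‖pieceWeight ρ e χ z‖ₑ ^ 2 ≠ ⊤ := ENNReal.pow_ne_top enorm_ne_top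
  calc ∫⁻ z', ‖pieceKernel ρ e χ k z z'‖ₑ ^ 2 ∂μ
      = ∫⁻ z', ‖pieceWeight ρ e χ z‖ₑ ^ 2 *
          (‖pieceWeight ρ e χ z'‖ₑ ^ 2 * ‖k (e z) (e z')‖ₑ ^ 2) ∂μ := by
        refine lintegral_congr fun z' => ?_
        rw [pieceKernel, enorm_mul, Complex.ofReal_mul, enorm_mul, mul_pow, mul_pow, mul_assoc]
        rw [← ofReal_norm (_ : ℂ), ← ofReal_norm (_ : ℂ)]
        simp only [Complex.norm_real, ofReal_norm]
    _ = ‖pieceWeight ρ e χ z‖ₑ ^ 2 *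
          ∫⁻ z', ‖pieceWeight ρ e χ z'‖ₑ ^ 2 * ‖k (e z) (e z')‖ₑ ^ 2 ∂μ :=
        lintegral_const_mul' _ _ h0
    _ ≤ ‖pieceWeight ρ e χ z‖ₑ ^ 2 * ∫⁻ y, ‖k (e z) y‖ₑ ^ 2 := by
        gcongr
        exact lintegral_pieceWeight_sq_le hμ he hχ (fun y => ‖k (e z) y‖ₑ ^ 2)

end SmoothMeasure

/-! ### Estimates of the kernels on the model space -/

section ScaledKernels

variable {d : ℕ}

/-- The kernel of the pseudo-differential operator with symbol `p` on `ℝ^d`, with the scale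
`h = 2πε` as its parameter. -/
def scaledKernel (h : ℝ) (p : Euc d → Euc d → ℂ) (x y : Euc d) : ℂ :=
  (((h ^ d)⁻¹ : ℝ) : ℂ) * 𝓕 (p ((2⁻¹ : ℝ) • (x + y))) (h⁻¹ • (y - x))

open Classical in
/-- The kernel `scaledKernel h p`, cut off at the distance `δ` from the diagonal. -/
def truncKernel (h δ : ℝ) (p : Euc d → Euc d → ℂ) (x y : Euc d) : ℂ :=
  if ‖y - x‖ < δ then scaledKernel h p x y else 0

theorem weylKernel_eq_scaledKernel (ε : ℝ) (p : Euc d → Euc d → ℂ) :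
    weylKernel ε p = scaledKernel (2 * Real.pi * ε) p := by
  ext x y
  exact weylKernel_eq p x y

variable {U : Set (Euc d)} {p : Euc d → Euc d → ℂ}

theorem IsLocalSymbol.measurable_scaledKernel (hp : IsLocalSymbol U p) (h : ℝ) :
    Measurable (Function.uncurry (scaledKernel h p)) := by
  have h1 : Continuous (fun q : Euc d × Euc d => ((2⁻¹ : ℝ) • (q.1 + q.2), h⁻¹ • (q.2 - q.1))) := by
    fun_prop
  exact (continuous_const.mul (hp.continuous_fourier.comp h1)).measurable

theorem IsLocalSymbol.measurable_truncKernel (hp : IsLocalSymbol U p) (h δ : ℝ) :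
    Measurable (Function.uncurry (truncKernel h δ p)) := by
  have h1 : MeasurableSet {q : Euc d × Euc d | ‖q.2 - q.1‖ < δ} :=
    (isOpen_lt (by fun_prop) continuous_const).measurableSet
  exact Measurable.ite h1 (hp.measurable_scaledKernel h) measurable_const

theorem lintegral_comp_add_smul {h : ℝ} (hh : 0 < h) (x : Euc d) {B : Euc d → ℝ≥0∞}
    (hB : Measurable B) :
    ∫⁻ y, B y = ENNReal.ofReal (h ^ d) * ∫⁻ s, B (x + h • s) := by
  have h1 : ∫⁻ s, B (x + h • s) = ∫⁻ v, B (x + v) ∂(Measure.map (fun s : Euc d => h • s) volume) :=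
    (lintegral_map (hB.comp (measurable_const_add x)) (measurable_const_smul h)).symm
  rw [h1, Measure.map_addHaar_smul volume hh.ne', lintegral_smul_measure,
    lintegral_add_left_eq_self, smul_eq_mul, ← mul_assoc, ← ENNReal.ofReal_mul (by positivity),
    finrank_euclideanSpace_fin, abs_of_pos (by positivity), mul_inv_cancel₀ (by positivity),
    ENNReal.ofReal_one, one_mul]

/-- Change of variables from `(x, y)` to the midpoint and the rescaled difference. -/
theorem lintegral_midpoint {h : ℝ} (hh : 0 < h) {A B : Euc d → ℝ≥0∞} (hA : Measurable A)
    (hB : Measurable B) :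
    ∫⁻ x, ∫⁻ y, A ((2⁻¹ : ℝ) • (x + y)) * B (h⁻¹ • (y - x)) =
      ENNReal.ofReal (h ^ d) * ((∫⁻ x, A x) * ∫⁻ s, B s) := by
  have h1 : ∀ x : Euc d, ∫⁻ y, A ((2⁻¹ : ℝ) • (x + y)) * B (h⁻¹ • (y - x)) =
      ENNReal.ofReal (h ^ d) * ∫⁻ s, A (x + (2⁻¹ * h) • s) * B s := by
    intro x
    have hm : Measurable (fun y : Euc d => A ((2⁻¹ : ℝ) • (x + y)) * B (h⁻¹ • (y - x))) :=
      (hA.comp (by fun_prop)).mul (hB.comp (by fun_prop))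
    rw [lintegral_comp_add_smul hh x hm]
    congr 1
    refine lintegral_congr fun s => ?_
    rw [add_sub_cancel_left, smul_smul, inv_mul_cancel₀ hh.ne', one_smul]
    congr 2
    rw [← add_assoc, smul_add, ← two_smul ℝ x, smul_smul, smul_smul]
    norm_num
  simp_rw [h1]
  have hm : Measurable (fun q : Euc d × Euc d => A (q.1 + (2⁻¹ * h) • q.2) * B q.2) :=
    (hA.comp (by fun_prop)).mul (hB.comp measurable_snd)
  rw [lintegral_const_mul _ hm.lintegral_prod_right', lintegral_lintegral_swap hm.aemeasurable]
  congr 1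
  rw [← lintegral_const_mul _ hB]
  refine lintegral_congr fun s => ?_
  have hA' : Measurable (fun x : Euc d => A (x + (2⁻¹ * h) • s)) := hA.comp (by fun_prop)
  simp only
  rw [lintegral_mul_const _ hA', lintegral_add_right_eq_self]

/-- A kernel which is concentrated near the diagonal at the scale `h`, over a compact set of
midpoints, has a Hilbert–Schmidt norm controlled by its size. -/
theorem hsNormSq_le_of_concentrated {h : ℝ} (hh : 0 < h) {K : Set (Euc d)} (hK : MeasurableSet K)
    {M : ℝ} (hM : 0 ≤ M) {F : Euc d → Euc d → ℂ}
    (hF : ∀ x y, ‖F x y‖ ^ 2 ≤ K.indicator (fun _ => M) ((2⁻¹ : ℝ) • (x + y)) *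
      decay (h⁻¹ • (y - x))) :
    hsNormSq volume F ≤ ENNReal.ofReal (h ^ d * M) *
      (volume K * ∫⁻ s : Euc d, ENNReal.ofReal (decay s)) := by
  have h2 : ∀ x y, ‖F x y‖ₑ ^ 2 ≤ K.indicator (fun _ => ENNReal.ofReal M) ((2⁻¹ : ℝ) • (x + y)) *
      ENNReal.ofReal (decay (h⁻¹ • (y - x))) := by
    intro x y
    have h3 := ENNReal.ofReal_le_ofReal (hF x y)
    rw [ENNReal.ofReal_pow (norm_nonneg _), ofReal_norm,
      ENNReal.ofReal_mul (indicator_nonneg (fun _ _ => hM) _)] at h3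
    refine h3.trans (le_of_eq ?_)
    congr 1
    by_cases hm : (2⁻¹ : ℝ) • (x + y) ∈ K
    · rw [indicator_of_mem hm, indicator_of_mem hm]
    · rw [indicator_of_notMem hm, indicator_of_notMem hm, ENNReal.ofReal_zero]
  calc hsNormSq volume F ≤ _ := lintegral_mono fun x => lintegral_mono fun y => h2 x y
    _ = ENNReal.ofReal (h ^ d) * ((∫⁻ x, K.indicator (fun _ => ENNReal.ofReal M) x) *
          ∫⁻ s : Euc d, ENNReal.ofReal (decay s)) :=
        lintegral_midpoint hh (measurable_const.indicator hK)
          continuous_decay.measurable.ennreal_ofReal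
    _ = _ := by
        rw [lintegral_indicator_const hK, ENNReal.ofReal_mul (by positivity)]
        ring

theorem lintegral_decay_ne_top : ∫⁻ s : Euc d, ENNReal.ofReal (decay s) ≠ ⊤ :=
  ((integrable_decay (d := d)).lintegral_lt_top).ne

theorem IsLocalSymbol.exists_base (hp : IsLocalSymbol U p) :
    ∃ K : Set (Euc d), IsCompact K ∧ K ⊆ U ∧ ∀ x, x ∉ K → p x = 0 := by
  obtain ⟨K, hK, hKU, hs⟩ := hp.support
  refine ⟨Prod.fst '' K, hK.image continuous_fst, ?_, fun x hx => ?_⟩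
  · rintro _ ⟨q, hq, rfl⟩
    exact (hKU hq).1
  · ext ξ
    by_contra h
    exact hx ⟨(x, ξ), hs x ξ h, rfl⟩

/-- Rapid decay with an integrable factor left over. -/
theorem IsLocalSymbol.exists_pow_fourier_le_decay (hp : IsLocalSymbol U p) (n : ℕ) :
    ∃ C : ℝ, 0 ≤ C ∧ ∀ x s, ‖s‖ ^ n * ‖𝓕 (p x) s‖ ≤ C * decay s := by
  obtain ⟨C₀, h₀⟩ := hp.exists_fourier_le n
  obtain ⟨C₁, h₁⟩ := hp.exists_fourier_le (n + (d + 1))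
  have hC₀ : 0 ≤ C₀ := le_trans (by positivity) (h₀ 0 0)
  have hC₁ : 0 ≤ C₁ := le_trans (by positivity) (h₁ 0 0)
  refine ⟨2 ^ d * (C₀ + C₁), by positivity, fun x s => ?_⟩
  rw [decay, ← div_eq_mul_inv, le_div_iff₀ (by positivity)]
  have h := add_pow_le (zero_le_one (α := ℝ)) (norm_nonneg s) (d + 1)
  calc ‖s‖ ^ n * ‖𝓕 (p x) s‖ * (1 + ‖s‖) ^ (d + 1)
      ≤ ‖s‖ ^ n * ‖𝓕 (p x) s‖ * (2 ^ (d + 1 - 1) * (1 ^ (d + 1) + ‖s‖ ^ (d + 1))) := by gcongr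
    _ = 2 ^ d * (‖s‖ ^ n * ‖𝓕 (p x) s‖ + ‖s‖ ^ (n + (d + 1)) * ‖𝓕 (p x) s‖) := by
        rw [Nat.add_sub_cancel, one_pow]; ring
    _ ≤ 2 ^ d * (C₀ + C₁) := by
        gcongr
        · exact h₀ x s
        · exact h₁ x s

theorem norm_scaledKernel {h : ℝ} (hh : 0 < h) (p : Euc d → Euc d → ℂ) (x y : Euc d) :
    ‖scaledKernel h p x y‖ =
      (h ^ d)⁻¹ * ‖𝓕 (p ((2⁻¹ : ℝ) • (x + y))) (h⁻¹ • (y - x))‖ := by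
  rw [scaledKernel, norm_mul, Complex.norm_real, Real.norm_of_nonneg (by positivity)]

theorem fourier_zero_fun (s : Euc d) : 𝓕 (0 : Euc d → ℂ) s = 0 := by
  rw [Real.fourier_eq']; simp

theorem IsLocalSymbol.hsNormSq_scaledKernel_le (hp : IsLocalSymbol U p) :
    ∃ C : ℝ, 0 ≤ C ∧ ∀ h, 0 < h →
      hsNormSq volume (scaledKernel h p) ≤ ENNReal.ofReal ((h ^ d)⁻¹ * C) := by
  obtain ⟨K, hK, -, hs⟩ := hp.exists_base
  obtain ⟨C, hC, hb⟩ := hp.exists_pow_fourier_le_decay 0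
  have hfin : volume K * ∫⁻ s : Euc d, ENNReal.ofReal (decay s) ≠ ⊤ :=
    ENNReal.mul_ne_top hK.measure_lt_top.ne lintegral_decay_ne_top
  refine ⟨C ^ 2 * (volume K * ∫⁻ s : Euc d, ENNReal.ofReal (decay s)).toReal, by positivity,
    fun h hh => ?_⟩
  refine (hsNormSq_le_of_concentrated (M := ((h ^ d)⁻¹ * C) ^ 2) hh hK.isClosed.measurableSet
    (by positivity) fun x y => ?_).trans ?_
  · rw [norm_scaledKernel hh]
    by_cases hx : (2⁻¹ : ℝ) • (x + y) ∈ K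
    · rw [indicator_of_mem hx]
      have h1 := hb ((2⁻¹ : ℝ) • (x + y)) (h⁻¹ • (y - x))
      rw [pow_zero, one_mul] at h1
      have h2 := decay_pos (h⁻¹ • (y - x))
      have h3 := decay_le_one (h⁻¹ • (y - x))
      calc _ ≤ ((h ^ d)⁻¹ * (C * decay (h⁻¹ • (y - x)))) ^ 2 := by gcongr
        _ = ((h ^ d)⁻¹ * C) ^ 2 * (decay (h⁻¹ • (y - x)) * decay (h⁻¹ • (y - x))) := by ring
        _ ≤ ((h ^ d)⁻¹ * C) ^ 2 * (decay (h⁻¹ • (y - x)) * 1) := by gcongr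
        _ = _ := by rw [mul_one]
    · rw [hs _ hx, fourier_zero_fun, norm_zero, mul_zero, indicator_of_notMem hx]
      simp
  · rw [← ENNReal.ofReal_toReal hfin, ← ENNReal.ofReal_mul (by positivity)]
    refine ENNReal.ofReal_le_ofReal (le_of_eq ?_)
    rw [ENNReal.toReal_ofReal (by positivity)]
    have : h ^ d ≠ 0 := by positivity
    field_simp

/-- Far from the diagonal the kernel is negligible: there the rescaled difference `s` satisfies
`|s| ≥ δ/h`, and `d + 1` powers of `|s|` are traded for a factor `h^{d+1}`. -/
theorem IsLocalSymbol.tendsto_hsNormSq_sub_truncKernel (hp : IsLocalSymbol U p) {δ : ℝ}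
    (hδ : 0 < δ) :
    Tendsto (fun h => hsNormSq volume (fun x y => scaledKernel h p x y - truncKernel h δ p x y))
      (𝓝[>] 0) (𝓝 0) := by
  obtain ⟨K, hK, -, hs⟩ := hp.exists_base
  obtain ⟨C, hC, hb⟩ := hp.exists_pow_fourier_le_decay (d + 1)
  have hfin : volume K * ∫⁻ s : Euc d, ENNReal.ofReal (decay s) ≠ ⊤ :=
    ENNReal.mul_ne_top hK.measure_lt_top.ne lintegral_decay_ne_top
  set D := (volume K * ∫⁻ s : Euc d, ENNReal.ofReal (decay s)).toReal with hD
  have hle : ∀ h : ℝ, 0 < h →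
      hsNormSq volume (fun x y => scaledKernel h p x y - truncKernel h δ p x y) ≤
        ENNReal.ofReal (h ^ (d + 2) * ((δ⁻¹ ^ (d + 1) * C) ^ 2 * D)) := by
    intro h hh
    refine (hsNormSq_le_of_concentrated (M := (h * (δ⁻¹ ^ (d + 1) * C)) ^ 2) hh
      hK.isClosed.measurableSet (by positivity) fun x y => ?_).trans ?_
    · by_cases hxy : ‖y - x‖ < δ
      · rw [truncKernel, if_pos hxy, sub_self, norm_zero, zero_pow two_ne_zero]
        exact mul_nonneg (indicator_nonneg (fun _ _ => by positivity) _) (decay_pos _).le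
      rw [truncKernel, if_neg hxy, sub_zero, norm_scaledKernel hh]
      by_cases hx : (2⁻¹ : ℝ) • (x + y) ∈ K
      · rw [indicator_of_mem hx]
        set s := h⁻¹ • (y - x) with hsdef
        have h1 := hb ((2⁻¹ : ℝ) • (x + y)) s
        have h2 := decay_pos s
        have h3 := decay_le_one s
        have hsn : h⁻¹ * δ ≤ ‖s‖ := by
          rw [hsdef, norm_smul, Real.norm_of_nonneg (by positivity)]
          gcongr
          exact not_lt.1 hxy
        have h4 : (h⁻¹ * δ) ^ (d + 1) * ‖𝓕 (p ((2⁻¹ : ℝ) • (x + y))) s‖ ≤ C * decay s :=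
          le_trans (by gcongr) h1
        have h5 : (h ^ d)⁻¹ * ‖𝓕 (p ((2⁻¹ : ℝ) • (x + y))) s‖ ≤
            h * (δ⁻¹ ^ (d + 1) * C) * decay s := by
          have h6 : (h ^ d)⁻¹ = h * δ⁻¹ ^ (d + 1) * (h⁻¹ * δ) ^ (d + 1) := by
            rw [mul_assoc, ← mul_pow, show δ⁻¹ * (h⁻¹ * δ) = h⁻¹ by field_simp, pow_succ, inv_pow,
              mul_comm, mul_assoc, inv_mul_cancel₀ hh.ne', mul_one]
          calc (h ^ d)⁻¹ * ‖𝓕 (p ((2⁻¹ : ℝ) • (x + y))) s‖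
              = h * δ⁻¹ ^ (d + 1) * ((h⁻¹ * δ) ^ (d + 1) * ‖𝓕 (p ((2⁻¹ : ℝ) • (x + y))) s‖) := by
                rw [h6]; ring
            _ ≤ h * δ⁻¹ ^ (d + 1) * (C * decay s) := by gcongr
            _ = _ := by ring
        calc _ ≤ (h * (δ⁻¹ ^ (d + 1) * C) * decay s) ^ 2 := by gcongr
          _ = (h * (δ⁻¹ ^ (d + 1) * C)) ^ 2 * (decay s * decay s) := by ring
          _ ≤ (h * (δ⁻¹ ^ (d + 1) * C)) ^ 2 * (decay s * 1) := by gcongr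
          _ = _ := by rw [mul_one]
      · rw [hs _ hx, fourier_zero_fun, norm_zero, mul_zero, indicator_of_notMem hx]
        simp
    · rw [← ENNReal.ofReal_toReal hfin, ← ENNReal.ofReal_mul (by positivity), ← hD]
      refine ENNReal.ofReal_le_ofReal (le_of_eq ?_)
      ring
  have hlim : Tendsto (fun h : ℝ => ENNReal.ofReal (h ^ (d + 2) * ((δ⁻¹ ^ (d + 1) * C) ^ 2 * D)))
      (𝓝[>] 0) (𝓝 0) := by
    have hc : Continuous (fun h : ℝ =>
        ENNReal.ofReal (h ^ (d + 2) * ((δ⁻¹ ^ (d + 1) * C) ^ 2 * D))) :=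
      ENNReal.continuous_ofReal.comp (by fun_prop)
    have := (hc.tendsto 0).mono_left (nhdsWithin_le_nhds (s := Ioi 0))
    simpa using this
  refine tendsto_of_tendsto_of_tendsto_of_le_of_le' tendsto_const_nhds hlim
    (Eventually.of_forall fun _ => zero_le) ?_
  filter_upwards [self_mem_nhdsWithin] with h hh using hle h hh

theorem norm_truncKernel_le {h : ℝ} (δ : ℝ) (p : Euc d → Euc d → ℂ) (x y : Euc d) :
    ‖truncKernel h δ p x y‖ ≤ ‖scaledKernel h p x y‖ := by
  unfold truncKernel
  split_ifs
  · exact le_rfl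
  · simp

/-- Cut off near enough to the diagonal, the kernel lives on a compact subset of `U`, although the
condition on the support of the symbol only concerns midpoints. -/
theorem IsLocalSymbol.exists_truncKernel_support (hp : IsLocalSymbol U p) (hU : IsOpen U) :
    ∃ δ : ℝ, 0 < δ ∧ ∃ B : Set (Euc d), IsCompact B ∧ B ⊆ U ∧
      ∀ h x y, truncKernel h δ p x y ≠ 0 → x ∈ B ∧ y ∈ B := by
  obtain ⟨K, hK, hKU, hs⟩ := hp.exists_base
  obtain ⟨δ, hδ, hsub⟩ := hK.exists_cthickening_subset_open hU hKU
  refine ⟨δ, hδ, Metric.cthickening δ K, hK.cthickening, hsub, fun h x y hne => ?_⟩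
  have hxy : ‖y - x‖ < δ := by
    by_contra hc
    exact hne (by rw [truncKernel, if_neg hc])
  have hm : (2⁻¹ : ℝ) • (x + y) ∈ K := by
    by_contra hc
    refine hne ?_
    rw [truncKernel, if_pos hxy, scaledKernel, hs _ hc, fourier_zero_fun, mul_zero]
  have key : ∀ u : Euc d, u - (2⁻¹ : ℝ) • (x + y) = (2⁻¹ : ℝ) • ((u - x) + (u - y)) := by
    intro u
    module
  constructor
  · refine Metric.mem_cthickening_of_dist_le x _ δ K hm ?_
    rw [dist_eq_norm, key, sub_self, zero_add, norm_smul, norm_sub_rev]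
    norm_num
    linarith [norm_nonneg (y - x)]
  · refine Metric.mem_cthickening_of_dist_le y _ δ K hm ?_
    rw [dist_eq_norm, key, sub_self, add_zero, norm_smul]
    norm_num
    linarith [norm_nonneg (y - x)]

end ScaledKernels

/-! ### Localized symbols and their kernels -/

/-- A symbol supported over the domain of a chart, with the cutoff used to quantize it there. -/
structure LocalizedSymbol (d : ℕ) (Z : Type*) [TopologicalSpace Z] [ChartedSpace (Euc d) Z]
    [IsManifold 𝓘(ℝ, Euc d) ∞ Z] where
  chart : Chart d Z
  isSmoothChart : IsSmoothChart chart
  χ : Z → ℝ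
  isCutoff : IsCutoff chart χ
  symbol : CotangentBundle d Z → ℂ
  isTestSymbol : IsTestSymbol symbol
  tsupport_subset : tsupport symbol ⊆ {p | p.proj ∈ chart.source}
  χ_eq_one : ∀ p, symbol p ≠ 0 → χ p.proj = 1

namespace LocalizedSymbol

variable {d : ℕ} {Z : Type*} [TopologicalSpace Z] [ChartedSpace (Euc d) Z]
  [IsManifold 𝓘(ℝ, Euc d) ∞ Z] (S : LocalizedSymbol d Z)

/-- The symbol in the canonical coordinates of the chart. -/
def coordSymbol : Euc d → Euc d → ℂ := localSymbol S.chart S.symbol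

theorem isLocalSymbol : IsLocalSymbol S.chart.target S.coordSymbol :=
  isLocalSymbol_localSymbol S.isSmoothChart S.isTestSymbol S.tsupport_subset

/-- A width such that the kernel, cut off at this distance from the diagonal, lives on a compact
subset of the target of the chart. -/
def width : ℝ := (S.isLocalSymbol.exists_truncKernel_support S.chart.open_target).choose

theorem width_pos : 0 < S.width :=
  (S.isLocalSymbol.exists_truncKernel_support S.chart.open_target).choose_spec.1

theorem exists_core : ∃ B : Set (Euc d), IsCompact B ∧ B ⊆ S.chart.target ∧
    ∀ h x y, truncKernel h S.width S.coordSymbol x y ≠ 0 → x ∈ B ∧ y ∈ B :=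
  (S.isLocalSymbol.exists_truncKernel_support S.chart.open_target).choose_spec.2

/-- The Schwartz kernel of the quantization of the symbol in the chart. -/
def kernel (ρ : Chart d Z → Euc d → ℝ) (h : ℝ) : Z → Z → ℂ :=
  pieceKernel ρ S.chart S.χ (scaledKernel h S.coordSymbol)

/-- The part of the Schwartz kernel near the diagonal. -/
def nearKernel (ρ : Chart d Z → Euc d → ℝ) (h : ℝ) : Z → Z → ℂ :=
  pieceKernel ρ S.chart S.χ (truncKernel h S.width S.coordSymbol)

variable {ρ : Chart d Z → Euc d → ℝ}

theorem nearKernel_eq_zero_left {h : ℝ} {z : Z} (hz : z ∉ S.chart.source) (z' : Z) :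
    S.nearKernel ρ h z z' = 0 := by
  simp [nearKernel, pieceKernel, S.isCutoff.pieceWeight_eq_zero hz]

theorem nearKernel_eq_zero_right {h : ℝ} (z : Z) {z' : Z} (hz : z' ∉ S.chart.source) :
    S.nearKernel ρ h z z' = 0 := by
  simp [nearKernel, pieceKernel, S.isCutoff.pieceWeight_eq_zero hz]

variable [MeasurableSpace Z] [BorelSpace Z] {μ : Measure Z}

theorem measurable_kernel (hμ : IsSmoothMeasure μ ρ) (h : ℝ) :
    Measurable (Function.uncurry (S.kernel ρ h)) :=
  measurable_pieceKernel hμ S.isSmoothChart S.isCutoff (S.isLocalSymbol.measurable_scaledKernel h)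

theorem measurable_nearKernel (hμ : IsSmoothMeasure μ ρ) (h : ℝ) :
    Measurable (Function.uncurry (S.nearKernel ρ h)) :=
  measurable_pieceKernel hμ S.isSmoothChart S.isCutoff
    (S.isLocalSymbol.measurable_truncKernel h S.width)

theorem exists_hsNormSq_kernel_le (hμ : IsSmoothMeasure μ ρ) : ∃ C : ℝ, 0 ≤ C ∧ ∀ h, 0 < h →
    hsNormSq μ (S.kernel ρ h) ≤ ENNReal.ofReal ((h ^ d)⁻¹ * C) ∧
    hsNormSq μ (S.nearKernel ρ h) ≤ ENNReal.ofReal ((h ^ d)⁻¹ * C) := by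
  obtain ⟨C, hC, hb⟩ := S.isLocalSymbol.hsNormSq_scaledKernel_le
  refine ⟨C, hC, fun h hh =>
    ⟨(hsNormSq_pieceKernel_le hμ S.isSmoothChart S.isCutoff _).trans (hb h hh),
      (hsNormSq_pieceKernel_le hμ S.isSmoothChart S.isCutoff _).trans (le_trans ?_ (hb h hh))⟩⟩
  refine lintegral_mono fun x => lintegral_mono fun y => ?_
  have h1 := norm_truncKernel_le (h := h) S.width S.coordSymbol x y
  have h2 : ‖truncKernel h S.width S.coordSymbol x y‖ₑ ≤ ‖scaledKernel h S.coordSymbol x y‖ₑ :=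
    enorm_le_iff_norm_le.2 h1
  gcongr

/-- Only the part of the kernel near the diagonal matters in the Hilbert–Schmidt norm. -/
theorem tendsto_hsNormSq_sub (hμ : IsSmoothMeasure μ ρ) :
    Tendsto (fun h => hsNormSq μ (fun z z' => S.kernel ρ h z z' - S.nearKernel ρ h z z'))
      (𝓝[>] 0) (𝓝 0) := by
  refine tendsto_of_tendsto_of_tendsto_of_le_of_le tendsto_const_nhds
    (S.isLocalSymbol.tendsto_hsNormSq_sub_truncKernel S.width_pos)
    (fun _ => zero_le) fun h => ?_
  refine le_trans (le_of_eq ?_) (hsNormSq_pieceKernel_le hμ S.isSmoothChart S.isCutoff _)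
  congr 1
  ext z z'
  simp only [kernel, nearKernel, pieceKernel, mul_sub]

theorem isSchmidtKernel_kernel (hμ : IsSmoothMeasure μ ρ) {h : ℝ} (hh : 0 < h) :
    IsSchmidtKernel μ (S.kernel ρ h) := by
  obtain ⟨C, -, hC⟩ := S.exists_hsNormSq_kernel_le hμ
  exact ⟨S.measurable_kernel hμ h, (hC h hh).1.trans_lt ENNReal.ofReal_lt_top⟩

theorem isSchmidtKernel_nearKernel (hμ : IsSmoothMeasure μ ρ) {h : ℝ} (hh : 0 < h) :
    IsSchmidtKernel μ (S.nearKernel ρ h) := by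
  obtain ⟨C, -, hC⟩ := S.exists_hsNormSq_kernel_le hμ
  exact ⟨S.measurable_nearKernel hμ h, (hC h hh).2.trans_lt ENNReal.ofReal_lt_top⟩

omit [BorelSpace Z] in
/-- The kernel near the diagonal lives on a compact subset of the domain of the chart, and it is of
the size `h^{-d}` on the scale `h`. -/
theorem exists_nearKernel_le (hμ : IsSmoothMeasure μ ρ) : ∃ B : Set (Euc d), IsCompact B ∧
    B ⊆ S.chart.target ∧ ∃ C : ℝ, 0 ≤ C ∧ ∀ h, 0 < h → ∀ z z',
      ‖((h ^ d : ℝ) : ℂ) * S.nearKernel ρ h z z'‖ ≤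
        (S.chart.source ∩ S.chart ⁻¹' B).indicator (fun _ => 1) z *
        (S.chart.source ∩ S.chart ⁻¹' B).indicator (fun _ => 1) z' *
        (C * decay (h⁻¹ • (S.chart z' - S.chart z))) := by
  obtain ⟨B, hB, hBt, hs⟩ := S.exists_core
  obtain ⟨C, hC, hb⟩ := S.isLocalSymbol.exists_pow_fourier_le_decay 0
  have hw : ContinuousOn (fun u => pieceWeight ρ S.chart S.χ (S.chart.symm u)) B :=
    ((continuousOn_pieceWeight hμ S.isSmoothChart S.isCutoff).comp S.chart.continuousOn_symm
      S.chart.mapsTo_symm).mono hBt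
  obtain ⟨M, hM⟩ := hB.exists_bound_of_continuousOn hw
  refine ⟨B, hB, hBt, max M 0 ^ 2 * C, by positivity, fun h hh z z' => ?_⟩
  have hD := decay_pos (h⁻¹ • (S.chart z' - S.chart z))
  by_cases h0 : S.nearKernel ρ h z z' = 0
  · rw [h0, mul_zero, norm_zero]
    refine mul_nonneg (mul_nonneg ?_ ?_) (by positivity) <;>
      exact indicator_nonneg (fun _ _ => zero_le_one) _
  have hz : z ∈ S.chart.source := by
    by_contra hc; exact h0 (S.nearKernel_eq_zero_left hc z')
  have hz' : z' ∈ S.chart.source := by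
    by_contra hc; exact h0 (S.nearKernel_eq_zero_right z hc)
  have ht : truncKernel h S.width S.coordSymbol (S.chart z) (S.chart z') ≠ 0 := by
    intro hc; exact h0 (by simp [nearKernel, pieceKernel, hc])
  obtain ⟨hzB, hzB'⟩ := hs h _ _ ht
  have hzC : z ∈ S.chart.source ∩ S.chart ⁻¹' B := ⟨hz, hzB⟩
  have hzC' : z' ∈ S.chart.source ∩ S.chart ⁻¹' B := ⟨hz', hzB'⟩
  rw [indicator_of_mem hzC, indicator_of_mem hzC', one_mul, one_mul]
  have h1 := hM _ hzB
  have h2 := hM _ hzB'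
  rw [S.chart.left_inv hz] at h1
  rw [S.chart.left_inv hz'] at h2
  have h3 := hb ((2⁻¹ : ℝ) • (S.chart z + S.chart z')) (h⁻¹ • (S.chart z' - S.chart z))
  rw [pow_zero, one_mul] at h3
  have h4 := (norm_truncKernel_le (h := h) S.width S.coordSymbol (S.chart z) (S.chart z')).trans_eq
    (norm_scaledKernel hh _ _ _)
  rw [nearKernel, pieceKernel, norm_mul, norm_mul, Complex.norm_real, Complex.norm_real,
    Real.norm_of_nonneg (by positivity : (0 : ℝ) ≤ h ^ d), norm_mul]
  calc _ ≤ h ^ d * (max M 0 * max M 0 * ((h ^ d)⁻¹ *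
        (C * decay (h⁻¹ • (S.chart z' - S.chart z))))) := by
        gcongr
        · exact h1.trans (le_max_left _ _)
        · exact h2.trans (le_max_left _ _)
        · exact h4.trans (by gcongr)
    _ = _ := by
        have : h ^ d ≠ 0 := by positivity
        field_simp

omit [BorelSpace Z] in
/-- The kernel at two points which approach `x` at a distance of order `h` from each other. -/
theorem tendsto_nearKernel (hμ : IsSmoothMeasure μ ρ) {x : Z} {y z : ℝ → Z} {v : Euc d}
    (hy : Tendsto y (𝓝[>] 0) (𝓝 x)) (hz : Tendsto z (𝓝[>] 0) (𝓝 x))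
    (hv : x ∈ S.chart.source →
      Tendsto (fun h => h⁻¹ • (S.chart (z h) - S.chart (y h))) (𝓝[>] 0) (𝓝 v)) :
    Tendsto (fun h => ((h ^ d : ℝ) : ℂ) * S.nearKernel ρ h (y h) (z h)) (𝓝[>] 0)
      (𝓝 (((pieceWeight ρ S.chart S.χ x ^ 2 : ℝ) : ℂ) * 𝓕 (S.coordSymbol (S.chart x)) v)) := by
  by_cases hx : x ∈ S.chart.source
  · have hpos : ∀ᶠ h : ℝ in 𝓝[>] 0, 0 < h := self_mem_nhdsWithin
    have hw := (continuousOn_pieceWeight hμ S.isSmoothChart S.isCutoff).continuousAt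
      (S.chart.open_source.mem_nhds hx)
    have hwy := hw.tendsto.comp hy
    have hwz := hw.tendsto.comp hz
    have hey := (S.chart.continuousAt hx).tendsto.comp hy
    have hez := (S.chart.continuousAt hx).tendsto.comp hz
    have hmid : Tendsto (fun h => (2⁻¹ : ℝ) • (S.chart (y h) + S.chart (z h))) (𝓝[>] 0)
        (𝓝 (S.chart x)) := by
      have h1 := (hey.add hez).const_smul (2⁻¹ : ℝ)
      rwa [← two_smul ℝ (S.chart x), smul_smul, inv_mul_cancel₀ two_ne_zero, one_smul] at h1
    have hF := (S.isLocalSymbol.continuous_fourier.tendsto (S.chart x, v)).comp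
      (hmid.prodMk_nhds (hv hx))
    have hnear : ∀ᶠ h : ℝ in 𝓝[>] 0, ‖S.chart (z h) - S.chart (y h)‖ < S.width := by
      have h1 := (hez.sub hey).norm
      rw [sub_self, norm_zero] at h1
      exact h1.eventually (gt_mem_nhds S.width_pos)
    have hlim := (Complex.continuous_ofReal.tendsto _).comp (hwy.mul hwz) |>.mul hF
    rw [← sq] at hlim
    refine hlim.congr' ?_
    filter_upwards [hpos, hnear] with h hh hn
    simp only [Function.comp_apply, nearKernel, pieceKernel, truncKernel, if_pos hn, scaledKernel]
    rw [mul_left_comm]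
    congr 1
    rw [← mul_assoc, ← Complex.ofReal_mul, mul_inv_cancel₀ (by positivity), Complex.ofReal_one,
      one_mul]
  · -- the closed support of the cutoff is contained in the domain of the chart
    have h1 : ∀ᶠ z' in 𝓝 x, S.χ z' = 0 := by
      have h2 : (tsupport S.χ)ᶜ ∈ 𝓝 x :=
        (isClosed_tsupport S.χ).isOpen_compl.mem_nhds fun hc => hx (S.isCutoff.support hc)
      filter_upwards [h2] with z' hz'
      exact image_eq_zero_of_notMem_tsupport hz'
    rw [S.isCutoff.pieceWeight_eq_zero hx, zero_pow two_ne_zero, Complex.ofReal_zero, zero_mul]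
    refine tendsto_const_nhds.congr' ?_
    filter_upwards [hy.eventually h1] with h hh
    simp [nearKernel, pieceKernel, pieceWeight, hh]

end LocalizedSymbol

/-! ### Rescaled integration around a point -/

section Rescaling

variable {d : ℕ} {Z : Type*} [TopologicalSpace Z]

/-- The density of `μ` in the coordinates of `e`, extended by zero. -/
def chartDensity (ρ : Chart d Z → Euc d → ℝ) (e : Chart d Z) (u : Euc d) : ℝ :=
  e.target.indicator (ρ e) u

open Classical in
/-- The point with coordinates `u` in the chart `e`, or `z₀` if there is none. -/
def chartPoint (e : Chart d Z) (z₀ : Z) (u : Euc d) : Z :=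
  e.target.piecewise e.symm (fun _ => z₀) u

variable {e : Chart d Z} {ρ : Chart d Z → Euc d → ℝ}

theorem chartPoint_of_mem (z₀ : Z) {u : Euc d} (hu : u ∈ e.target) :
    chartPoint e z₀ u = e.symm u := by
  classical
  exact piecewise_eq_of_mem _ _ _ hu

theorem measurable_chartPoint [MeasurableSpace Z] [BorelSpace Z] (e : Chart d Z) (z₀ : Z) :
    Measurable (chartPoint e z₀) := by
  classical
  exact e.continuousOn_symm.measurable_piecewise continuousOn_const e.open_target.measurableSet

variable [ChartedSpace (Euc d) Z] [MeasurableSpace Z] {μ : Measure Z}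

theorem measurable_chartDensity (hμ : IsSmoothMeasure μ ρ) (he : IsSmoothChart e) :
    Measurable (chartDensity ρ e) := by
  classical
  have h := ((hμ.smooth e he).continuousOn).measurable_piecewise
    (continuousOn_const (c := (0 : ℝ)) (s := e.targetᶜ)) e.open_target.measurableSet
  exact h

theorem tendsto_add_smul (c s : Euc d) :
    Tendsto (fun h : ℝ => c + h • s) (𝓝[>] 0) (𝓝 c) := by
  have hc : Continuous (fun h : ℝ => c + h • s) := by fun_prop
  have := (hc.tendsto 0).mono_left (nhdsWithin_le_nhds (s := Ioi 0))
  simpa using this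

omit [ChartedSpace (Euc d) Z] [MeasurableSpace Z] in
theorem eventually_mem_target {x : Z} (hx : x ∈ e.source) (s : Euc d) :
    ∀ᶠ h : ℝ in 𝓝[>] 0, e x + h • s ∈ e.target :=
  (tendsto_add_smul (e x) s).eventually (e.open_target.mem_nhds (e.map_source hx))

theorem tendsto_chartDensity (hμ : IsSmoothMeasure μ ρ) (he : IsSmoothChart e) {x : Z}
    (hx : x ∈ e.source) (s : Euc d) :
    Tendsto (fun h : ℝ => chartDensity ρ e (e x + h • s)) (𝓝[>] 0) (𝓝 (ρ e (e x))) := by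
  have h1 := ((hμ.smooth e he).continuousOn.continuousAt
    (e.open_target.mem_nhds (e.map_source hx))).tendsto.comp (tendsto_add_smul (e x) s)
  refine h1.congr' ?_
  filter_upwards [eventually_mem_target hx s] with h hh
  rw [chartDensity, indicator_of_mem hh]
  rfl

omit [ChartedSpace (Euc d) Z] [MeasurableSpace Z] in
theorem tendsto_chartPoint {x : Z} (hx : x ∈ e.source) (z₀ : Z) (s : Euc d) :
    Tendsto (fun h : ℝ => chartPoint e z₀ (e x + h • s)) (𝓝[>] 0) (𝓝 x) := by
  have h1 := (e.continuousAt_symm (e.map_source hx)).tendsto.comp (tendsto_add_smul (e x) s)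
  rw [e.left_inv hx] at h1
  refine h1.congr' ?_
  filter_upwards [eventually_mem_target hx s] with h hh
  rw [chartPoint_of_mem z₀ hh]
  rfl

omit [MeasurableSpace Z] in
/-- The difference quotient of a change of charts along the ray in the direction `s`. -/
theorem tendsto_chart_chartPoint {e' : Chart d Z} (he : IsSmoothChart e) (he' : IsSmoothChart e')
    {x : Z} (hx : x ∈ e.source) (hx' : x ∈ e'.source) (z₀ : Z) (s : Euc d) :
    Tendsto (fun h : ℝ => h⁻¹ • (e' (chartPoint e z₀ (e x + h • s)) - e' x)) (𝓝[>] 0)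
      (𝓝 (fderiv ℝ (e' ∘ e.symm) (e x) s)) := by
  have h1 := ((hasFDerivAt_transition he he' (e.map_source hx)
    (by rwa [e.left_inv hx])).hasLineDerivAt s).tendsto_slope_zero_right
  refine h1.congr' ?_
  filter_upwards [eventually_mem_target hx s] with h hh
  rw [chartPoint_of_mem z₀ hh, Function.comp_apply, Function.comp_apply, e.left_inv hx]

variable [BorelSpace Z]

/-- Integration in the coordinates of a chart, centred at `c` and on the scale `h`. -/
theorem integral_eq_rescaled (hμ : IsSmoothMeasure μ ρ) (he : IsSmoothChart e) {G : Z → ℂ}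
    (hG : Measurable G) (hG0 : ∀ z, z ∉ e.source → G z = 0) (z₀ : Z) (c : Euc d) {h : ℝ}
    (hh : 0 < h) :
    ∫ z, G z ∂μ = ((h ^ d : ℝ) : ℂ) * ∫ s, (chartDensity ρ e (c + h • s) : ℂ) *
      G (chartPoint e z₀ (c + h • s)) := by
  set F : Euc d → ℂ := fun u => (chartDensity ρ e u : ℂ) * G (chartPoint e z₀ u) with hF
  have h1 : ∫ z, G z ∂μ = ∫ u, F u := by
    rw [← setIntegral_eq_integral_of_forall_compl_eq_zero hG0,
      hμ.integral_source_eq he hG.aestronglyMeasurable,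
      ← integral_indicator e.open_target.measurableSet]
    refine integral_congr_ae (ae_of_all _ fun u => ?_)
    by_cases hu : u ∈ e.target
    · simp only [hF, chartDensity, indicator_of_mem hu, chartPoint_of_mem z₀ hu]
    · simp [hF, chartDensity, indicator_of_notMem hu]
  have h2 : ∫ s, F (c + h • s) = ((h ^ d)⁻¹ : ℝ) • ∫ u, F u := by
    rw [Measure.integral_comp_smul volume (fun v => F (c + v)) h, integral_add_left_eq_self,
      finrank_euclideanSpace_fin, abs_of_pos (by positivity)]
  rw [h1, h2, Complex.real_smul, ← mul_assoc, ← Complex.ofReal_mul,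
    mul_inv_cancel₀ (by positivity), Complex.ofReal_one, one_mul]

end Rescaling

/-! ### The rescaled trace integrand -/

section Slices

variable {d : ℕ} {Z : Type*} [TopologicalSpace Z] [ChartedSpace (Euc d) Z]
  [IsManifold 𝓘(ℝ, Euc d) ∞ Z] {ρ : Chart d Z → Euc d → ℝ}

/-- The kernel near the diagonal as a function of the second point, in coordinates centred at the
first one and on the scale `h`, with the Jacobian factor of the change of variables. -/
def LocalizedSymbol.raySlice (S : LocalizedSymbol d Z) (ρ : Chart d Z → Euc d → ℝ) (h : ℝ) (x : Z)
    (s : Euc d) : ℂ :=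
  (chartDensity ρ S.chart (S.chart x + h • s) : ℂ) *
    (((h ^ d : ℝ) : ℂ) * S.nearKernel ρ h x (chartPoint S.chart x (S.chart x + h • s)))

/-- The integrand of the trace for three localized symbols at `(x, y, z)`, with `y` and `z` in the
coordinates of the first and of the third chart, centred at `x` and on the scale `h`. -/
def sliceIntegrand (S₁ S₂ S₃ : LocalizedSymbol d Z) (ρ : Chart d Z → Euc d → ℝ) (h : ℝ) (x : Z)
    (s r : Euc d) : ℂ :=
  S₁.raySlice ρ h x s * (((h ^ d : ℝ) : ℂ) *
    S₂.nearKernel ρ h (chartPoint S₁.chart x (S₁.chart x + h • s))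
      (chartPoint S₃.chart x (S₃.chart x + h • r))) *
    (starRingEnd ℂ) (S₃.raySlice ρ h x r)

/-- The limit of the rescaled trace integrand as `h → 0`. If `x` lies outside of one of the three
charts then a weight `pieceWeight` vanishes. -/
def limitIntegrand (S₁ S₂ S₃ : LocalizedSymbol d Z) (ρ : Chart d Z → Euc d → ℝ) (x : Z)
    (s r : Euc d) : ℂ :=
  ((ρ S₁.chart (S₁.chart x) : ℂ) * (((pieceWeight ρ S₁.chart S₁.χ x ^ 2 : ℝ) : ℂ) *
      𝓕 (S₁.coordSymbol (S₁.chart x)) s)) *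
    (((pieceWeight ρ S₂.chart S₂.χ x ^ 2 : ℝ) : ℂ) * 𝓕 (S₂.coordSymbol (S₂.chart x))
      (fderiv ℝ (S₂.chart ∘ S₃.chart.symm) (S₃.chart x) r -
        fderiv ℝ (S₂.chart ∘ S₁.chart.symm) (S₁.chart x) s)) *
    (starRingEnd ℂ) ((ρ S₃.chart (S₃.chart x) : ℂ) *
      (((pieceWeight ρ S₃.chart S₃.χ x ^ 2 : ℝ) : ℂ) * 𝓕 (S₃.coordSymbol (S₃.chart x)) r))

variable [MeasurableSpace Z] {μ : Measure Z}

theorem LocalizedSymbol.tendsto_raySlice (S : LocalizedSymbol d Z) (hμ : IsSmoothMeasure μ ρ)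
    (x : Z) (s : Euc d) :
    Tendsto (fun h => S.raySlice ρ h x s) (𝓝[>] 0)
      (𝓝 ((ρ S.chart (S.chart x) : ℂ) * (((pieceWeight ρ S.chart S.χ x ^ 2 : ℝ) : ℂ) *
      𝓕 (S.coordSymbol (S.chart x)) s))) := by
  by_cases hx : x ∈ S.chart.source
  · refine ((Complex.continuous_ofReal.tendsto _).comp
      (tendsto_chartDensity hμ S.isSmoothChart hx s)).mul
      (S.tendsto_nearKernel hμ tendsto_const_nhds (tendsto_chartPoint hx x s) fun _ => ?_)
    refine tendsto_const_nhds.congr' ?_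
    filter_upwards [eventually_mem_target hx s, self_mem_nhdsWithin] with h hh hpos
    rw [chartPoint_of_mem x hh, S.chart.right_inv hh, add_sub_cancel_left, smul_smul,
      inv_mul_cancel₀ (ne_of_gt hpos), one_smul]
  · simp only [raySlice, S.nearKernel_eq_zero_left hx, S.isCutoff.pieceWeight_eq_zero hx]
    simp

theorem tendsto_sliceIntegrand (S₁ S₂ S₃ : LocalizedSymbol d Z) (hμ : IsSmoothMeasure μ ρ) (x : Z)
    (s r : Euc d) :
    Tendsto (fun h => sliceIntegrand S₁ S₂ S₃ ρ h x s r) (𝓝[>] 0)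
      (𝓝 (limitIntegrand S₁ S₂ S₃ ρ x s r)) := by
  have h1 := S₁.tendsto_raySlice hμ x s
  have h3 := S₃.tendsto_raySlice hμ x r
  by_cases hx : x ∈ S₁.chart.source ∧ x ∈ S₃.chart.source
  · refine (h1.mul (S₂.tendsto_nearKernel hμ (tendsto_chartPoint hx.1 x s)
      (tendsto_chartPoint hx.2 x r) fun hx2 => ?_)).mul
      ((Complex.continuous_conj.tendsto _).comp h3)
    have h4 := (tendsto_chart_chartPoint S₃.isSmoothChart S₂.isSmoothChart hx.2 hx2 x r).sub
      (tendsto_chart_chartPoint S₁.isSmoothChart S₂.isSmoothChart hx.1 hx2 x s)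
    refine h4.congr fun h => ?_
    rw [← smul_sub, sub_sub_sub_cancel_right]
  · rw [not_and_or] at hx
    rcases hx with hx | hx
    · simp only [sliceIntegrand, limitIntegrand, LocalizedSymbol.raySlice,
        S₁.nearKernel_eq_zero_left hx, S₁.isCutoff.pieceWeight_eq_zero hx]
      simp
    · simp only [sliceIntegrand, limitIntegrand, LocalizedSymbol.raySlice,
        S₃.nearKernel_eq_zero_left hx, S₃.isCutoff.pieceWeight_eq_zero hx]
      simp

variable [BorelSpace Z]

theorem LocalizedSymbol.measurable_raySlice (S : LocalizedSymbol d Z) (hμ : IsSmoothMeasure μ ρ)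
    (h : ℝ) (x : Z) : Measurable (S.raySlice ρ h x) := by
  have h1 : Measurable (fun s : Euc d => S.chart x + h • s) := by fun_prop
  refine (Complex.measurable_ofReal.comp
    ((measurable_chartDensity hμ S.isSmoothChart).comp h1)).mul (measurable_const.mul ?_)
  exact (S.measurable_nearKernel hμ h).comp
    (measurable_const.prodMk ((measurable_chartPoint S.chart x).comp h1))

theorem measurable_sliceIntegrand (S₁ S₂ S₃ : LocalizedSymbol d Z) (hμ : IsSmoothMeasure μ ρ)
    (h : ℝ) (x : Z) : Measurable (Function.uncurry (sliceIntegrand S₁ S₂ S₃ ρ h x)) := by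
  have h1 : ∀ c : Euc d, Measurable (fun s : Euc d => c + h • s) := fun c => by fun_prop
  refine (((S₁.measurable_raySlice hμ h x).comp measurable_fst).mul (measurable_const.mul ?_)).mul
    (Complex.continuous_conj.measurable.comp ((S₃.measurable_raySlice hμ h x).comp measurable_snd))
  exact (S₂.measurable_nearKernel hμ h).comp
    (((measurable_chartPoint S₁.chart x).comp ((h1 _).comp measurable_fst)).prodMk
      ((measurable_chartPoint S₃.chart x).comp ((h1 _).comp measurable_snd)))

/-- The bound which dominates the rescaled kernel uniformly in `h`. -/
theorem LocalizedSymbol.exists_raySlice_le [T2Space Z] (S : LocalizedSymbol d Z)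
    (hμ : IsSmoothMeasure μ ρ) :
    ∃ A : Set Z, MeasurableSet A ∧ μ A < ⊤ ∧ ∃ C : ℝ, 0 ≤ C ∧ ∀ h, 0 < h → ∀ x s,
      ‖S.raySlice ρ h x s‖ ≤ A.indicator (fun _ => 1) x * (C * decay s) := by
  obtain ⟨B, hB, hBt, C, hC, hb⟩ := S.exists_nearKernel_le hμ
  obtain ⟨R, hR⟩ := hB.exists_bound_of_continuousOn
    ((hμ.smooth S.chart S.isSmoothChart).continuousOn.mono hBt)
  have := hμ.isLocallyFiniteMeasure
  have hA : S.chart.source ∩ S.chart ⁻¹' B = S.chart.symm '' B := by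
    rw [S.chart.symm_image_eq_source_inter_preimage hBt]
  have hAc : IsCompact (S.chart.source ∩ S.chart ⁻¹' B) := by
    rw [hA]
    exact hB.image_of_continuousOn (S.chart.continuousOn_symm.mono hBt)
  refine ⟨_, hAc.isClosed.measurableSet, hAc.measure_lt_top, max R 0 * C, by positivity,
    fun h hh x s => ?_⟩
  set u := S.chart x + h • s with hu
  have h1 := hb h hh x (chartPoint S.chart x u)
  rw [LocalizedSymbol.raySlice, norm_mul, Complex.norm_real]
  have hD := decay_pos s
  have hI : ∀ z, 0 ≤ (S.chart.source ∩ S.chart ⁻¹' B).indicator (fun _ => (1 : ℝ)) z :=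
    fun z => indicator_nonneg (fun _ _ => zero_le_one) z
  by_cases hut : u ∈ S.chart.target
  · rw [chartPoint_of_mem x hut] at h1 ⊢
    have h2 : h⁻¹ • (S.chart (S.chart.symm u) - S.chart x) = s := by
      rw [S.chart.right_inv hut, hu, add_sub_cancel_left, smul_smul, inv_mul_cancel₀ hh.ne',
        one_smul]
    rw [h2] at h1
    by_cases huB : u ∈ B
    · have h3 : ‖chartDensity ρ S.chart u‖ ≤ max R 0 := by
        rw [chartDensity, indicator_of_mem hut]
        exact (hR u huB).trans (le_max_left _ _)
      have h4 : (S.chart.source ∩ S.chart ⁻¹' B).indicator (fun _ => (1 : ℝ)) 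
          (S.chart.symm u) ≤ 1 :=
        indicator_le_self' (fun _ _ => zero_le_one) _
      calc _ ≤ max R 0 * ((S.chart.source ∩ S.chart ⁻¹' B).indicator (fun _ => 1) x * 1 *
            (C * decay s)) := by
            refine mul_le_mul h3 (h1.trans ?_) (norm_nonneg _) (le_max_right _ _)
            have := hI x
            gcongr
        _ = _ := by ring
    · have h3 : S.chart.symm u ∉ S.chart.source ∩ S.chart ⁻¹' B := by
        intro hc
        have h4 : S.chart (S.chart.symm u) ∈ B := hc.2
        rw [S.chart.right_inv hut] at h4
        exact huB h4
      rw [indicator_of_notMem h3, mul_zero, zero_mul] at h1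
      rw [le_antisymm h1 (norm_nonneg _), mul_zero]
      exact mul_nonneg (hI x) (by positivity)
  · rw [chartDensity, indicator_of_notMem hut, norm_zero, zero_mul]
    exact mul_nonneg (hI x) (by positivity)

theorem exists_sliceIntegrand_le [T2Space Z] (S₁ S₂ S₃ : LocalizedSymbol d Z)
    (hμ : IsSmoothMeasure μ ρ) :
    ∃ A : Set Z, MeasurableSet A ∧ μ A < ⊤ ∧ ∃ C : ℝ, 0 ≤ C ∧ ∀ h, 0 < h → ∀ x s r,
      ‖sliceIntegrand S₁ S₂ S₃ ρ h x s r‖ ≤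
        A.indicator (fun _ => C) x * (decay s * decay r) := by
  obtain ⟨A, hAm, hA, C₁, hC₁, h₁⟩ := S₁.exists_raySlice_le hμ
  obtain ⟨B, -, -, C₂, hC₂, h₂⟩ := S₂.exists_nearKernel_le hμ
  obtain ⟨A', -, -, C₃, hC₃, h₃⟩ := S₃.exists_raySlice_le hμ
  refine ⟨A, hAm, hA, C₁ * C₂ * C₃, by positivity, fun h hh x s r => ?_⟩
  rw [sliceIntegrand, norm_mul, norm_mul, RCLike.norm_conj]
  have hD := decay_pos s
  have hD' := decay_pos r
  have k1 := h₁ h hh x s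
  have k3 : ‖S₃.raySlice ρ h x r‖ ≤ C₃ * decay r := by
    refine (h₃ h hh x r).trans (mul_le_of_le_one_left (by positivity) ?_)
    exact indicator_le_self' (fun _ _ => zero_le_one) _
  have k2 := h₂ h hh (chartPoint S₁.chart x (S₁.chart x + h • s))
    (chartPoint S₃.chart x (S₃.chart x + h • r))
  have k2' := k2.trans (mul_le_mul (mul_le_one₀
    (indicator_le_self' (fun _ _ => zero_le_one) _) (indicator_nonneg (fun _ _ => zero_le_one) _)
    (indicator_le_self' (fun _ _ => zero_le_one) _))
    (mul_le_mul_of_nonneg_left (decay_le_one _) hC₂) (mul_nonneg hC₂ (decay_pos _).le) zero_le_one)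
  rw [one_mul, mul_one] at k2'
  calc _ ≤ A.indicator (fun _ => 1) x * (C₁ * decay s) * C₂ * (C₃ * decay r) := by
        have hI : 0 ≤ A.indicator (fun _ => (1 : ℝ)) x :=
          indicator_nonneg (fun _ _ => zero_le_one) x
        gcongr
    _ = _ := by
        by_cases hx : x ∈ A
        · simp only [indicator_of_mem hx]; ring
        · simp only [indicator_of_notMem hx]; ring

end Slices

/-! ### Products of three localized symbols -/

section TripleSymbol

variable {d : ℕ} {Z : Type*} [TopologicalSpace Z] [ChartedSpace (Euc d) Z]
  [IsManifold 𝓘(ℝ, Euc d) ∞ Z] (S₁ S₂ S₃ : LocalizedSymbol d Z)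

theorem LocalizedSymbol.χ_eq_one_of_coordSymbol_ne_zero (S : LocalizedSymbol d Z) {x ξ : Euc d}
    (hne : S.coordSymbol x ξ ≠ 0) : S.χ (S.chart.symm x) = 1 := by
  rw [LocalizedSymbol.coordSymbol, localSymbol] at hne
  by_cases hx : x ∈ S.chart.target
  · rw [indicator_of_mem hx] at hne
    exact S.χ_eq_one _ hne
  · exact absurd (indicator_of_notMem hx _) hne

/-- The coordinate expressions of a symbol in two charts differ by the adjoint of the derivative of
the change of charts in the fibre variable. -/
theorem LocalizedSymbol.symbol_canonicalCoord_eq (S : LocalizedSymbol d Z) {e : Chart d Z}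
    (he : IsSmoothChart e) {x : Z} (hx : x ∈ S.chart.source) (hxe : x ∈ e.source) (η : Euc d) :
    S.coordSymbol (S.chart x) (ContinuousLinearMap.adjoint
      (fderiv ℝ (e ∘ S.chart.symm) (S.chart x)) η) = S.symbol (canonicalCoord e (e x, η)) := by
  have h := canonicalCoord_transition S.isSmoothChart he (S.chart.map_source hx)
    (by rwa [S.chart.left_inv hx]) η
  rw [S.chart.left_inv hx] at h
  rw [h, LocalizedSymbol.coordSymbol, localSymbol, indicator_of_mem (S.chart.map_source hx)]

/-- The product of the first two symbols and the conjugate of the third. -/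
def tripleSymbol (p : CotangentBundle d Z) : ℂ :=
  S₁.symbol p * S₂.symbol p * (starRingEnd ℂ) (S₃.symbol p)

theorem isTestSymbol_tripleSymbol : IsTestSymbol (tripleSymbol S₁ S₂ S₃) :=
  (S₁.isTestSymbol.mul S₂.isTestSymbol).mul S₃.isTestSymbol.conj

theorem tsupport_tripleSymbol_subset :
    tsupport (tripleSymbol S₁ S₂ S₃) ⊆ {p | p.proj ∈ S₂.chart.source} := by
  refine (closure_mono fun p hp => ?_).trans S₂.tsupport_subset
  intro h0
  exact hp (by simp [tripleSymbol, h0])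

theorem LocalizedSymbol.symbol_eq_zero (S : LocalizedSymbol d Z) {p : CotangentBundle d Z}
    (hp : p.proj ∉ S.chart.source) : S.symbol p = 0 := by
  by_contra h
  exact hp (S.tsupport_subset (subset_tsupport _ h))

end TripleSymbol

/-! ### The limit of the trace near the diagonal -/

section Trilinear

variable {d : ℕ} {Z : Type*} [TopologicalSpace Z] [ChartedSpace (Euc d) Z]
  [IsManifold 𝓘(ℝ, Euc d) ∞ Z] {ρ : Chart d Z → Euc d → ℝ} [MeasurableSpace Z] [BorelSpace Z]
  {μ : Measure Z} (S₁ S₂ S₃ : LocalizedSymbol d Z)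

/-- The two inner integrations of the trace, with both variables rescaled. Each of the changes of
variables contributes a factor `h^d`, which the kernels absorb. -/
theorem mul_integral_traceIntegrand_slice [SFinite μ] (hμ : IsSmoothMeasure μ ρ) {h : ℝ}
    (hh : 0 < h) (x : Z) (hint : Integrable (fun q => traceIntegrand (S₁.nearKernel ρ h)
      (S₂.nearKernel ρ h) (S₃.nearKernel ρ h) (x, q)) (μ.prod μ)) :
    ((h ^ d : ℝ) : ℂ) * ∫ q, traceIntegrand (S₁.nearKernel ρ h)
      (S₂.nearKernel ρ h) (S₃.nearKernel ρ h) (x, q) ∂(μ.prod μ) =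
      ∫ s, ∫ r, sliceIntegrand S₁ S₂ S₃ ρ h x s r := by
  have hm : Measurable (fun q : Z × Z => traceIntegrand (S₁.nearKernel ρ h)
      (S₂.nearKernel ρ h) (S₃.nearKernel ρ h) (x, q)) :=
    (measurable_traceIntegrand (S₁.measurable_nearKernel hμ h) (S₂.measurable_nearKernel hμ h)
      (S₃.measurable_nearKernel hμ h)).comp measurable_prodMk_left
  rw [integral_prod _ hint]
  have h1 : ∀ y, ∫ z, traceIntegrand (S₁.nearKernel ρ h)
      (S₂.nearKernel ρ h) (S₃.nearKernel ρ h) (x, (y, z)) ∂μ = _ := fun y =>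
    integral_eq_rescaled hμ S₃.isSmoothChart (G := fun z => traceIntegrand (S₁.nearKernel ρ h)
      (S₂.nearKernel ρ h) (S₃.nearKernel ρ h) (x, (y, z))) (hm.comp measurable_prodMk_left)
      (fun z hz => by simp [traceIntegrand, S₃.nearKernel_eq_zero_right x hz])
      x (S₃.chart x) hh
  have h2 : Measurable (fun y => ∫ z, traceIntegrand (S₁.nearKernel ρ h)
      (S₂.nearKernel ρ h) (S₃.nearKernel ρ h) (x, (y, z)) ∂μ) :=
    (hm.stronglyMeasurable.integral_prod_right').measurable
  rw [integral_eq_rescaled hμ S₁.isSmoothChart h2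
    (fun y hy => by simp [traceIntegrand, S₁.nearKernel_eq_zero_right x hy]) x (S₁.chart x) hh]
  simp_rw [h1]
  rw [← integral_const_mul, ← integral_const_mul]
  refine integral_congr_ae (ae_of_all _ fun s => ?_)
  simp only
  rw [← integral_const_mul, ← integral_const_mul, ← integral_const_mul, ← integral_const_mul]
  refine integral_congr_ae (ae_of_all _ fun r => ?_)
  simp only [traceIntegrand, sliceIntegrand, LocalizedSymbol.raySlice, map_mul, Complex.conj_ofReal]
  ring

theorem tendsto_integral_sliceIntegrand [T2Space Z] (hμ : IsSmoothMeasure μ ρ) (x : Z) :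
    Tendsto (fun h => ∫ s, ∫ r, sliceIntegrand S₁ S₂ S₃ ρ h x s r) (𝓝[>] 0)
      (𝓝 (∫ s, ∫ r, limitIntegrand S₁ S₂ S₃ ρ x s r)) := by
  obtain ⟨A, -, -, C, hC, hb⟩ := exists_sliceIntegrand_le S₁ S₂ S₃ hμ
  have hb' : ∀ h, 0 < h → ∀ s r, ‖sliceIntegrand S₁ S₂ S₃ ρ h x s r‖ ≤ C * decay s * decay r := by
    intro h hh s r
    refine (hb h hh x s r).trans ?_
    rw [mul_assoc]
    refine mul_le_mul_of_nonneg_right (indicator_le_self' (fun _ _ => hC) x) ?_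
    exact mul_nonneg (decay_pos _).le (decay_pos _).le
  have hpos : ∀ᶠ h : ℝ in 𝓝[>] 0, 0 < h := self_mem_nhdsWithin
  have hm := fun h => measurable_sliceIntegrand S₁ S₂ S₃ hμ h x
  refine tendsto_integral_filter_of_dominated_convergence
    (fun s => C * decay s * ∫ r : Euc d, decay r) ?_ ?_ ?_ ?_
  · exact Eventually.of_forall fun h =>
      ((hm h).stronglyMeasurable.integral_prod_right).aestronglyMeasurable
  · filter_upwards [hpos] with h hh
    refine ae_of_all _ fun s => ?_
    rw [← integral_const_mul]
    exact norm_integral_le_of_norm_le (integrable_decay.const_mul _) (ae_of_all _ (hb' h hh s))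
  · exact (integrable_decay.const_mul C).mul_const _
  · refine ae_of_all _ fun s => ?_
    refine tendsto_integral_filter_of_dominated_convergence (fun r => C * decay s * decay r) ?_ ?_
      (integrable_decay.const_mul _) (ae_of_all _ fun r => tendsto_sliceIntegrand S₁ S₂ S₃ hμ x s r)
    · exact Eventually.of_forall fun h => ((hm h).of_uncurry_left).aestronglyMeasurable
    · filter_upwards [hpos] with h hh
      exact ae_of_all _ (hb' h hh s)

theorem tendsto_integral_traceIntegrand_nearKernel [T2Space Z] [SFinite μ]
    (hμ : IsSmoothMeasure μ ρ) :
    Tendsto (fun h => ((h ^ d : ℝ) : ℂ) * ∫ p, traceIntegrand (S₁.nearKernel ρ h)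
        (S₂.nearKernel ρ h) (S₃.nearKernel ρ h) p ∂(μ.prod (μ.prod μ))) (𝓝[>] 0)
      (𝓝 (∫ x, ∫ s, ∫ r, limitIntegrand S₁ S₂ S₃ ρ x s r ∂volume ∂volume ∂μ)) := by
  have hpos : ∀ᶠ h : ℝ in 𝓝[>] 0, 0 < h := self_mem_nhdsWithin
  have hint : ∀ h, 0 < h → Integrable (traceIntegrand (S₁.nearKernel ρ h)
        (S₂.nearKernel ρ h) (S₃.nearKernel ρ h)) (μ.prod (μ.prod μ)) := fun h hh =>
    integrable_traceIntegrand (S₁.isSchmidtKernel_nearKernel hμ hh)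
      (S₂.isSchmidtKernel_nearKernel hμ hh) (S₃.isSchmidtKernel_nearKernel hμ hh)
  -- for each `h` Fubini's theorem holds at almost every `x`, while the rescaled double integral is
  -- defined, and converges, at every `x`
  have hae : ∀ h, 0 < h → (fun x => ((h ^ d : ℝ) : ℂ) * ∫ q, traceIntegrand (S₁.nearKernel ρ h)
      (S₂.nearKernel ρ h) (S₃.nearKernel ρ h) (x, q) ∂(μ.prod μ)) =ᵐ[μ]
      fun x => ∫ s, ∫ r, sliceIntegrand S₁ S₂ S₃ ρ h x s r := by
    intro h hh
    filter_upwards [(hint h hh).prod_right_ae] with x hx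
    exact mul_integral_traceIntegrand_slice S₁ S₂ S₃ hμ hh x hx
  have heq : ∀ h, 0 < h → ((h ^ d : ℝ) : ℂ) * ∫ p, traceIntegrand (S₁.nearKernel ρ h)
        (S₂.nearKernel ρ h) (S₃.nearKernel ρ h) p ∂(μ.prod (μ.prod μ)) =
      ∫ x, ∫ s, ∫ r, sliceIntegrand S₁ S₂ S₃ ρ h x s r ∂volume ∂volume ∂μ := by
    intro h hh
    rw [integral_prod _ (hint h hh), ← integral_const_mul]
    exact integral_congr_ae (hae h hh)
  obtain ⟨A, hAm, hA, C, hC, hb⟩ := exists_sliceIntegrand_le S₁ S₂ S₃ hμ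
  have hD : 0 ≤ ∫ r : Euc d, decay r := integral_nonneg fun r => (decay_pos r).le
  refine Tendsto.congr' (f₁ := fun h => ∫ x, ∫ s, ∫ r, sliceIntegrand S₁ S₂ S₃ ρ h x s r
      ∂volume ∂volume ∂μ) ?_ ?_
  · filter_upwards [hpos] with h hh using (heq h hh).symm
  refine tendsto_integral_filter_of_dominated_convergence
    (fun x => A.indicator (fun _ => C) x * ((∫ s : Euc d, decay s) * ∫ r : Euc d, decay r)) ?_ ?_ ?_
    (ae_of_all _ fun x => tendsto_integral_sliceIntegrand S₁ S₂ S₃ hμ x)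
  · filter_upwards [hpos] with h hh
    exact (((hint h hh).integral_prod_left).aestronglyMeasurable.const_mul _).congr (hae h hh)
  · filter_upwards [hpos] with h hh
    refine ae_of_all _ fun x => ?_
    have hsplit : A.indicator (fun _ => C) x * ((∫ s : Euc d, decay s) * ∫ r : Euc d, decay r) =
        ∫ s : Euc d, A.indicator (fun _ => C) x * decay s * ∫ r : Euc d, decay r := by
      rw [integral_mul_const, integral_const_mul, mul_assoc]
    rw [hsplit]
    refine norm_integral_le_of_norm_le ((integrable_decay.const_mul _).mul_const _)
      (ae_of_all _ fun s => ?_)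
    rw [← integral_const_mul]
    refine norm_integral_le_of_norm_le (integrable_decay.const_mul _) (ae_of_all _ fun r => ?_)
    rw [mul_assoc]
    exact hb h hh x s r
  · exact ((integrable_indicator_iff hAm).2 (integrableOn_const hA.ne)).mul_const _

/-! ### The value of the limit -/

omit [BorelSpace Z] in
/-- Away from the set where the cutoff is one, the symbol vanishes on the whole fibre; so the cutoff
leaves no trace in the limit. -/
theorem LocalizedSymbol.pieceWeight_sq_mul_fourier (S : LocalizedSymbol d Z)
    (hμ : IsSmoothMeasure μ ρ) {x : Z} (hx : x ∈ S.chart.source) (s : Euc d) :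
    ((pieceWeight ρ S.chart S.χ x ^ 2 : ℝ) : ℂ) * 𝓕 (S.coordSymbol (S.chart x)) s =
      (((ρ S.chart (S.chart x))⁻¹ : ℝ) : ℂ) * 𝓕 (S.coordSymbol (S.chart x)) s := by
  by_cases h0 : S.coordSymbol (S.chart x) = 0
  · rw [h0, fourier_zero_fun, mul_zero, mul_zero]
  · obtain ⟨ξ, hξ⟩ := Function.ne_iff.1 h0
    have h1 := S.χ_eq_one_of_coordSymbol_ne_zero hξ
    rw [S.chart.left_inv hx] at h1
    rw [pieceWeight, h1, one_mul, inv_pow,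
      Real.sq_sqrt (hμ.pos _ S.isSmoothChart _ (S.chart.map_source hx)).le]

theorem contDiff_and_hasCompactSupport_of_comp_adjoint {L : Euc d →L[ℝ] Euc d} (hL : L.det ≠ 0)
    {f g : Euc d → ℂ} (hf : ContDiff ℝ ∞ f) (hf' : HasCompactSupport f)
    (hfg : ∀ η, f (ContinuousLinearMap.adjoint L η) = g η) :
    ContDiff ℝ ∞ g ∧ HasCompactSupport g := by
  have hg : g = f ∘ ContinuousLinearMap.adjoint L := funext fun η => (hfg η).symm
  have hL' : (ContinuousLinearMap.adjoint L : Euc d →L[ℝ] Euc d).det ≠ 0 := by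
    rwa [det_adjoint]
  have hinj : Function.Injective (ContinuousLinearMap.adjoint L) :=
    (LinearMap.equivOfDetNeZero (ContinuousLinearMap.adjoint L : Euc d →ₗ[ℝ] Euc d) hL').injective
  rw [hg]
  exact ⟨hf.comp (ContinuousLinearMap.adjoint L).contDiff,
    hf'.comp_isClosedEmbedding (LinearMap.isClosedEmbedding_of_injective
      (f := (ContinuousLinearMap.adjoint L : Euc d →ₗ[ℝ] Euc d)) (LinearMap.ker_eq_bot.2 hinj))⟩

omit [BorelSpace Z] in
/-- The limit at a point `x` of the second chart is an integral over the fibre at `x`, in the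
canonical coordinates of this chart. -/
theorem integral_limitIntegrand (hμ : IsSmoothMeasure μ ρ) {x : Z} (hx : x ∈ S₂.chart.source) :
    ∫ s, ∫ r, limitIntegrand S₁ S₂ S₃ ρ x s r =
      (((ρ S₂.chart (S₂.chart x))⁻¹ : ℝ) : ℂ) *
        ∫ ξ, localSymbol S₂.chart (tripleSymbol S₁ S₂ S₃) (S₂.chart x) ξ := by
  have hxt := S₂.chart.map_source hx
  have hloc : ∀ b : CotangentBundle d Z → ℂ, ∀ ξ, localSymbol S₂.chart b (S₂.chart x) ξ =
      b (canonicalCoord S₂.chart (S₂.chart x, ξ)) := by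
    intro b ξ
    rw [localSymbol, indicator_of_mem hxt]
  have hproj : ∀ ξ : Euc d,
      (canonicalCoord S₂.chart (S₂.chart x, ξ) : CotangentBundle d Z).proj = x :=
    fun ξ => S₂.chart.left_inv hx
  simp_rw [hloc]
  by_cases hx1 : x ∈ S₁.chart.source
  swap
  · simp only [limitIntegrand, S₁.isCutoff.pieceWeight_eq_zero hx1, tripleSymbol]
    have h0 : ∀ ξ : Euc d, S₁.symbol (canonicalCoord S₂.chart (S₂.chart x, ξ)) = 0 := fun ξ =>
      S₁.symbol_eq_zero (by rw [hproj]; exact hx1)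
    simp [h0]
  by_cases hx3 : x ∈ S₃.chart.source
  swap
  · simp only [limitIntegrand, S₃.isCutoff.pieceWeight_eq_zero hx3, tripleSymbol]
    have h0 : ∀ ξ : Euc d, S₃.symbol (canonicalCoord S₂.chart (S₂.chart x, ξ)) = 0 := fun ξ =>
      S₃.symbol_eq_zero (by rw [hproj]; exact hx3)
    simp [h0]
  set L := fderiv ℝ (S₂.chart ∘ S₁.chart.symm) (S₁.chart x) with hLdef
  set M := fderiv ℝ (S₂.chart ∘ S₃.chart.symm) (S₃.chart x) with hMdef
  have hL : L.det ≠ 0 := det_fderiv_transition_ne_zero S₁.isSmoothChart S₂.isSmoothChart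
    (S₁.chart.map_source hx1) (by rwa [S₁.chart.left_inv hx1])
  have hM : M.det ≠ 0 := det_fderiv_transition_ne_zero S₃.isSmoothChart S₂.isSmoothChart
    (S₃.chart.map_source hx3) (by rwa [S₃.chart.left_inv hx3])
  have h1 := S₁.symbol_canonicalCoord_eq S₂.isSmoothChart hx1 hx
  have h3 := S₃.symbol_canonicalCoord_eq S₂.isSmoothChart hx3 hx
  have c1 := contDiff_and_hasCompactSupport_of_comp_adjoint hL
    (S₁.isLocalSymbol.contDiff_slice _) (S₁.isLocalSymbol.hasCompactSupport_slice _) h1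
  have c3 := contDiff_and_hasCompactSupport_of_comp_adjoint hM
    (S₃.isLocalSymbol.contDiff_slice _) (S₃.isLocalSymbol.hasCompactSupport_slice _) h3
  have key := integral_fourier_trilinear_comp c1.1 c1.2
    (S₂.isLocalSymbol.contDiff_slice (S₂.chart x))
    (S₂.isLocalSymbol.hasCompactSupport_slice (S₂.chart x)) c3.1 c3.2 hL hM h1 h3
  have hr1 := (hμ.pos _ S₁.isSmoothChart _ (S₁.chart.map_source hx1)).ne'
  have hr3 := (hμ.pos _ S₃.isSmoothChart _ (S₃.chart.map_source hx3)).ne'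
  have hlim : ∀ s r, limitIntegrand S₁ S₂ S₃ ρ x s r =
      (((ρ S₂.chart (S₂.chart x))⁻¹ : ℝ) : ℂ) * (𝓕 (S₁.coordSymbol (S₁.chart x)) s *
        𝓕 (S₂.coordSymbol (S₂.chart x)) (M r - L s) *
        (starRingEnd ℂ) (𝓕 (S₃.coordSymbol (S₃.chart x)) r)) := by
    intro s r
    rw [limitIntegrand, S₁.pieceWeight_sq_mul_fourier hμ hx1, S₂.pieceWeight_sq_mul_fourier hμ hx,
      S₃.pieceWeight_sq_mul_fourier hμ hx3, ← mul_assoc (ρ S₁.chart _ : ℂ),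
      ← mul_assoc (ρ S₃.chart _ : ℂ), ← Complex.ofReal_mul, ← Complex.ofReal_mul,
      mul_inv_cancel₀ hr1, mul_inv_cancel₀ hr3, Complex.ofReal_one, one_mul, one_mul]
    ring
  simp_rw [hlim, integral_const_mul]
  rw [key]
  congr 1
  refine integral_congr_ae (ae_of_all _ fun ξ => ?_)
  simp only [tripleSymbol]
  rw [LocalizedSymbol.coordSymbol, hloc]

theorem integral_integral_limitIntegrand (hμ : IsSmoothMeasure μ ρ) :
    ∫ x, ∫ s, ∫ r, limitIntegrand S₁ S₂ S₃ ρ x s r ∂volume ∂volume ∂μ =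
      ∫ p, tripleSymbol S₁ S₂ S₃ p ∂(liouville d Z) := by
  have hb := isTestSymbol_tripleSymbol S₁ S₂ S₃
  have hbs := tsupport_tripleSymbol_subset S₁ S₂ S₃
  have hloc := isLocalSymbol_localSymbol S₂.isSmoothChart hb hbs
  set G : Z → ℂ := fun x => ∫ s, ∫ r, limitIntegrand S₁ S₂ S₃ ρ x s r with hG
  have hG0 : ∀ x, x ∉ S₂.chart.source → G x = 0 := by
    intro x hx
    simp [hG, limitIntegrand, S₂.isCutoff.pieceWeight_eq_zero hx]
  have hG1 : ContinuousOn G S₂.chart.source := by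
    have hc : Continuous (fun u : Euc d =>
        ∫ ξ, localSymbol S₂.chart (tripleSymbol S₁ S₂ S₃) u ξ) := by
      have h1 := hloc.continuous_fourier.comp (continuous_id.prodMk (continuous_const (y := 0)))
      refine h1.congr fun u => ?_
      rw [Function.comp_apply, Real.fourier_eq']
      simp
    have h2 : ContinuousOn (fun x => (((ρ S₂.chart (S₂.chart x))⁻¹ : ℝ) : ℂ) *
        ∫ ξ, localSymbol S₂.chart (tripleSymbol S₁ S₂ S₃) (S₂.chart x) ξ) S₂.chart.source := by
      refine ContinuousOn.mul ?_ (hc.comp_continuousOn S₂.chart.continuousOn)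
      refine Complex.continuous_ofReal.comp_continuousOn (ContinuousOn.inv₀ ?_ fun x hx => ?_)
      · exact (hμ.smooth _ S₂.isSmoothChart).continuousOn.comp S₂.chart.continuousOn
          S₂.chart.mapsTo
      · exact (hμ.pos _ S₂.isSmoothChart _ (S₂.chart.map_source hx)).ne'
    exact h2.congr fun x hx => integral_limitIntegrand S₁ S₂ S₃ hμ hx
  rw [(integrable_and_integral_liouville_eq S₂.isSmoothChart hb hbs).2,
    ← setIntegral_eq_integral_of_forall_compl_eq_zero hG0,
    hμ.integral_source_eq S₂.isSmoothChart
      (hG1.aestronglyMeasurable S₂.chart.open_source.measurableSet)]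
  have h0 : ∀ u, u ∉ S₂.chart.target →
      ∫ ξ, localSymbol S₂.chart (tripleSymbol S₁ S₂ S₃) u ξ = 0 := by
    intro u hu
    simp [localSymbol, indicator_of_notMem hu]
  rw [← setIntegral_eq_integral_of_forall_compl_eq_zero h0]
  refine setIntegral_congr_fun S₂.chart.open_target.measurableSet fun u hu => ?_
  have h3 := integral_limitIntegrand S₁ S₂ S₃ hμ (S₂.chart.map_target hu)
  rw [S₂.chart.right_inv hu] at h3
  simp only [hG]
  rw [h3, ← mul_assoc, ← Complex.ofReal_mul, mul_inv_cancel₀ (hμ.pos _ S₂.isSmoothChart _ hu).ne',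
    Complex.ofReal_one, one_mul]

end Trilinear

/-! ### Sums of Hilbert–Schmidt kernels and negligible traces -/

section SchmidtSum

variable {Z : Type*} [MeasurableSpace Z] {μ : Measure Z} [SFinite μ]

omit [SFinite μ] in
theorem IsSchmidtKernel.zero : IsSchmidtKernel μ (fun _ _ : Z => (0 : ℂ)) :=
  ⟨measurable_const, by simp [hsNormSq]⟩

theorem IsSchmidtKernel.add {K K' : Z → Z → ℂ} (hK : IsSchmidtKernel μ K)
    (hK' : IsSchmidtKernel μ K') : IsSchmidtKernel μ (fun z z' => K z z' + K' z z') := by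
  refine ⟨hK.1.add hK'.1, ?_⟩
  have hsq : ∀ a b : ℝ≥0∞, (a + b) ^ 2 ≤ 4 * (a ^ 2 + b ^ 2) := by
    intro a b
    rcases le_total a b with h | h
    · calc (a + b) ^ 2 ≤ (b + b) ^ 2 := by gcongr
        _ = 4 * b ^ 2 := by ring
        _ ≤ _ := by gcongr; exact le_add_self
    · calc (a + b) ^ 2 ≤ (a + a) ^ 2 := by gcongr
        _ = 4 * a ^ 2 := by ring
        _ ≤ _ := by gcongr; exact le_self_add
  have hm : Measurable fun q : Z × Z => ‖Function.uncurry K q‖ₑ ^ 2 := hK.1.enorm.pow_const 2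
  have hL : Measurable fun x => ∫⁻ y, ‖K x y‖ₑ ^ 2 ∂μ := hm.lintegral_prod_right'
  calc hsNormSq μ (fun z z' => K z z' + K' z z')
      ≤ ∫⁻ x, ∫⁻ y, 4 * (‖K x y‖ₑ ^ 2 + ‖K' x y‖ₑ ^ 2) ∂μ ∂μ := by
        refine lintegral_mono fun x => lintegral_mono fun y => ?_
        refine le_trans ?_ (hsq _ _)
        dsimp only
        gcongr
        exact enorm_add_le _ _
    _ = 4 * (hsNormSq μ K + hsNormSq μ K') := by
        rw [hsNormSq, hsNormSq, ← lintegral_add_left hL,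
          ← lintegral_const_mul' _ _ (by simp)]
        refine lintegral_congr fun x => ?_
        rw [lintegral_const_mul' _ _ (by simp),
          lintegral_add_left (hK.1.of_uncurry_left.enorm.pow_const 2)]
    _ < ⊤ := ENNReal.mul_lt_top (by simp) (ENNReal.add_lt_top.2 ⟨hK.2, hK'.2⟩)

theorem IsSchmidtKernel.sum {ι : Type*} {K : ι → Z → Z → ℂ} (J : Finset ι)
    (hK : ∀ j, IsSchmidtKernel μ (K j)) : IsSchmidtKernel μ (fun z z' => ∑ j ∈ J, K j z z') := by
  classical
  induction J using Finset.induction_on with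
  | empty => simpa using IsSchmidtKernel.zero
  | insert j J hj ih =>
    simp_rw [Finset.sum_insert hj]
    exact (hK j).add ih

theorem IsSchmidtKernel.sub {K K' : Z → Z → ℂ} (hK : IsSchmidtKernel μ K)
    (hK' : IsSchmidtKernel μ K') : IsSchmidtKernel μ (fun z z' => K z z' - K' z z') := by
  have h : IsSchmidtKernel μ (fun z z' => -K' z z') :=
    ⟨hK'.1.neg, by simpa [hsNormSq] using hK'.2⟩
  simpa only [sub_eq_add_neg] using hK.add h

/-- A trace with three Hilbert–Schmidt factors is negligible when the product of their norms is. -/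
theorem tendsto_mul_integral_traceIntegrand_zero {A₁ A₂ A₃ : ℝ → Z → Z → ℂ} {c : ℝ → ℝ}
    (h₁ : ∀ h, 0 < h → IsSchmidtKernel μ (A₁ h)) (h₂ : ∀ h, 0 < h → IsSchmidtKernel μ (A₂ h))
    (h₃ : ∀ h, 0 < h → IsSchmidtKernel μ (A₃ h))
    (hlim : Tendsto (fun h => ‖c h‖ₑ ^ 2 * (hsNormSq μ (A₁ h) * (hsNormSq μ (A₂ h) *
      hsNormSq μ (A₃ h)))) (𝓝[>] 0) (𝓝 0)) :
    Tendsto (fun h => (c h : ℂ) * ∫ p, traceIntegrand (A₁ h) (A₂ h) (A₃ h) p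
      ∂(μ.prod (μ.prod μ))) (𝓝[>] 0) (𝓝 0) := by
  have hle : ∀ᶠ h : ℝ in 𝓝[>] 0, ‖(c h : ℂ) * ∫ p, traceIntegrand (A₁ h) (A₂ h) (A₃ h) p
      ∂(μ.prod (μ.prod μ))‖ₑ ^ 2 ≤ ‖c h‖ₑ ^ 2 * (hsNormSq μ (A₁ h) * (hsNormSq μ (A₂ h) *
      hsNormSq μ (A₃ h))) := by
    filter_upwards [self_mem_nhdsWithin] with h hh
    have hc : ‖(c h : ℂ)‖ₑ = ‖c h‖ₑ := by
      rw [← ofReal_norm, ← ofReal_norm, Complex.norm_real]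
    rw [enorm_mul, mul_pow, hc]
    gcongr
    refine le_trans ?_ (lintegral_traceIntegrand_sq_le (h₁ h hh).1 (h₂ h hh).1 (h₃ h hh).1)
    gcongr
    exact enorm_integral_le_lintegral_enorm _
  have h2 := tendsto_of_tendsto_of_tendsto_of_le_of_le' tendsto_const_nhds hlim
    (Eventually.of_forall fun _ => zero_le) hle
  have h3 := (ENNReal.continuous_rpow_const (y := (2 : ℝ)⁻¹)).tendsto 0 |>.comp h2
  rw [ENNReal.zero_rpow_of_pos (by norm_num)] at h3
  rw [tendsto_zero_iff_enorm_tendsto_zero]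
  refine h3.congr fun h => ?_
  rw [Function.comp_apply, ← ENNReal.rpow_natCast, ← ENNReal.rpow_mul]
  norm_num

end SchmidtSum

/-! ### The limit of the trace for localized symbols -/

section FullKernels

variable {d : ℕ} {Z : Type*} [TopologicalSpace Z] [ChartedSpace (Euc d) Z]
  [IsManifold 𝓘(ℝ, Euc d) ∞ Z] {ρ : Chart d Z → Euc d → ℝ} [MeasurableSpace Z] [BorelSpace Z]
  {μ : Measure Z} [SFinite μ]

/-- Of three squared norms, one tends to zero and the two others are `O(h^{-d})`, for which the
factor `h^{2d}` compensates. -/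
theorem tendsto_sq_mul_zero {r u v : ℝ → ℝ≥0∞} {C C' : ℝ} (hr : Tendsto r (𝓝[>] 0) (𝓝 0))
    (hu : ∀ h, 0 < h → u h ≤ ENNReal.ofReal ((h ^ d)⁻¹ * C))
    (hv : ∀ h, 0 < h → v h ≤ ENNReal.ofReal ((h ^ d)⁻¹ * C')) :
    Tendsto (fun h : ℝ => ‖h ^ d‖ₑ ^ 2 * (r h * (u h * v h))) (𝓝[>] 0) (𝓝 0) := by
  have h1 : Tendsto (fun h => r h * (ENNReal.ofReal C * ENNReal.ofReal C')) (𝓝[>] 0) (𝓝 0) := by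
    have := ENNReal.Tendsto.mul_const hr (b := ENNReal.ofReal C * ENNReal.ofReal C')
      (Or.inr (ENNReal.mul_ne_top ENNReal.ofReal_ne_top ENNReal.ofReal_ne_top))
    rwa [zero_mul] at this
  refine tendsto_of_tendsto_of_tendsto_of_le_of_le' tendsto_const_nhds h1
    (Eventually.of_forall fun _ => zero_le) ?_
  filter_upwards [self_mem_nhdsWithin] with h hh
  have hh' : (0 : ℝ) < h := hh
  have hpow : (0 : ℝ) < h ^ d := by positivity
  have key : ∀ {w : ℝ≥0∞} {D : ℝ}, w ≤ ENNReal.ofReal ((h ^ d)⁻¹ * D) →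
      ‖h ^ d‖ₑ * w ≤ ENNReal.ofReal D := by
    intro w D hw
    calc ‖h ^ d‖ₑ * w ≤ ENNReal.ofReal (h ^ d) * ENNReal.ofReal ((h ^ d)⁻¹ * D) := by
          rw [Real.enorm_eq_ofReal hpow.le]; gcongr
      _ = ENNReal.ofReal D := by
          rw [← ENNReal.ofReal_mul hpow.le, ← mul_assoc, mul_inv_cancel₀ hpow.ne', one_mul]
  calc ‖h ^ d‖ₑ ^ 2 * (r h * (u h * v h)) = r h * ((‖h ^ d‖ₑ * u h) * (‖h ^ d‖ₑ * v h)) := by ring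
    _ ≤ r h * (ENNReal.ofReal C * ENNReal.ofReal C') := by
        gcongr
        · exact key (hu h hh)
        · exact key (hv h hh)

/-- The semiclassical limit of the trace of three localized operators. -/
theorem tendsto_integral_traceIntegrand_kernel [T2Space Z] (S₁ S₂ S₃ : LocalizedSymbol d Z)
    (hμ : IsSmoothMeasure μ ρ) :
    Tendsto (fun h => ((h ^ d : ℝ) : ℂ) * ∫ p, traceIntegrand (S₁.kernel ρ h)
        (S₂.kernel ρ h) (S₃.kernel ρ h) p ∂(μ.prod (μ.prod μ))) (𝓝[>] 0)
      (𝓝 (∫ p, tripleSymbol S₁ S₂ S₃ p ∂(liouville d Z))) := by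
  have K := fun (S : LocalizedSymbol d Z) h (hh : 0 < h) => S.isSchmidtKernel_kernel hμ hh
  have N := fun (S : LocalizedSymbol d Z) h (hh : 0 < h) => S.isSchmidtKernel_nearKernel hμ hh
  set R : LocalizedSymbol d Z → ℝ → Z → Z → ℂ :=
    fun S h z z' => S.kernel ρ h z z' - S.nearKernel ρ h z z' with hRdef
  have R' : ∀ (S : LocalizedSymbol d Z) h, 0 < h → IsSchmidtKernel μ (R S h) :=
    fun S h hh => (K S h hh).sub (N S h hh)
  have hR : ∀ S : LocalizedSymbol d Z, Tendsto (fun h => hsNormSq μ (R S h)) (𝓝[>] 0) (𝓝 0) :=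
    fun S => S.tendsto_hsNormSq_sub hμ
  obtain ⟨C₁, -, hb₁⟩ := S₁.exists_hsNormSq_kernel_le hμ
  obtain ⟨C₂, -, hb₂⟩ := S₂.exists_hsNormSq_kernel_le hμ
  obtain ⟨C₃, -, hb₃⟩ := S₃.exists_hsNormSq_kernel_le hμ
  -- the kernels are replaced one after the other by their parts near the diagonal
  have t₁ := tendsto_mul_integral_traceIntegrand_zero (c := fun h => h ^ d) (R' S₁) (K S₂) (K S₃)
    (tendsto_sq_mul_zero (hR S₁) (fun h hh => (hb₂ h hh).1) (fun h hh => (hb₃ h hh).1))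
  have t₂ := tendsto_mul_integral_traceIntegrand_zero (c := fun h => h ^ d) (N S₁) (R' S₂) (K S₃)
    ((tendsto_sq_mul_zero (hR S₂) (fun h hh => (hb₁ h hh).2) (fun h hh => (hb₃ h hh).1)).congr
      fun h => by ring)
  have t₃ := tendsto_mul_integral_traceIntegrand_zero (c := fun h => h ^ d) (N S₁) (N S₂) (R' S₃)
    ((tendsto_sq_mul_zero (hR S₃) (fun h hh => (hb₁ h hh).2) (fun h hh => (hb₂ h hh).2)).congr
      fun h => by ring)
  have t₀ := tendsto_integral_traceIntegrand_nearKernel S₁ S₂ S₃ hμ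
  rw [integral_integral_limitIntegrand S₁ S₂ S₃ hμ] at t₀
  have t := ((t₁.add t₂).add t₃).add t₀
  rw [add_zero, add_zero, zero_add] at t
  refine t.congr' ?_
  filter_upwards [self_mem_nhdsWithin] with h hh
  rw [← mul_add, ← mul_add, ← mul_add]
  congr 1
  have i₁ := integrable_traceIntegrand (R' S₁ h hh) (K S₂ h hh) (K S₃ h hh)
  have i₂ := integrable_traceIntegrand (N S₁ h hh) (R' S₂ h hh) (K S₃ h hh)
  have i₃ := integrable_traceIntegrand (N S₁ h hh) (N S₂ h hh) (R' S₃ h hh)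
  have i₀ := integrable_traceIntegrand (N S₁ h hh) (N S₂ h hh) (N S₃ h hh)
  have hsum : traceIntegrand (S₁.kernel ρ h) (S₂.kernel ρ h) (S₃.kernel ρ h) =
      traceIntegrand (R S₁ h) (S₂.kernel ρ h) (S₃.kernel ρ h) +
        traceIntegrand (S₁.nearKernel ρ h) (R S₂ h) (S₃.kernel ρ h) +
        traceIntegrand (S₁.nearKernel ρ h) (S₂.nearKernel ρ h) (R S₃ h) +
        traceIntegrand (S₁.nearKernel ρ h) (S₂.nearKernel ρ h) (S₃.nearKernel ρ h) := by
    ext p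
    simp only [traceIntegrand, hRdef, Pi.add_apply, map_sub]
    ring
  rw [hsum, integral_add' ((i₁.add i₂).add i₃) i₀, integral_add' (i₁.add i₂) i₃,
    integral_add' i₁ i₂]

end FullKernels

/-! ### The quantization on the manifold -/

section Quantization

variable {d : ℕ} {Z : Type*} [TopologicalSpace Z] [ChartedSpace (Euc d) Z]
  [IsManifold 𝓘(ℝ, Euc d) ∞ Z] {ρ : Chart d Z → Euc d → ℝ} {ι : Type*}
  (Q : QuantizationAtlas d Z ι)

/-- The `j`-th piece `ψ_j a` of a symbol. -/
def QuantizationAtlas.piece {a : CotangentBundle d Z → ℂ} (ha : IsTestSymbol a) (j : ι) :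
    LocalizedSymbol d Z where
  chart := Q.chart j
  isSmoothChart := Q.isSmoothChart j
  χ := Q.χ j
  isCutoff := ⟨(Q.χ_smooth j).continuous, Q.χ_support j, Q.χ_mem j⟩
  symbol := fun p => (Q.ψ j p.proj : ℂ) * a p
  isTestSymbol := ha.base_mul (Q.ψ j).contMDiff
  tsupport_subset := (tsupport_base_mul_subset a (Q.ψ j)).trans fun _ hp => Q.ψ_subordinate j hp
  χ_eq_one := fun p hp => Q.χ_eq_one j p.proj (subset_tsupport _ fun h => hp (by simp [h]))

/-- Only finitely many pieces of a compactly supported symbol do not vanish. -/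
theorem QuantizationAtlas.finite_pieces {a : CotangentBundle d Z → ℂ} (ha : IsTestSymbol a) :
    {j | ∃ p : CotangentBundle d Z, (Q.ψ j p.proj : ℂ) * a p ≠ 0}.Finite := by
  have hC : IsCompact ((fun p : CotangentBundle d Z => p.proj) '' tsupport a) :=
    ha.2.isCompact.image continuous_proj_cotangentBundle
  refine (Q.ψ.locallyFinite.finite_nonempty_inter_compact hC).subset ?_
  rintro j ⟨p, hp⟩
  refine ⟨p.proj, fun h => hp (by simp [h]), p, subset_tsupport _ fun h => hp (by simp [h]), rfl⟩

theorem QuantizationAtlas.opKernel_eq_sum {a : CotangentBundle d Z → ℂ} (ha : IsTestSymbol a)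
    {J : Finset ι} (hJ : ∀ j, (∃ p : CotangentBundle d Z, (Q.ψ j p.proj : ℂ) * a p ≠ 0) → j ∈ J)
    (ε : ℝ) (z z' : Z) :
    opKernel Q ρ ε a z z' = ∑ j ∈ J, (Q.piece ha j).kernel ρ (2 * Real.pi * ε) z z' := by
  have hterm : ∀ j, ((Q.χ j z * Q.χ j z' *
      (Real.sqrt (ρ (Q.chart j) (Q.chart j z)))⁻¹ *
      (Real.sqrt (ρ (Q.chart j) (Q.chart j z')))⁻¹ : ℝ) : ℂ) *
    weylKernel ε (localSymbol (Q.chart j) (fun p => (Q.ψ j p.proj : ℂ) * a p))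
      (Q.chart j z) (Q.chart j z') = (Q.piece ha j).kernel ρ (2 * Real.pi * ε) z z' := by
    intro j
    rw [weylKernel_eq_scaledKernel]
    simp only [LocalizedSymbol.kernel, pieceKernel, pieceWeight, LocalizedSymbol.coordSymbol,
      QuantizationAtlas.piece]
    congr 2
    ring
  rw [opKernel]
  simp_rw [hterm]
  refine finsum_eq_sum_of_support_subset _ fun j hj => ?_
  by_contra hjJ
  have h0 : ∀ p : CotangentBundle d Z, (Q.ψ j p.proj : ℂ) * a p = 0 := by
    intro p
    by_contra h
    exact hjJ (hJ j ⟨p, h⟩)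
  refine hj ?_
  have h1 : ∀ x, (Q.piece ha j).coordSymbol x = 0 := by
    intro x
    ext ξ
    simp only [LocalizedSymbol.coordSymbol, localSymbol, QuantizationAtlas.piece, h0]
    simp
  simp [LocalizedSymbol.kernel, pieceKernel, scaledKernel, h1, fourier_zero_fun]

theorem QuantizationAtlas.sum_pieces {a : CotangentBundle d Z → ℂ} (ha : IsTestSymbol a)
    {J : Finset ι} (hJ : ∀ j, (∃ p : CotangentBundle d Z, (Q.ψ j p.proj : ℂ) * a p ≠ 0) → j ∈ J)
    (p : CotangentBundle d Z) : ∑ j ∈ J, (Q.piece ha j).symbol p = a p := by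
  simp only [QuantizationAtlas.piece]
  rw [← Finset.sum_mul]
  by_cases hp : a p = 0
  · rw [hp, mul_zero]
  have h1 : ∑ᶠ j, Q.ψ j p.proj = 1 := Q.ψ.sum_eq_one (mem_univ _)
  rw [finsum_eq_sum_of_support_subset (s := J)] at h1
  · rw [← Complex.ofReal_sum, h1, Complex.ofReal_one, one_mul]
  · intro j hj
    exact hJ j ⟨p, mul_ne_zero (Complex.ofReal_ne_zero.2 hj) hp⟩

variable [MeasurableSpace Z] [BorelSpace Z] {μ : Measure Z} [SFinite μ]

theorem QuantizationAtlas.isSchmidtKernel_opKernel (hμ : IsSmoothMeasure μ ρ)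
    {a : CotangentBundle d Z → ℂ} (ha : IsTestSymbol a) {ε : ℝ} (hε : 0 < ε) :
    IsSchmidtKernel μ (opKernel Q ρ ε a) := by
  have h := IsSchmidtKernel.sum (Q.finite_pieces ha).toFinset fun j =>
    (Q.piece ha j).isSchmidtKernel_kernel hμ (h := 2 * Real.pi * ε) (by positivity)
  convert h using 1
  ext z z'
  exact Q.opKernel_eq_sum ha (fun j hj => (Q.finite_pieces ha).mem_toFinset.2 hj) ε z z'

theorem hasKernel_opε (hμ : IsSmoothMeasure μ ρ)
    {a : CotangentBundle d Z → ℂ} (ha : IsTestSymbol a) {ε : ℝ} (hε : 0 < ε) :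
    HasKernel μ (opKernel Q ρ ε a) (opε Q μ ρ ε a) := by
  have h := (Q.isSchmidtKernel_opKernel hμ ha hε).exists_hasKernel
  rw [opε, kernelOperator, dif_pos h]
  exact h.choose_spec

/-- The semiclassical limit of the trace `Tr(Op_ε(a) Op_ε(n) Op_ε(n)^*)`. -/
theorem tendsto_integral_traceIntegrand_opKernel [T2Space Z] (hμ : IsSmoothMeasure μ ρ)
    {a n : CotangentBundle d Z → ℂ} (ha : IsTestSymbol a) (hn : IsTestSymbol n) :
    Integrable (fun p => a p * ((‖n p‖ ^ 2 : ℝ) : ℂ)) (liouville d Z) ∧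
    Tendsto (fun ε : ℝ => (((2 * Real.pi * ε) ^ d : ℝ) : ℂ) *
      ∫ p, traceIntegrand (opKernel Q ρ ε a) (opKernel Q ρ ε n) (opKernel Q ρ ε n) p
        ∂(μ.prod (μ.prod μ))) (𝓝[>] 0)
      (𝓝 (∫ p, a p * ((‖n p‖ ^ 2 : ℝ) : ℂ) ∂(liouville d Z))) := by
  classical
  -- the indices of the pieces of `a` and `n` that do not vanish
  set J := (Q.finite_pieces ha).toFinset ∪ (Q.finite_pieces hn).toFinset with hJdef
  have hJa : ∀ j, (∃ p : CotangentBundle d Z, (Q.ψ j p.proj : ℂ) * a p ≠ 0) → j ∈ J := fun j hj =>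
    Finset.mem_union_left _ ((Q.finite_pieces ha).mem_toFinset.2 hj)
  have hJn : ∀ j, (∃ p : CotangentBundle d Z, (Q.ψ j p.proj : ℂ) * n p ≠ 0) → j ∈ J := fun j hj =>
    Finset.mem_union_right _ ((Q.finite_pieces hn).mem_toFinset.2 hj)
  set A := fun j => Q.piece ha j
  set N := fun j => Q.piece hn j
  have hsym : ∀ p, a p * ((‖n p‖ ^ 2 : ℝ) : ℂ) =
      ∑ j ∈ J, ∑ k ∈ J, ∑ l ∈ J, tripleSymbol (A j) (N k) (N l) p := by
    intro p
    have h1 : ((‖n p‖ ^ 2 : ℝ) : ℂ) = n p * (starRingEnd ℂ) (n p) := by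
      rw [Complex.mul_conj, Complex.normSq_eq_norm_sq]
    rw [h1, ← mul_assoc, ← Q.sum_pieces ha hJa p, ← Q.sum_pieces hn hJn p, Finset.sum_mul_sum,
      Finset.sum_mul, map_sum]
    refine Finset.sum_congr rfl fun j _ => ?_
    rw [Finset.sum_mul_sum]
    rfl
  have hint : ∀ j k l, Integrable (tripleSymbol (A j) (N k) (N l)) (liouville d Z) := fun j k l =>
    (integrable_and_integral_liouville_eq (N k).isSmoothChart
      (isTestSymbol_tripleSymbol (A j) (N k) (N l))
      (tsupport_tripleSymbol_subset (A j) (N k) (N l))).1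
  simp_rw [hsym]
  refine ⟨integrable_finsetSum _ fun j _ => integrable_finsetSum _ fun k _ =>
    integrable_finsetSum _ fun l _ => hint j k l, ?_⟩
  rw [integral_finsetSum _ fun j _ => integrable_finsetSum _ fun k _ =>
    integrable_finsetSum _ fun l _ => hint j k l]
  simp_rw [integral_finsetSum _ fun k _ => integrable_finsetSum J fun l _ => hint _ k l,
    integral_finsetSum _ fun l _ => hint _ _ l]
  have hscale : Tendsto (fun ε : ℝ => 2 * Real.pi * ε) (𝓝[>] 0) (𝓝[>] 0) := by
    refine tendsto_nhdsWithin_iff.2 ⟨?_, ?_⟩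
    · have hc : Continuous (fun ε : ℝ => 2 * Real.pi * ε) := by fun_prop
      have := (hc.tendsto 0).mono_left (nhdsWithin_le_nhds (s := Ioi 0))
      simpa using this
    · filter_upwards [self_mem_nhdsWithin] with ε hε
      have : (0 : ℝ) < ε := hε
      exact mem_Ioi.2 (by positivity)
  have hlim := tendsto_finsetSum J fun j _ => tendsto_finsetSum J fun k _ =>
    tendsto_finsetSum J fun l _ =>
      (tendsto_integral_traceIntegrand_kernel (A j) (N k) (N l) hμ).comp hscale
  refine hlim.congr' ?_
  filter_upwards [self_mem_nhdsWithin] with ε hε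
  have hε' : (0 : ℝ) < ε := hε
  have hh : 0 < 2 * Real.pi * ε := by positivity
  have hexp : ∀ p, traceIntegrand (opKernel Q ρ ε a) (opKernel Q ρ ε n) (opKernel Q ρ ε n) p =
      ∑ j ∈ J, ∑ k ∈ J, ∑ l ∈ J, traceIntegrand ((A j).kernel ρ (2 * Real.pi * ε))
        ((N k).kernel ρ (2 * Real.pi * ε)) ((N l).kernel ρ (2 * Real.pi * ε)) p := by
    intro p
    simp only [traceIntegrand]
    rw [Q.opKernel_eq_sum ha hJa, Q.opKernel_eq_sum hn hJn, Q.opKernel_eq_sum hn hJn,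
      Finset.sum_mul_sum, Finset.sum_mul, map_sum]
    refine Finset.sum_congr rfl fun j _ => ?_
    rw [Finset.sum_mul_sum]
  have hi : ∀ j k l, Integrable (traceIntegrand ((A j).kernel ρ (2 * Real.pi * ε))
        ((N k).kernel ρ (2 * Real.pi * ε)) ((N l).kernel ρ (2 * Real.pi * ε)))
      (μ.prod (μ.prod μ)) := fun j k l =>
    integrable_traceIntegrand ((A j).isSchmidtKernel_kernel hμ hh)
      ((N k).isSchmidtKernel_kernel hμ hh) ((N l).isSchmidtKernel_kernel hμ hh)
  simp_rw [hexp]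
  rw [integral_finsetSum _ fun j _ => integrable_finsetSum _ fun k _ =>
    integrable_finsetSum _ fun l _ => hi j k l]
  simp_rw [integral_finsetSum _ fun k _ => integrable_finsetSum J fun l _ => hi _ k l,
    integral_finsetSum _ fun l _ => hi _ _ l, Finset.mul_sum, Function.comp_apply]

end Quantization

end WignerNoise

end

theorem mainTheorem7 {d : ℕ} {Z : Type*} [TopologicalSpace Z] [T2Space Z]
    [SecondCountableTopology Z] [ChartedSpace (WignerNoise.Euc d) Z]
    [IsManifold 𝓘(ℝ, WignerNoise.Euc d) ∞ Z] [MeasurableSpace Z] [BorelSpace Z]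
    (μ : Measure Z) (ρ : WignerNoise.Chart d Z → WignerNoise.Euc d → ℝ)
    (hμ : WignerNoise.IsSmoothMeasure μ ρ)
    {ι : Type*} (Q : WignerNoise.QuantizationAtlas d Z ι)
    {Ω : Type*} [MeasurableSpace Ω] (P : Measure Ω) [IsProbabilityMeasure P]
    (w : Lp ℂ 2 μ → Ω → ℂ) (hw : WignerNoise.IsWhiteNoise P w)
    (n : WignerNoise.CotangentBundle d Z → ℂ) (hn : WignerNoise.IsTestSymbol n) :
    -- the operators `Op_ε(a)` are well defined on `L²(Z)` by their kernels
    (∀ a, WignerNoise.IsTestSymbol a → ∀ ε : ℝ, 0 < ε →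
      WignerNoise.HasKernel μ (WignerNoise.opKernel Q ρ ε a) (WignerNoise.opε Q μ ρ ε a)) ∧
    -- the random field `Op_ε(n) w` takes its values in `L²(Z)`
    (∀ ε : ℝ, 0 < ε → ∃ F : Ω → Lp ℂ 2 μ,
      WignerNoise.IsImage P w (WignerNoise.opε Q μ ρ ε n) F) ∧
    -- its power spectrum is asymptotic to `(2πε)^{-d} |n|² |dx dξ|`
    ∀ f : ℝ → Ω → Lp ℂ 2 μ,
      (∀ ε : ℝ, 0 < ε → WignerNoise.IsImage P w (WignerNoise.opε Q μ ρ ε n) (f ε)) →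
      ∀ a, WignerNoise.IsTestSymbol a →
        (∀ ε : ℝ, 0 < ε → Integrable (fun t => WignerNoise.wigner Q μ ρ ε (f ε t) a) P) ∧
        Integrable (fun p => a p * ((‖n p‖ ^ 2 : ℝ) : ℂ)) (WignerNoise.liouville d Z) ∧
        Tendsto
          (fun ε : ℝ => (((2 * Real.pi * ε) ^ d : ℝ) : ℂ) *
            WignerNoise.powerSpectrum Q μ ρ ε P (f ε) a)
          (𝓝[>] 0)
          (𝓝 (∫ p, a p * ((‖n p‖ ^ 2 : ℝ) : ℂ) ∂(WignerNoise.liouville d Z))) := by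
  have hfin := hμ.isLocallyFiniteMeasure
  have : Fact ((2 : ℝ≥0∞) ≠ ⊤) := ⟨by simp⟩
  have hK := fun a (ha : WignerNoise.IsTestSymbol a) (ε : ℝ) (hε : 0 < ε) =>
    Q.isSchmidtKernel_opKernel hμ ha hε
  have hA := fun a (ha : WignerNoise.IsTestSymbol a) (ε : ℝ) (hε : 0 < ε) =>
    WignerNoise.hasKernel_opε Q hμ ha hε
  obtain ⟨s, b, hs⟩ := WignerNoise.exists_countable_hilbertBasis (H := Lp ℂ 2 μ)
  refine ⟨hA, fun ε hε => hw.exists_isImage b _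
    ((hK n hn ε hε).summable_norm_adjoint_sq b (hA n hn ε hε)), fun f hf a ha => ?_⟩
  have hmean := fun (ε : ℝ) (hε : 0 < ε) =>
    WignerNoise.integral_inner_isImage hw b (hK a ha ε hε) (hA a ha ε hε) (hK n hn ε hε)
      (hA n hn ε hε) (hf ε hε)
  obtain ⟨hint, hlim⟩ := WignerNoise.tendsto_integral_traceIntegrand_opKernel Q hμ ha hn
  refine ⟨fun ε hε => (hmean ε hε).1, hint, hlim.congr' ?_⟩
  filter_upwards [self_mem_nhdsWithin] with ε hε
  rw [← (hmean ε hε).2]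
  rfl
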